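/- Polygons in the hyperbolic plane $H^2$ are given by their cyclic sequences of vertices $(v_1,\dots,v_n)$, $n\ge 3$, $v_{n+1}=v_1$, with $v_i\ne v_{i+1}$; the edges are the geodesic segments $[v_i,v_{i+1}]$. A polygon is \emph{convex} if its edges, traversed once, form a simple closed curve which is the boundary of a convex domain (a nonempty open convex subset of $H^2$), called its interior; angles equal to $\pi$ at vertices are allowed. The area of a convex polygon is the hyperbolic area of its interior. For $l=(l_1,\dots,l_n)$, let $\mathcal P^c_H(l)$ be the space of convex polygons in $H^2$ with $d(v_i,v_{i+1})=l_i$ for all $i$, up to global isometries of $H^2$ (orientation-reversing ones included), with the quotient of the topology given by the vertices. \textbf{Theorem.} Let $n\ge 3$ and let $l=(l_1,\dots,l_n)$ be such that $\mathcal P^c_H(l)$ is not empty. Then: \begin{enumerate} \item there is a unique element $p\in\mathcal P^c_H(l)$ whose vertices all lie on a circle, or on a horocycle, or on one connected component of the set of points at a fixed positive distance from a complete geodesic; \item this $p$ has maximal area among all elements of $\mathcal P^c_H(l)$; \item $\mathcal P^c_H(l)$ is connected. \end{enumerate} -/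

import Mathlib

open scoped UpperHalfPlane

/-- The hyperbolic plane is Mathlib's upper half-plane `ℍ`, with its hyperbolic distance `dist` and
its hyperbolic area measure `MeasureTheory.volume`, of density `1 / (im z) ^ 2`. -/
abbrev HypPlane : Type := ℍ

namespace HypPlane

/-! ### Segments, convexity and special curves -/

/-- The geodesic segment joining `x` to `y`: the points where the triangle inequality between
`x` and `y` is an equality. -/
def segment (x y : HypPlane) : Set HypPlane :=
  {z | dist x z + dist z y = dist x y}

/-- A set is convex if it contains the geodesic segment between any two of its points. -/
def IsConvex (D : Set HypPlane) : Prop :=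
  ∀ x ∈ D, ∀ y ∈ D, segment x y ⊆ D

/-- A complete geodesic: a vertical half-line, or a half-circle centred on the real axis. -/
def IsGeodesic (g : Set HypPlane) : Prop :=
  (∃ a : ℝ, g = {z | z.re = a}) ∨
  (∃ a r : ℝ, 0 < r ∧ g = {z | (z.re - a) ^ 2 + z.im ^ 2 = r ^ 2})

/-- A hyperbolic circle of positive radius. -/
def IsCircle (C : Set HypPlane) : Prop :=
  ∃ (c : HypPlane) (r : ℝ), 0 < r ∧ C = Metric.sphere c r

/-- A horocycle: a horizontal line (centred at infinity), or a Euclidean circle of diameter `k`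
tangent to the real axis at `a`, without its point of tangency. -/
def IsHorocycle (C : Set HypPlane) : Prop :=
  (∃ c : ℝ, 0 < c ∧ C = {z | z.im = c}) ∨
  (∃ a k : ℝ, 0 < k ∧ C = {z | (z.re - a) ^ 2 + z.im ^ 2 = k * z.im})

/-- One branch of an equidistant curve: a connected component of the set of points at a fixed
positive distance from a geodesic. -/
def IsEquidistantBranch (C : Set HypPlane) : Prop :=
  ∃ (g : Set HypPlane) (d : ℝ), IsGeodesic g ∧ 0 < d ∧
    ∃ x ∈ {z : HypPlane | Metric.infDist z g = d},
      C = connectedComponentIn {z : HypPlane | Metric.infDist z g = d} x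

/-! ### Polygons

A polygon is the cyclic sequence `p : Fin n → HypPlane` of its vertices; `finRotate n i` is the
index that follows `i` cyclically. -/

/-- The `i`-th edge of `p`, from `p i` to the next vertex. -/
def edge {n : ℕ} (p : Fin n → HypPlane) (i : Fin n) : Set HypPlane :=
  segment (p i) (p (finRotate n i))

/-- The closed curve traced by `p`: the union of its edges. -/
def curve {n : ℕ} (p : Fin n → HypPlane) : Set HypPlane :=
  ⋃ i, edge p i

/-- `p` is a simple polygon: consecutive vertices are distinct, and the edges, each without its
final vertex, are pairwise disjoint, so that the closed curve is traversed exactly once. -/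
def IsSimple {n : ℕ} (p : Fin n → HypPlane) : Prop :=
  (∀ i, p i ≠ p (finRotate n i)) ∧
  ∀ i j, i ≠ j →
    Disjoint (edge p i \ {p (finRotate n i)}) (edge p j \ {p (finRotate n j)})

/-- `D` is a convex domain (a nonempty open convex set) whose boundary is the curve of `p`.
When `p` is simple there is at most one such `D`, namely the interior of `p`. -/
def IsConvexInterior {n : ℕ} (p : Fin n → HypPlane) (D : Set HypPlane) : Prop :=
  D.Nonempty ∧ IsOpen D ∧ IsConvex D ∧ frontier D = curve p

/-- A convex polygon: a simple polygon that is the boundary of a convex domain. -/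
def IsConvexPolygon {n : ℕ} (p : Fin n → HypPlane) : Prop :=
  IsSimple p ∧ ∃ D, IsConvexInterior p D

/-- The convex polygons with edge lengths `l`, with the topology given by their vertices. -/
abbrev ConvexPolygon {n : ℕ} (l : Fin n → ℝ) : Type :=
  {p : Fin n → HypPlane // IsConvexPolygon p ∧ ∀ i, dist (p i) (p (finRotate n i)) = l i}

/-- Two polygons are congruent if a global isometry, which may reverse the orientation, carries
each vertex of the first to the corresponding vertex of the second. -/
def congruence {n : ℕ} (l : Fin n → ℝ) : Setoid (ConvexPolygon l) where
  r p q := ∃ g : HypPlane ≃ᵢ HypPlane, ∀ i, g (p.1 i) = q.1 i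
  iseqv :=
    { refl := fun _ => ⟨IsometryEquiv.refl _, fun _ => rfl⟩
      symm := by
        rintro p q ⟨g, hg⟩
        exact ⟨g.symm, fun i => by rw [← hg i, g.symm_apply_apply]⟩
      trans := by
        rintro p q r ⟨g, hg⟩ ⟨h, hh⟩
        exact ⟨g.trans h, fun i => by rw [← hh i, ← hg i]; rfl⟩ }

/-- The moduli space of convex polygons with edge lengths `l`, up to global isometries, with the
quotient topology. -/
abbrev ModuliSpace {n : ℕ} (l : Fin n → ℝ) : Type :=
  Quotient (congruence l)

/-- All vertices of `p` lie on one circle, one horocycle, or one branch of an equidistant curve. -/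
def IsInscribed {n : ℕ} (p : Fin n → HypPlane) : Prop :=
  ∃ C : Set HypPlane, (IsCircle C ∨ IsHorocycle C ∨ IsEquidistantBranch C) ∧ ∀ i, p i ∈ C

end HypPlane

/-! The plane is read in the hyperboloid model: `bil` of two points is the hyperbolic cosine of
their distance, and the sign of the volume `tri` of three points is their orientation. Up to a
reflection, a convex polygon is a periodic sequence whose cyclically ordered triples have
nonnegative volume (`CPoly`). The translation is made by `CPoly.isConvexPolygon` and
`IsConvexPolygon.cpoly_or`. `CPoly.volume_inner` writes the hyperbolic area as a sum of edge terms.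
For polygons, being inscribed in a circle, a horocycle or an equidistant branch means that the
vertices lie on an affine plane missing the origin (`Coplanar`), by `IsInscribed.coplanar` and
`CPoly.isInscribed`.

Three facts carry the theorem.

Rigidity (`CPoly.congruent_of_coplanar`): edge lengths determine a coplanar polygon. The half chords
sinh(d/2) satisfy Ptolemy's relation. Seen from the ends of the longest edge, the vertices become
points of a conic with one unknown parameter. The slopes of these points are strictly monotone in
the parameter, and the last slope must be 0, so only one parameter is possible.

Improvement (`CPoly.improvable`): arbitrarily close to a polygon that is not coplanar there is one
with the same edge lengths and larger area. The polygon is cut along a quadrilateral, the arcs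
outside it are moved rigidly, and a diagonal is varied. If all angles are less than π, the
derivative of the area is a nonzero multiple of the volume of the four vertices, so a suitable
quadrilateral improves. If some angle is π, convexity allows only one direction, but shortening the
diagonal by s² gains area of order s on the flat side and changes the other side only at order s².

Compactness (`exists_max`): after normalizing the first vertex, polygons with given edge lengths and
area at least A > 0 form a compact set, since the lower bound excludes collapse to a line. Hence
every nonempty clopen set of polygons that is saturated for congruence contains an area maximizer,
and improvement makes it coplanar.

Applied to all polygons, this gives existence and maximality of the inscribed polygon; rigidity
gives uniqueness. Two disjoint nonempty clopen sets of classes would each contain the unique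
inscribed class, so the moduli space is connected. -/

namespace HypPlane
open Filter Topology

/-! ### The hyperboloid model -/

/-- The vector of the hyperboloid `p * r - q ^ 2 = 1` that represents `z`. -/
noncomputable def vec (z : ℍ) : ℝ × ℝ × ℝ :=
  ((z.re ^ 2 + z.im ^ 2) / z.im, z.re / z.im, 1 / z.im)

/-- The Lorentzian bilinear form. -/
noncomputable def bil (u v : ℝ × ℝ × ℝ) : ℝ :=
  (u.1 * v.2.2 + u.2.2 * v.1) / 2 - u.2.1 * v.2.1

/-- The Lorentzian volume form, positive on positively oriented triples. -/
noncomputable def tri (u v w : ℝ × ℝ × ℝ) : ℝ :=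
  -(u.1 * (v.2.1 * w.2.2 - v.2.2 * w.2.1) - u.2.1 * (v.1 * w.2.2 - v.2.2 * w.1)
    + u.2.2 * (v.1 * w.2.1 - v.2.1 * w.1)) / 2

/-- The Lorentzian cross product. -/
noncomputable def crs (u v : ℝ × ℝ × ℝ) : ℝ × ℝ × ℝ :=
  (-(u.1 * v.2.1 - u.2.1 * v.1), (u.2.2 * v.1 - u.1 * v.2.2) / 2,
    -(u.2.1 * v.2.2 - u.2.2 * v.2.1))

/-- The open cone of future timelike vectors. -/
def Fut (v : ℝ × ℝ × ℝ) : Prop := 0 < v.2.2 ∧ 0 < bil v v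

lemma bil_comm (u v : ℝ × ℝ × ℝ) : bil u v = bil v u := by unfold bil; ring

lemma bil_add_left (u u' v : ℝ × ℝ × ℝ) : bil (u + u') v = bil u v + bil u' v := by
  simp only [bil, Prod.fst_add, Prod.snd_add]; ring

lemma bil_add_right (u v v' : ℝ × ℝ × ℝ) : bil u (v + v') = bil u v + bil u v' := by
  simp only [bil, Prod.fst_add, Prod.snd_add]; ring

lemma bil_smul_left (c : ℝ) (u v : ℝ × ℝ × ℝ) : bil (c • u) v = c * bil u v := by
  simp only [bil, Prod.smul_fst, Prod.smul_snd, smul_eq_mul]; ring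

lemma bil_smul_right (c : ℝ) (u v : ℝ × ℝ × ℝ) : bil u (c • v) = c * bil u v := by
  simp only [bil, Prod.smul_fst, Prod.smul_snd, smul_eq_mul]; ring

lemma bil_crs (u v w : ℝ × ℝ × ℝ) : bil (crs u v) w = tri u v w := by
  unfold bil crs tri; ring

lemma bil_crs_left (u v : ℝ × ℝ × ℝ) : bil (crs u v) u = 0 := by
  unfold bil crs; ring

lemma bil_crs_right (u v : ℝ × ℝ × ℝ) : bil (crs u v) v = 0 := by
  unfold bil crs; ring

lemma bil_crs_crs (u v : ℝ × ℝ × ℝ) :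
    bil (crs u v) (crs u v) = bil u u * bil v v - bil u v ^ 2 := by
  unfold bil crs; ring

lemma tri_rot (u v w : ℝ × ℝ × ℝ) : tri u v w = tri v w u := by unfold tri; ring

lemma tri_swap (u v w : ℝ × ℝ × ℝ) : tri u w v = -tri u v w := by unfold tri; ring

lemma tri_swap_left (u v w : ℝ × ℝ × ℝ) : tri v u w = -tri u v w := by unfold tri; ring

@[simp] lemma tri_self_left (u v : ℝ × ℝ × ℝ) : tri u u v = 0 := by unfold tri; ring

@[simp] lemma tri_self_right (u v : ℝ × ℝ × ℝ) : tri u v v = 0 := by unfold tri; ring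

@[simp] lemma tri_self_outer (u v : ℝ × ℝ × ℝ) : tri u v u = 0 := by unfold tri; ring

lemma tri_add_right (u v w w' : ℝ × ℝ × ℝ) : tri u v (w + w') = tri u v w + tri u v w' := by
  simp only [tri, Prod.fst_add, Prod.snd_add]; ring

lemma tri_smul_right (c : ℝ) (u v w : ℝ × ℝ × ℝ) : tri u v (c • w) = c * tri u v w := by
  simp only [tri, Prod.smul_fst, Prod.smul_snd, smul_eq_mul]; ring

lemma tri_add_mid (u v v' w : ℝ × ℝ × ℝ) : tri u (v + v') w = tri u v w + tri u v' w := by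
  simp only [tri, Prod.fst_add, Prod.snd_add]; ring

lemma tri_smul_mid (c : ℝ) (u v w : ℝ × ℝ × ℝ) : tri u (c • v) w = c * tri u v w := by
  simp only [tri, Prod.smul_fst, Prod.smul_snd, smul_eq_mul]; ring

lemma tri_add_left (u u' v w : ℝ × ℝ × ℝ) : tri (u + u') v w = tri u v w + tri u' v w := by
  simp only [tri, Prod.fst_add, Prod.snd_add]; ring

lemma tri_smul_left (c : ℝ) (u v w : ℝ × ℝ × ℝ) : tri (c • u) v w = c * tri u v w := by
  simp only [tri, Prod.smul_fst, Prod.smul_snd, smul_eq_mul]; ring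

/-- Gram determinant. The factor 1/2 in `tri` matches the determinant 1/4 of the form, which is
positive because the form has two negative squares. -/
lemma tri_sq (u v w : ℝ × ℝ × ℝ) : tri u v w ^ 2 =
    bil u u * bil v v * bil w w + 2 * bil u v * bil v w * bil u w
      - bil u u * bil v w ^ 2 - bil v v * bil u w ^ 2 - bil w w * bil u v ^ 2 := by
  unfold tri bil; ring

/-- Expansion of a vector in the basis `u, v, w`. -/
lemma tri_expand (u v w z : ℝ × ℝ × ℝ) :
    tri u v w • z = tri z v w • u + tri u z w • v + tri u v z • w := by
  obtain ⟨u1, u2, u3⟩ := u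
  obtain ⟨v1, v2, v3⟩ := v
  obtain ⟨w1, w2, w3⟩ := w
  obtain ⟨z1, z2, z3⟩ := z
  simp only [tri, Prod.smul_mk, smul_eq_mul, Prod.mk_add_mk, Prod.mk.injEq]
  refine ⟨?_, ?_, ?_⟩ <;> ring

/-- The Plücker relation for the pencil of lines through `o`. -/
lemma tri_plucker (o a b c d : ℝ × ℝ × ℝ) :
    tri o a b * tri o c d - tri o a c * tri o b d + tri o a d * tri o b c = 0 := by
  unfold tri; ring

/-- Expansion of a vector in the frame `u, v, crs u v`. -/
lemma frame_expand (u v z : ℝ × ℝ × ℝ) :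
    (bil u v ^ 2 - bil u u * bil v v) • z =
      (bil u v * bil v z - bil v v * bil u z) • u + (bil u v * bil u z - bil u u * bil v z) • v
        - tri u v z • crs u v := by
  obtain ⟨u1, u2, u3⟩ := u
  obtain ⟨v1, v2, v3⟩ := v
  obtain ⟨z1, z2, z3⟩ := z
  simp only [tri, bil, crs, Prod.smul_mk, smul_eq_mul, Prod.mk_add_mk, Prod.mk_sub_mk,
    Prod.mk.injEq]
  refine ⟨?_, ?_, ?_⟩ <;> ring

/-! ### Vectors of points -/

@[simp] lemma bil_vec_self (z : ℍ) : bil (vec z) (vec z) = 1 := by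
  have := z.im_pos
  simp only [bil, vec]; field_simp; ring

lemma vec_pos (z : ℍ) : 0 < (vec z).2.2 := by
  have := z.im_pos
  simp only [vec]; positivity

lemma fut_vec (z : ℍ) : Fut (vec z) := ⟨vec_pos z, by simp⟩

lemma bil_vec (z w : ℍ) :
    bil (vec z) (vec w) = 1 + ((z.re - w.re) ^ 2 + (z.im - w.im) ^ 2) / (2 * z.im * w.im) := by
  have := z.im_pos
  have := w.im_pos
  simp only [bil, vec]; field_simp; ring

lemma cosh_dist_eq (z w : ℍ) : Real.cosh (dist z w) = bil (vec z) (vec w) := by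
  rw [UpperHalfPlane.cosh_dist, bil_vec, Complex.dist_eq_re_im, Real.sq_sqrt (by positivity)]
  rfl

lemma one_le_bil (z w : ℍ) : 1 ≤ bil (vec z) (vec w) := by
  rw [← cosh_dist_eq]; exact Real.one_le_cosh _

lemma dist_eq_dist_iff (a b c d : ℍ) :
    dist a b = dist c d ↔ bil (vec a) (vec b) = bil (vec c) (vec d) := by
  rw [← cosh_dist_eq, ← cosh_dist_eq]
  refine ⟨fun h => by rw [h], fun h => ?_⟩
  have := Real.cosh_le_cosh.1 h.le
  have h2 := Real.cosh_le_cosh.1 h.ge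
  rw [abs_of_nonneg dist_nonneg, abs_of_nonneg dist_nonneg] at this h2
  exact le_antisymm this h2

lemma one_lt_bil {z w : ℍ} (h : z ≠ w) : 1 < bil (vec z) (vec w) := by
  rw [← cosh_dist_eq]; exact Real.one_lt_cosh.2 (dist_pos.2 h).ne'

lemma vec_injective : Function.Injective vec := by
  intro z w h
  by_contra hne
  have := one_lt_bil hne
  rw [h, bil_vec_self] at this
  exact lt_irrefl _ this

lemma continuous_vec : Continuous vec := by
  have h1 := UpperHalfPlane.continuous_re
  have h2 := UpperHalfPlane.continuous_im
  unfold vec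
  refine Continuous.prodMk ?_ (Continuous.prodMk ?_ ?_)
  · exact ((h1.pow 2).add (h2.pow 2)).div h2 fun z => z.im_ne_zero
  · exact h1.div h2 fun z => z.im_ne_zero
  · exact continuous_const.div h2 fun z => z.im_ne_zero

lemma continuous_bil : Continuous fun p : (ℝ × ℝ × ℝ) × (ℝ × ℝ × ℝ) => bil p.1 p.2 := by
  unfold bil; fun_prop

lemma continuous_tri :
    Continuous fun p : (ℝ × ℝ × ℝ) × (ℝ × ℝ × ℝ) × (ℝ × ℝ × ℝ) => tri p.1 p.2.1 p.2.2 := by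
  unfold tri; fun_prop

@[fun_prop] lemma Continuous.bil {X : Type*} [TopologicalSpace X] {f g : X → ℝ × ℝ × ℝ}
    (hf : Continuous f) (hg : Continuous g) : Continuous fun x => bil (f x) (g x) :=
  continuous_bil.comp (hf.prodMk hg)

@[fun_prop] lemma Continuous.tri {X : Type*} [TopologicalSpace X] {f g h : X → ℝ × ℝ × ℝ}
    (hf : Continuous f) (hg : Continuous g) (hh : Continuous h) :
    Continuous fun x => tri (f x) (g x) (h x) :=
  continuous_tri.comp (hf.prodMk (hg.prodMk hh))

lemma tendsto_bil {X : Type*} {l : Filter X} {f g : X → ℝ × ℝ × ℝ} {a b : ℝ × ℝ × ℝ}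
    (hf : Tendsto f l (𝓝 a)) (hg : Tendsto g l (𝓝 b)) :
    Tendsto (fun x => bil (f x) (g x)) l (𝓝 (bil a b)) :=
  (continuous_bil.tendsto (a, b)).comp (hf.prodMk_nhds hg)

lemma tendsto_tri {X : Type*} {l : Filter X} {f g h : X → ℝ × ℝ × ℝ} {a b c : ℝ × ℝ × ℝ}
    (hf : Tendsto f l (𝓝 a)) (hg : Tendsto g l (𝓝 b)) (hh : Tendsto h l (𝓝 c)) :
    Tendsto (fun x => tri (f x) (g x) (h x)) l (𝓝 (tri a b c)) := by
  simp only [← bil_crs]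
  refine tendsto_bil ?_ hh
  have h2 : Continuous fun p : (ℝ × ℝ × ℝ) × (ℝ × ℝ × ℝ) => crs p.1 p.2 := by
    unfold crs; fun_prop
  exact (h2.tendsto (a, b)).comp (hf.prodMk_nhds hg)

/-- The numerator is the half-plane equation of the geodesic through `u` and `v`. This is the bridge
between orientation and coordinates in the area computations. -/
lemma tri_vec (u v z : ℍ) :
    tri (vec u) (vec v) (vec z) = ((v.re - u.re) * (z.re ^ 2 + z.im ^ 2)
      + ((u.re ^ 2 + u.im ^ 2) - (v.re ^ 2 + v.im ^ 2)) * z.re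
      + (u.re * (v.re ^ 2 + v.im ^ 2) - v.re * (u.re ^ 2 + u.im ^ 2))) /
        (2 * u.im * v.im * z.im) := by
  have h1 := u.im_ne_zero
  have h2 := v.im_ne_zero
  have h3 := z.im_ne_zero
  simp only [tri, vec]
  generalize u.re = a, u.im = b, v.re = c, v.im = d, z.re = e, z.im = f at *
  field_simp
  ring

/-! ### The future cone -/

lemma Fut.fst_pos {v : ℝ × ℝ × ℝ} (h : Fut v) : 0 < v.1 := by
  obtain ⟨h1, h2⟩ := h
  unfold bil at h2
  by_contra hc
  nlinarith [mul_nonneg h1.le (not_lt.1 hc |> neg_nonneg.2), sq_nonneg v.2.1]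

/-- Reverse Cauchy–Schwarz: being timelike bounds the squares of the middle coordinates, and the
arithmetic-geometric mean inequality compares the mixed products of the outer ones. -/
lemma Fut.bil_pos {u v : ℝ × ℝ × ℝ} (hu : Fut u) (hv : Fut v) : 0 < bil u v := by
  have hu1 := hu.fst_pos
  have hv1 := hv.fst_pos
  obtain ⟨hu3, hu2⟩ := hu
  obtain ⟨hv3, hv2⟩ := hv
  unfold bil at *
  obtain ⟨a, b, c⟩ := u
  obtain ⟨d, e, f⟩ := v
  simp only at *
  have h1 : b ^ 2 < a * c := by nlinarith
  have h2 : e ^ 2 < d * f := by nlinarith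
  have h3 : (b * e) ^ 2 < (a * f) * (c * d) := by
    have : b ^ 2 * e ^ 2 ≤ b ^ 2 * (d * f) := by gcongr
    have : b ^ 2 * (d * f) < a * c * (d * f) := by gcongr
    nlinarith
  have h4 : (b * e) ^ 2 < ((a * f + c * d) / 2) ^ 2 := by nlinarith [sq_nonneg (a * f - c * d)]
  have h5 := abs_lt_of_sq_lt_sq h4 (by positivity)
  linarith [(abs_lt.1 h5).2]

lemma Fut.add {u v : ℝ × ℝ × ℝ} (hu : Fut u) (hv : Fut v) : Fut (u + v) := by
  have := hu.bil_pos hv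
  refine ⟨add_pos hu.1 hv.1, ?_⟩
  rw [bil_add_left, bil_add_right, bil_add_right, bil_comm v u]
  linarith [hu.2, hv.2]

lemma Fut.smul {u : ℝ × ℝ × ℝ} (hu : Fut u) {c : ℝ} (hc : 0 < c) : Fut (c • u) := by
  refine ⟨mul_pos hc hu.1, ?_⟩
  rw [bil_smul_left, bil_smul_right]
  have := hu.2
  positivity

lemma fut_comb {u v : ℝ × ℝ × ℝ} (hu : Fut u) (hv : Fut v) {s t : ℝ} (hs : 0 ≤ s) (ht : 0 ≤ t)
    (h : 0 < s + t) : Fut (s • u + t • v) := by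
  rcases hs.eq_or_lt with rfl | hs
  · rw [zero_smul, zero_add]; exact hv.smul (by linarith)
  rcases ht.eq_or_lt with rfl | ht
  · rw [zero_smul, add_zero]; exact hu.smul hs
  exact (hu.smul hs).add (hv.smul ht)

/-- A timelike vector lies in one of two opposite cones, and the past one pairs negatively with `u`.
-/
lemma fut_of_bil_pos {u v : ℝ × ℝ × ℝ} (hu : Fut u) (hv : 0 < bil v v) (h : 0 < bil u v) :
    Fut v := by
  refine ⟨?_, hv⟩
  by_contra hc
  rcases (not_lt.1 hc).eq_or_lt with h0 | h0
  · unfold bil at hv; rw [h0] at hv; nlinarith [sq_nonneg v.2.1]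
  · have hf : Fut ((-1 : ℝ) • v) := by
      refine ⟨?_, ?_⟩
      · simp only [Prod.smul_snd, smul_eq_mul]; linarith
      · rw [bil_smul_left, bil_smul_right]; linarith
    have := hu.bil_pos hf
    rw [bil_smul_right] at this
    linarith

lemma isOpen_fut : IsOpen {v : ℝ × ℝ × ℝ | Fut v} := by
  have h1 : Continuous fun v : ℝ × ℝ × ℝ => v.2.2 := by fun_prop
  have h2 : Continuous fun v : ℝ × ℝ × ℝ => bil v v := by fun_prop
  exact (isOpen_lt continuous_const h1).inter (isOpen_lt continuous_const h2)

open Classical in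
/-- The point of the hyperbolic plane on the ray of a future timelike vector. -/
noncomputable def pt (v : ℝ × ℝ × ℝ) : ℍ :=
  if h : Fut v then ⟨⟨v.2.1 / v.2.2, √(bil v v) / v.2.2⟩, div_pos (Real.sqrt_pos.2 h.2) h.1⟩
  else UpperHalfPlane.I

lemma pt_re {v : ℝ × ℝ × ℝ} (h : Fut v) : (pt v).re = v.2.1 / v.2.2 := by
  rw [pt, dif_pos h]; rfl

lemma pt_im {v : ℝ × ℝ × ℝ} (h : Fut v) : (pt v).im = √(bil v v) / v.2.2 := by
  rw [pt, dif_pos h]; rfl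

lemma vec_pt {v : ℝ × ℝ × ℝ} (h : Fut v) : vec (pt v) = (1 / √(bil v v)) • v := by
  have h1 := h.1
  have h2 := Real.sqrt_pos.2 h.2
  have h3 := Real.sq_sqrt h.2.le
  obtain ⟨p, q, r⟩ := v
  simp only [vec, pt_re h, pt_im h, Prod.smul_mk, smul_eq_mul, Prod.mk.injEq]
  simp only at h1
  set s := √(bil (p, q, r) (p, q, r))
  simp only [bil] at h3
  refine ⟨?_, ?_, ?_⟩
  · field_simp; rw [h3]; ring
  · field_simp
  · field_simp

lemma vec_pt_unit {v : ℝ × ℝ × ℝ} (h : Fut v) (h1 : bil v v = 1) : vec (pt v) = v := by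
  rw [vec_pt h, h1]; simp

@[simp] lemma pt_vec (z : ℍ) : pt (vec z) = z :=
  vec_injective (vec_pt_unit (fut_vec z) (bil_vec_self z))

/-- `vec (pt v)` is a positive multiple of `v`. -/
lemma exists_vec_pt {v : ℝ × ℝ × ℝ} (h : Fut v) : ∃ c : ℝ, 0 < c ∧ vec (pt v) = c • v :=
  ⟨_, one_div_pos.2 (Real.sqrt_pos.2 h.2), vec_pt h⟩

lemma continuousAt_pt {v : ℝ × ℝ × ℝ} (h : Fut v) : ContinuousAt pt v := by
  rw [UpperHalfPlane.isEmbedding_coe.continuousAt_iff]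
  have : (fun v : ℝ × ℝ × ℝ => ((v.2.1 / v.2.2 : ℝ) : ℂ) + ((√(bil v v) / v.2.2 : ℝ) : ℂ) * Complex.I)
      =ᶠ[𝓝 v] UpperHalfPlane.coe ∘ pt := by
    filter_upwards [isOpen_fut.mem_nhds h] with w hw
    rw [Function.comp_apply, ← UpperHalfPlane.re_add_im, pt_re hw, pt_im hw]
  refine ContinuousAt.congr ?_ this
  have h0 : v.2.2 ≠ 0 := h.1.ne'
  have hb : ContinuousAt (fun v : ℝ × ℝ × ℝ => bil v v) v := by fun_prop
  have h2 : ContinuousAt (fun v : ℝ × ℝ × ℝ => v.2.2) v := by fun_prop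
  have h3 : ContinuousAt (fun v : ℝ × ℝ × ℝ => v.2.1) v := by fun_prop
  exact (Complex.continuous_ofReal.continuousAt.comp (h3.div h2 h0)).add
    ((Complex.continuous_ofReal.continuousAt.comp
      ((Real.continuous_sqrt.continuousAt.comp hb).div h2 h0)).mul continuousAt_const)

end HypPlane

namespace HypPlane
open Filter Topology

/-! ### Segments and convex sets -/

/-- The orthogonal complement of a timelike vector is negative definite. -/
lemma eq_zero_of_bil_eq_zero {w : ℝ × ℝ × ℝ} (u : ℍ) (h : bil w w = 0) (h' : bil w (vec u) = 0) :
    w = 0 := by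
  obtain ⟨p, q, r⟩ := w
  have hy := u.im_pos
  set x := u.re with hx
  set y := u.im with hy'
  simp only [bil, vec, ← hx, ← hy'] at h h'
  have h1 : p + r * (x ^ 2 + y ^ 2) = 2 * q * x := by
    field_simp at h'; linarith
  have h2 : p * r = q ^ 2 := by linarith
  have h3 : (q - r * x) ^ 2 + r ^ 2 * y ^ 2 = 0 := by
    have : p = 2 * q * x - r * (x ^ 2 + y ^ 2) := by linarith
    rw [this] at h2; nlinarith
  have h4 : r = 0 := by
    have : r ^ 2 * y ^ 2 = 0 := by nlinarith [sq_nonneg (q - r * x), sq_nonneg (r * y)]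
    rcases mul_eq_zero.1 this with h | h
    · exact pow_eq_zero_iff (two_ne_zero) |>.1 h
    · exact absurd h (by positivity)
  subst h4
  have h5 : q = 0 := by nlinarith
  subst h5
  have h6 : p = 0 := by linarith
  rw [h6]; rfl

/-- Since `vec z` is a unit vector, the sinh of the two partial distances are `t` and `s` times the
sinh of the total distance. The addition formula for cosh then gives equality in the triangle
inequality. -/
lemma mem_segment_of_vec {u v z : ℍ} {s t : ℝ} (hs : 0 ≤ s) (ht : 0 ≤ t)
    (h : vec z = s • vec u + t • vec v) : z ∈ segment u v := by
  show dist u z + dist z v = dist u v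
  set X := bil (vec u) (vec v) with hX
  have e1 : bil (vec u) (vec z) = s + t * X := by
    rw [h, bil_add_right, bil_smul_right, bil_smul_right, bil_vec_self]; ring
  have e2 : bil (vec z) (vec v) = s * X + t := by
    rw [h, bil_add_left, bil_smul_left, bil_smul_left, bil_vec_self]; ring
  have e3 : 1 = s * (s + t * X) + t * (s * X + t) := by
    rw [← e1, ← e2, bil_comm (vec u), ← bil_smul_right, ← bil_smul_right, ← bil_add_right, ← h,
      bil_vec_self]
  have c1 : Real.cosh (dist u z) = s + t * X := by rw [cosh_dist_eq, e1]
  have c2 : Real.cosh (dist z v) = s * X + t := by rw [cosh_dist_eq, e2]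
  have c3 : Real.cosh (dist u v) = X := by rw [cosh_dist_eq]
  have d1 : Real.sinh (dist u z) = t * Real.sinh (dist u v) := by
    refine (pow_left_inj₀ (Real.sinh_nonneg_iff.2 dist_nonneg)
      (mul_nonneg ht (Real.sinh_nonneg_iff.2 dist_nonneg)) two_ne_zero).1 ?_
    rw [mul_pow, Real.sinh_sq, Real.sinh_sq, c1, c3]; linear_combination -e3
  have d2 : Real.sinh (dist z v) = s * Real.sinh (dist u v) := by
    refine (pow_left_inj₀ (Real.sinh_nonneg_iff.2 dist_nonneg)
      (mul_nonneg hs (Real.sinh_nonneg_iff.2 dist_nonneg)) two_ne_zero).1 ?_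
    rw [mul_pow, Real.sinh_sq, Real.sinh_sq, c2, c3]; linear_combination -e3
  have : Real.cosh (dist u z + dist z v) = Real.cosh (dist u v) := by
    have := Real.sinh_sq (dist u v)
    rw [Real.cosh_add, c1, c2, d1, d2, c3]
    rw [c3] at this
    linear_combination (s * t) * this - X * e3
  rw [← abs_of_nonneg (dist_nonneg : 0 ≤ dist u v),
    ← abs_of_nonneg (add_nonneg dist_nonneg dist_nonneg : 0 ≤ dist u z + dist z v)]
  exact le_antisymm (Real.cosh_le_cosh.1 this.le) (Real.cosh_le_cosh.1 this.ge)

lemma mem_segment_iff {u v z : ℍ} :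
    z ∈ segment u v ↔ ∃ s t : ℝ, 0 ≤ s ∧ 0 ≤ t ∧ vec z = s • vec u + t • vec v := by
  refine ⟨fun h => ?_, fun ⟨s, t, hs, ht, h⟩ => mem_segment_of_vec hs ht h⟩
  change dist u z + dist z v = dist u v at h
  rcases eq_or_ne u v with rfl | hne
  · rw [dist_self] at h
    have : dist u z = 0 := by linarith [@dist_nonneg _ _ u z, @dist_nonneg _ _ z u]
    rw [← dist_eq_zero.1 this]
    exact ⟨1, 0, by simp⟩
  set a := dist u z
  set b := dist z v
  have hc : 0 < a + b := by rw [h]; exact dist_pos.2 hne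
  have hs : 0 < Real.sinh (a + b) := Real.sinh_pos_iff.2 hc
  have e1 : bil (vec u) (vec z) = Real.cosh a := (cosh_dist_eq u z).symm
  have e2 : bil (vec z) (vec v) = Real.cosh b := (cosh_dist_eq z v).symm
  have e3 : bil (vec u) (vec v) = Real.cosh (a + b) := by rw [h, cosh_dist_eq]
  -- The sines of the parts predict the combination; `w` is the defect. It is orthogonal to `u`, `v`
  -- and `z`, hence null and orthogonal to a timelike vector, so it vanishes.
  set w := Real.sinh (a + b) • vec z + ((-Real.sinh b) • vec u + (-Real.sinh a) • vec v) with hw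
  have hca := Real.cosh_sq a
  have hcb := Real.cosh_sq b
  have w1 : bil w (vec u) = 0 := by
    simp only [hw, bil_add_left, bil_smul_left, bil_vec_self, bil_comm (vec z) (vec u),
      bil_comm (vec v) (vec u), e1, e3, Real.cosh_add, Real.sinh_add]
    linear_combination (Real.sinh b) * hca
  have w2 : bil w (vec v) = 0 := by
    simp only [hw, bil_add_left, bil_smul_left, bil_vec_self, e2, e3, Real.cosh_add, Real.sinh_add]
    linear_combination (Real.sinh a) * hcb
  have w3 : bil w (vec z) = 0 := by
    simp only [hw, bil_add_left, bil_smul_left, bil_vec_self, bil_comm (vec v) (vec z), e1, e2,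
      Real.sinh_add]
    ring
  have w0 : w = 0 := by
    refine eq_zero_of_bil_eq_zero u ?_ w1
    nth_rewrite 2 [hw]
    simp only [bil_add_right, bil_smul_right, w1, w2, w3]; ring
  refine ⟨Real.sinh b / Real.sinh (a + b), Real.sinh a / Real.sinh (a + b),
    div_nonneg (Real.sinh_nonneg_iff.2 dist_nonneg) hs.le,
    div_nonneg (Real.sinh_nonneg_iff.2 dist_nonneg) hs.le, ?_⟩
  have : Real.sinh (a + b) • vec z = Real.sinh b • vec u + Real.sinh a • vec v := by
    have := hw.symm.trans w0
    rw [add_eq_zero_iff_eq_neg] at this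
    rw [this, neg_add, neg_smul, neg_smul, neg_neg, neg_neg]
  rw [div_eq_inv_mul, div_eq_inv_mul, mul_smul, mul_smul, ← smul_add, ← this, smul_smul,
    inv_mul_cancel₀ hs.ne', one_smul]

lemma pt_comb_mem_segment (u v : ℍ) {s t : ℝ} (hs : 0 ≤ s) (ht : 0 ≤ t) (h : 0 < s + t) :
    pt (s • vec u + t • vec v) ∈ segment u v := by
  obtain ⟨c, hc, e⟩ := exists_vec_pt (fut_comb (fut_vec u) (fut_vec v) hs ht h)
  refine mem_segment_of_vec (s := c * s) (t := c * t) (by positivity) (by positivity) ?_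
  rw [e, smul_add, smul_smul, smul_smul]

lemma comb_pos {u v z : ℍ} {s t : ℝ} (hs : 0 ≤ s) (ht : 0 ≤ t)
    (h : vec z = s • vec u + t • vec v) : 0 < s + t := by
  rcases (add_nonneg hs ht).eq_or_lt with h0 | h0
  · have h1 : s = 0 := by linarith
    have h2 : t = 0 := by linarith
    have := vec_pos z
    rw [h, h1, h2] at this
    simp at this
  · exact h0

lemma left_mem_segment (u v : ℍ) : u ∈ segment u v := by simp [segment]

lemma right_mem_segment (u v : ℍ) : v ∈ segment u v := by simp [segment]

lemma segment_comm (u v : ℍ) : segment u v = segment v u := by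
  ext z
  change dist u z + dist z v = dist u v ↔ dist v z + dist z u = dist v u
  rw [dist_comm u z, dist_comm z v, dist_comm u v, add_comm]

lemma isConvex_halfPlane (N : ℝ × ℝ × ℝ) : IsConvex {z | 0 < bil N (vec z)} := by
  intro x hx y hy z hz
  obtain ⟨s, t, hs, ht, h⟩ := mem_segment_iff.1 hz
  simp only [Set.mem_ofPred_eq] at *
  rw [h, bil_add_right, bil_smul_right, bil_smul_right]
  have := comb_pos hs ht h
  rcases hs.eq_or_lt with rfl | hs
  · nlinarith
  · have : 0 < s * bil N (vec x) := by positivity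
    have : 0 ≤ t * bil N (vec y) := by positivity
    linarith

lemma isConvex_tri_pos (u v : ℝ × ℝ × ℝ) : IsConvex {z | 0 < tri u v (vec z)} := by
  simpa only [bil_crs] using isConvex_halfPlane (crs u v)

lemma IsConvex.iInter {ι : Sort*} {D : ι → Set ℍ} (h : ∀ i, IsConvex (D i)) :
    IsConvex (⋂ i, D i) := by
  intro x hx y hy z hz
  rw [Set.mem_iInter] at *
  exact fun i => h i x (hx i) y (hy i) hz

/-- Points between an interior point and a point of the closure are interior. -/
lemma IsConvex.mem_of_mem_closure {D : Set ℍ} (hD : IsConvex D) (ho : IsOpen D) {x y z : ℍ}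
    (hx : x ∈ D) (hy : y ∈ closure D) {s t : ℝ} (hs : 0 < s) (ht : 0 ≤ t)
    (h : vec z = s • vec x + t • vec y) : z ∈ D := by
  -- Solve the combination for its first point as a function of the second: when `y` is replaced by
  -- a nearby `y'` in `D`, the first point moves little and stays in the open set `D`.
  set g : ℍ → ℝ × ℝ × ℝ := fun y' => s⁻¹ • (vec z - t • vec y') with hg
  have hgy : g y = vec x := by
    simp only [hg, h, add_sub_cancel_right, smul_smul, inv_mul_cancel₀ hs.ne', one_smul]
  have hgc : Continuous g := by
    have := continuous_vec
    simp only [hg]; fun_prop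
  have h1 : ∀ᶠ y' in 𝓝 y, Fut (g y') :=
    hgc.continuousAt.eventually (isOpen_fut.mem_nhds (by
      show Fut (g y)
      rw [hgy]; exact fut_vec x))
  have h2 : ∀ᶠ y' in 𝓝 y, pt (g y') ∈ D := by
    have hc : ContinuousAt (fun y' => pt (g y')) y :=
      ContinuousAt.comp (g := pt) (by rw [hgy]; exact continuousAt_pt (fut_vec x)) hgc.continuousAt
    refine hc.eventually (ho.mem_nhds ?_)
    change pt (g y) ∈ D
    rw [hgy, pt_vec]; exact hx
  obtain ⟨y', hy', h1', h2'⟩ := ((mem_closure_iff_frequently.1 hy).and_eventually (h1.and h2)).exists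
  obtain ⟨c, hc, e⟩ := exists_vec_pt h1'
  refine hD _ h2' _ hy' (mem_segment_of_vec (s := s / c) (t := t) (by positivity) ht ?_)
  rw [e, smul_smul, div_mul_cancel₀ _ hc.ne']
  simp only [hg, smul_smul, mul_inv_cancel₀ hs.ne', one_smul, sub_add_cancel]

lemma isPreconnected_segment (u v : ℍ) : IsPreconnected (segment u v) := by
  have : segment u v = (fun t : ℝ => pt ((1 - t) • vec u + t • vec v)) '' Set.Icc 0 1 := by
    ext z
    constructor
    · intro hz
      obtain ⟨s, t, hs, ht, h⟩ := mem_segment_iff.1 hz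
      have h0 := comb_pos hs ht h
      refine ⟨t / (s + t), ⟨by positivity, (div_le_one h0).2 (by linarith)⟩, ?_⟩
      have e : (1 - t / (s + t)) • vec u + (t / (s + t)) • vec v = (s + t)⁻¹ • vec z := by
        rw [h, smul_add, smul_smul, smul_smul]; congr 2 <;> field_simp; ring
      simp only [e]
      have hf := (fut_vec z).smul (inv_pos.2 h0)
      apply vec_injective
      rw [vec_pt hf, bil_smul_left, bil_smul_right, bil_vec_self, mul_one,
        Real.sqrt_mul_self (inv_pos.2 h0).le, smul_smul]
      rw [one_div, inv_mul_cancel₀ (inv_pos.2 h0).ne', one_smul]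
    · rintro ⟨t, ⟨h0, h1⟩, rfl⟩
      exact pt_comb_mem_segment u v (by linarith) h0 (by linarith)
  rw [this]
  refine isPreconnected_Icc.image _ fun t ht => ContinuousAt.continuousWithinAt ?_
  refine ContinuousAt.comp (g := pt) (continuousAt_pt
    (fut_comb (fut_vec u) (fut_vec v) (by linarith [ht.2]) ht.1 (by linarith))) ?_
  fun_prop

lemma exists_mem_segment_frontier {D : Set ℍ} {x y : ℍ} (hx : x ∈ D) (hy : y ∉ D) :
    ∃ z ∈ segment x y, z ∈ frontier D := by
  by_contra hc
  push Not at hc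
  have := (isPreconnected_segment x y).subset_or_subset (u := interior D) (v := (closure D)ᶜ) isOpen_interior isClosed_closure.isOpen_compl
    (Set.disjoint_left.2 fun z hz hz' => hz' (subset_closure (interior_subset hz)))
    (fun z hz => by
      by_cases h : z ∈ closure D
      · left; by_contra h'; exact hc z hz ⟨h, h'⟩
      · right; exact h)
  rcases this with h | h
  · exact hy (interior_subset (h (right_mem_segment x y)))
  · exact h (left_mem_segment x y) (subset_closure hx)

end HypPlane

namespace HypPlane
open Filter Topology

/-! ### Positively oriented convex polygons -/

/-- The orientation of a triple of points. -/
noncomputable def ori (a b c : ℍ) : ℝ := tri (vec a) (vec b) (vec c)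

lemma ori_rot (a b c : ℍ) : ori a b c = ori b c a := tri_rot _ _ _

lemma ori_swap (a b c : ℍ) : ori a c b = -ori a b c := tri_swap _ _ _

lemma ori_swap_left (a b c : ℍ) : ori b a c = -ori a b c := tri_swap_left _ _ _

@[simp] lemma ori_self_left (a b : ℍ) : ori a a b = 0 := tri_self_left _ _

@[simp] lemma ori_self_right (a b : ℍ) : ori a b b = 0 := tri_self_right _ _

@[simp] lemma ori_self_outer (a b : ℍ) : ori a b a = 0 := tri_self_outer _ _

lemma continuous_ori {X : Type*} [TopologicalSpace X] {f g h : X → ℍ} (hf : Continuous f)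
    (hg : Continuous g) (hh : Continuous h) : Continuous fun x => ori (f x) (g x) (h x) :=
  Continuous.tri (continuous_vec.comp hf) (continuous_vec.comp hg) (continuous_vec.comp hh)

/-- Three points on one geodesic are collinear. -/
lemma ori_eq_zero_of_line {a b x y z : ℍ} (hab : a ≠ b) (hx : ori a b x = 0) (hy : ori a b y = 0)
    (hz : ori a b z = 0) : ori x y z = 0 := by
  -- Expand the normal of the line `a b` in the triple `x, y, z` and pair it with itself: the right
  -- side vanishes, while the norm of the normal is not zero.
  have h := congrArg (bil (crs (vec a) (vec b)))
    (tri_expand (vec x) (vec y) (vec z) (crs (vec a) (vec b)))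
  simp only [bil_add_right, bil_smul_right, bil_crs_crs, bil_vec_self] at h
  simp only [bil_crs] at h
  change ori x y z * _ = _ * ori a b x + _ * ori a b y + _ * ori a b z at h
  rw [hx, hy, hz] at h
  have := one_lt_bil hab
  have h2 : (1 : ℝ) * 1 - bil (vec a) (vec b) ^ 2 ≠ 0 := by nlinarith
  rw [mul_zero, mul_zero, mul_zero, add_zero, add_zero] at h
  exact (mul_eq_zero.1 h).resolve_right h2

/-- The vertices of a positively oriented convex polygon, as a periodic sequence. -/
structure CPoly (n : ℕ) (v : ℕ → ℍ) : Prop where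
  three_le : 3 ≤ n
  per : ∀ k, v (k + n) = v k
  nonneg : ∀ i j k, i ≤ j → j ≤ k → k ≤ i + n → 0 ≤ ori (v i) (v j) (v k)
  edge : ∀ i, v i ≠ v (i + 1)
  noncol : ∃ i j k, ori (v i) (v j) (v k) ≠ 0

/-- The interior of a positively oriented convex polygon. -/
def inner (v : ℕ → ℍ) : Set ℍ := {z | ∀ i, 0 < ori (v i) (v (i + 1)) z}

lemma exists_index_of_per {α : Type*} {n : ℕ} (hn : 0 < n) {v : ℕ → α} (h : ∀ k, v (k + n) = v k)
    (i k : ℕ) : ∃ k', i ≤ k' ∧ k' < i + n ∧ v k' = v k := by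
  have hm : ∀ m k, v (k + m * n) = v k := by
    intro m
    induction m with
    | zero => simp
    | succ m ih => intro k; rw [Nat.succ_mul, ← add_assoc, h, ih]
  -- Adding `i * n` first makes the subtraction of `i` exact and does not change the residue.
  refine ⟨i + (k + i * n - i) % n, by omega, by have := Nat.mod_lt (k + i * n - i) hn; omega, ?_⟩
  have h1 : i ≤ k + i * n := by nlinarith
  have h2 := Nat.mod_add_div (k + i * n - i) n
  rw [← hm ((k + i * n - i) / n), ← hm i k]
  congr 1
  rw [mul_comm n] at h2
  omega

namespace CPoly
variable {n : ℕ} {v : ℕ → ℍ}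

lemma pos (h : CPoly n v) : 0 < n := by have := h.three_le; omega

lemma shift (h : CPoly n v) (a : ℕ) : CPoly n fun k => v (k + a) where
  three_le := h.three_le
  per k := by rw [add_right_comm, h.per]
  nonneg i j k hij hjk hki := h.nonneg _ _ _ (by omega) (by omega) (by omega)
  edge i := by have := h.edge (i + a); rwa [add_right_comm] at this
  noncol := by
    obtain ⟨i, j, k, hne⟩ := h.noncol
    obtain ⟨i', hi, -, ei⟩ := exists_index_of_per h.pos h.per a i
    obtain ⟨j', hj, -, ej⟩ := exists_index_of_per h.pos h.per a j
    obtain ⟨k', hk, -, ek⟩ := exists_index_of_per h.pos h.per a k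
    refine ⟨i' - a, j' - a, k' - a, ?_⟩
    simp only [Nat.sub_add_cancel hi, Nat.sub_add_cancel hj, Nat.sub_add_cancel hk, ei, ej, ek]
    exact hne

/-- Not all vertices of a polygon lie on one geodesic. -/
lemma exists_off_line (h : CPoly n v) {a b : ℍ} (hab : a ≠ b) (k : ℕ) :
    ∃ w, k ≤ w ∧ w < k + n ∧ ori a b (v w) ≠ 0 := by
  by_contra hc
  push Not at hc
  obtain ⟨i, j, l, hne⟩ := h.noncol
  obtain ⟨i', hi, hi', ei⟩ := exists_index_of_per h.pos h.per k i
  obtain ⟨j', hj, hj', ej⟩ := exists_index_of_per h.pos h.per k j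
  obtain ⟨l', hl, hl', el⟩ := exists_index_of_per h.pos h.per k l
  rw [← ei, ← ej, ← el] at hne
  exact hne (ori_eq_zero_of_line hab (hc _ hi hi') (hc _ hj hj') (hc _ hl hl'))

lemma exists_pos (h : CPoly n v) (i : ℕ) :
    ∃ w, i + 1 < w ∧ w < i + n ∧ 0 < ori (v i) (v (i + 1)) (v w) := by
  obtain ⟨w, hw, hw', hne⟩ := h.exists_off_line (h.edge i) i
  have h1 : w ≠ i := by rintro rfl; simp at hne
  have h2 : w ≠ i + 1 := by rintro rfl; simp at hne
  refine ⟨w, by omega, hw', lt_of_le_of_ne (h.nonneg _ _ _ ?_ ?_ ?_) hne.symm⟩ <;> omega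

/-- If two vertices coincide, every triple formed by this point, a vertex of one arc and a vertex of
the other has both signs, hence is flat. All vertices are then on one line. -/
lemma injective (h : CPoly n v) {i j : ℕ} (hij : i < j) (hj : j < i + n) : v i ≠ v j := by
  intro he
  have key : ∀ k x, i ≤ k → k ≤ j → j ≤ x → x ≤ i + n → ori (v i) (v k) (v x) = 0 := by
    intro k x h1 h2 h3 h4
    refine le_antisymm ?_ (h.nonneg _ _ _ h1 (by omega) h4)
    have := h.nonneg k j x h2 h3 (by omega)
    rw [← he, ori_swap_left] at this
    linarith
  have hne : v i ≠ v (j + 1) := he ▸ h.edge j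
  have h1 : ∀ k, i ≤ k → k ≤ j → ori (v i) (v (j + 1)) (v k) = 0 := by
    intro k hk hk'
    rw [ori_swap, key k (j + 1) hk hk' (by omega) (by omega), neg_zero]
  have h2 : ∀ x, j ≤ x → x ≤ i + n → ori (v i) (v (j + 1)) (v x) = 0 := by
    intro x hx hx'
    exact ori_eq_zero_of_line (h.edge i) (by simp)
      (key (i + 1) (j + 1) (by omega) (by omega) (by omega) (by omega))
      (key (i + 1) x (by omega) (by omega) hx hx')
  obtain ⟨w, hw, hw', hne'⟩ := h.exists_off_line hne i
  rcases le_total w j with hle | hle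
  · exact hne' (h1 w hw hle)
  · exact hne' (h2 w hle hw'.le)

lemma isOpen_inner (h : CPoly n v) : IsOpen (inner v) := by
  have : inner v = ⋂ i ∈ Finset.range n, {z | 0 < ori (v i) (v (i + 1)) z} := by
    ext z
    simp only [inner, Set.mem_iInter, Set.mem_ofPred_eq, Finset.mem_range]
    refine ⟨fun hz i _ => hz i, fun hz i => ?_⟩
    obtain ⟨i', -, hi', ei⟩ := exists_index_of_per h.pos (v := fun k => (v k, v (k + 1)))
      (fun k => by rw [h.per, add_right_comm, h.per]) 0 i
    have := hz i' (by omega)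
    simp only [Prod.mk.injEq] at ei
    rwa [ei.1, ei.2] at this
  rw [this]
  exact isOpen_biInter_finset fun i _ =>
    isOpen_lt continuous_const (continuous_ori continuous_const continuous_const continuous_id)

lemma isConvex_inner (v : ℕ → ℍ) : IsConvex (inner v) := by
  have : inner v = ⋂ i, {z | 0 < tri (vec (v i)) (vec (v (i + 1))) (vec z)} := by
    ext z; simp [inner, ori]
  rw [this]
  exact IsConvex.iInter fun i => isConvex_tri_pos _ _

/-- The centroid of the vertices. -/
noncomputable def center (n : ℕ) (v : ℕ → ℍ) : ℍ := pt (∑ j ∈ Finset.range n, vec (v j))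

lemma exists_vec_center (h : CPoly n v) :
    ∃ c : ℝ, 0 < c ∧ vec (center n v) = c • ∑ j ∈ Finset.range n, vec (v j) := by
  refine exists_vec_pt ?_
  have : ∀ m, 0 < m → Fut (∑ j ∈ Finset.range m, vec (v j)) := by
    intro m hm
    induction m, hm using Nat.le_induction with
    | base => simpa using fut_vec (v 0)
    | succ m _ ih => rw [Finset.sum_range_succ]; exact ih.add (fut_vec _)
  exact this n h.pos

lemma tri_sum_right (u w : ℝ × ℝ × ℝ) (f : ℕ → ℝ × ℝ × ℝ) (n : ℕ) :
    tri u w (∑ j ∈ Finset.range n, f j) = ∑ j ∈ Finset.range n, tri u w (f j) := by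
  induction n with
  | zero => simp [tri]
  | succ n ih => rw [Finset.sum_range_succ, tri_add_right, ih, Finset.sum_range_succ]

lemma center_mem_inner (h : CPoly n v) : center n v ∈ inner v := by
  intro i
  obtain ⟨c, hc, e⟩ := h.exists_vec_center
  rw [ori, e, tri_smul_right, tri_sum_right]
  refine mul_pos hc ?_
  obtain ⟨w, hw1, hw2, hw3⟩ := h.exists_pos i
  obtain ⟨w', -, hw', ew⟩ := exists_index_of_per h.pos h.per 0 w
  refine Finset.sum_pos' (fun j _ => ?_) ⟨w', Finset.mem_range.2 (by omega), by rw [ew]; exact hw3⟩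
  obtain ⟨j', h1, h2, ej⟩ := exists_index_of_per h.pos h.per i j
  rw [← ej]
  rcases h1.eq_or_lt with rfl | h1
  · simp
  · exact h.nonneg i (i + 1) j' (by omega) (by omega) (by omega)

/-- The sum is the volume of `z`, the centre and the sum of the vertices, and the last two are
proportional. Hence the terms cannot all have one strict sign. -/
lemma sum_ori_center (h : CPoly n v) (z : ℍ) :
    ∑ j ∈ Finset.range n, ori (center n v) (v j) z = 0 := by
  obtain ⟨c, hc, e⟩ := h.exists_vec_center
  have : ∑ j ∈ Finset.range n, ori (center n v) (v j) z
      = tri (vec z) (vec (center n v)) (∑ j ∈ Finset.range n, vec (v j)) := by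
    rw [tri_sum_right]
    exact Finset.sum_congr rfl fun j _ => by rw [← ori_rot]; rfl
  rw [this]
  have h2 : ∑ j ∈ Finset.range n, vec (v j) = c⁻¹ • vec (center n v) := by
    rw [e, smul_smul, inv_mul_cancel₀ hc.ne', one_smul]
  rw [h2, tri_smul_right, tri_self_right, mul_zero]

/-- Every point lies in a sector spanned by the centre and an edge. -/
lemma exists_sector (h : CPoly n v) (z : ℍ) :
    ∃ j, 0 ≤ ori (center n v) (v j) z ∧ ori (center n v) (v (j + 1)) z ≤ 0 := by
  by_contra hc
  push Not at hc
  have hs := h.sum_ori_center z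
  have hn : (Finset.range n).Nonempty := Finset.nonempty_range_iff.2 h.pos.ne'
  -- Without such a sector, nonnegativity at one vertex propagates as positivity to all later ones,
  -- so the terms of the vanishing sum would all have one strict sign.
  by_cases h0 : ∃ j, 0 ≤ ori (center n v) (v j) z
  · obtain ⟨j, hj⟩ := h0
    have h1 : ∀ k, 0 < ori (center n v) (v (j + 1 + k)) z := by
      intro k
      induction k with
      | zero => exact hc j hj
      | succ k ih => exact hc _ ih.le
    have : 0 < ∑ j ∈ Finset.range n, ori (center n v) (v j) z := by
      refine Finset.sum_pos (fun i _ => ?_) hn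
      obtain ⟨i', hi', -, ei⟩ := exists_index_of_per h.pos h.per (j + 1) i
      rw [← ei]
      obtain ⟨k, rfl⟩ := Nat.exists_eq_add_of_le hi'
      exact h1 k
    linarith
  · push Not at h0
    have : ∑ j ∈ Finset.range n, ori (center n v) (v j) z < 0 :=
      Finset.sum_neg (fun i _ => h0 i) hn
    linarith

lemma ori_nonneg_of_mem_segment {a b x y z : ℍ} (h1 : 0 ≤ ori a b x) (h2 : 0 ≤ ori a b y)
    (hz : z ∈ segment x y) : 0 ≤ ori a b z := by
  obtain ⟨s, t, hs, ht, e⟩ := mem_segment_iff.1 hz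
  rw [ori, e, tri_add_right, tri_smul_right, tri_smul_right]
  exact add_nonneg (mul_nonneg hs h1) (mul_nonneg ht h2)

lemma ori_nonneg_vertex (h : CPoly n v) (i j : ℕ) : 0 ≤ ori (v i) (v (i + 1)) (v j) := by
  obtain ⟨j', h1, h2, ej⟩ := exists_index_of_per h.pos h.per i j
  rw [← ej]
  rcases h1.eq_or_lt with rfl | h1
  · simp
  · exact h.nonneg i (i + 1) j' (by omega) (by omega) (by omega)

/-- A small move towards the centre makes all the inequalities strict. -/
lemma mem_closure_inner (h : CPoly n v) {z : ℍ} (hz : ∀ i, 0 ≤ ori (v i) (v (i + 1)) z) :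
    z ∈ closure (inner v) := by
  set o := center n v
  have ho := h.center_mem_inner
  have hc : Tendsto (fun t : ℝ => pt ((1 : ℝ) • vec z + t • vec o)) (𝓝[>] 0) (𝓝 z) := by
    have h1 : ContinuousAt pt ((1 : ℝ) • vec z + (0 : ℝ) • vec o) := by
      rw [one_smul, zero_smul, add_zero]; exact continuousAt_pt (fut_vec z)
    have h2 : Tendsto (fun t : ℝ => (1 : ℝ) • vec z + t • vec o) (𝓝[>] 0)
        (𝓝 ((1 : ℝ) • vec z + (0 : ℝ) • vec o)) := by
      refine Tendsto.mono_left (Continuous.tendsto ?_ _) nhdsWithin_le_nhds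
      fun_prop
    have := h1.tendsto.comp h2
    rw [show pt ((1 : ℝ) • vec z + (0 : ℝ) • vec o) = z by
      rw [one_smul, zero_smul, add_zero, pt_vec]] at this
    exact this
  refine mem_closure_of_tendsto hc ?_
  filter_upwards [self_mem_nhdsWithin] with t ht i
  have ht : 0 < t := ht
  obtain ⟨c, hc, e⟩ := exists_vec_pt (fut_comb (fut_vec z) (fut_vec o) zero_le_one ht.le
    (by linarith))
  rw [ori, e, tri_smul_right, tri_add_right, tri_smul_right, tri_smul_right]
  have h1 := hz i
  have h2 := ho i
  rw [ori] at h1 h2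
  have : 0 < t * tri (vec (v i)) (vec (v (i + 1))) (vec o) := by positivity
  refine mul_pos hc (by linarith)

/-- A frontier point lies on some edge line `i` and in the sector of some edge `j`. If it were
strictly inside edge `j`, its expansion in the centre and the ends of edge `j` would be strictly
positive on line `i`. So it is a nonnegative combination of the ends of edge `j`. -/
lemma frontier_inner (h : CPoly n v) : frontier (inner v) = ⋃ i, segment (v i) (v (i + 1)) := by
  rw [h.isOpen_inner.frontier_eq]
  ext z
  rw [Set.mem_iUnion]
  constructor
  · rintro ⟨hz, hz'⟩
    have h0 : ∀ i, 0 ≤ ori (v i) (v (i + 1)) z := by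
      intro i
      have : IsClosed {z | 0 ≤ ori (v i) (v (i + 1)) z} := isClosed_le continuous_const
        (continuous_ori continuous_const continuous_const continuous_id)
      exact closure_minimal (fun w hw => (hw i).le) this hz
    have : ∃ i, ori (v i) (v (i + 1)) z = 0 := by
      by_contra hc
      push Not at hc
      exact hz' fun i => lt_of_le_of_ne (h0 i) (hc i).symm
    obtain ⟨i, hi⟩ := this
    obtain ⟨j, hj1, hj2⟩ := h.exists_sector z
    refine ⟨j, ?_⟩
    set o := center n v
    have ho := h.center_mem_inner
    have hd : 0 < tri (vec o) (vec (v j)) (vec (v (j + 1))) := by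
      have := ho j
      rwa [ori, ← tri_rot] at this
    have hx := tri_expand (vec o) (vec (v j)) (vec (v (j + 1))) (vec z)
    set d := tri (vec o) (vec (v j)) (vec (v (j + 1)))
    have e1 : tri (vec z) (vec (v j)) (vec (v (j + 1))) = ori (v j) (v (j + 1)) z := tri_rot _ _ _
    have e2 : tri (vec o) (vec z) (vec (v (j + 1))) = -ori o (v (j + 1)) z := tri_swap _ _ _
    have e3 : tri (vec o) (vec (v j)) (vec z) = ori o (v j) z := rfl
    rw [e1, e2, e3] at hx
    have hz0 : ori (v j) (v (j + 1)) z = 0 := by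
      refine le_antisymm (not_lt.1 fun hlt => ?_) (h0 j)
      have := congrArg (tri (vec (v i)) (vec (v (i + 1)))) hx
      simp only [tri_add_right, tri_smul_right] at this
      change d * ori (v i) (v (i + 1)) z = _ * ori (v i) (v (i + 1)) o
        + _ * ori (v i) (v (i + 1)) (v j) + _ * ori (v i) (v (i + 1)) (v (j + 1)) at this
      rw [hi, mul_zero] at this
      have p1 := mul_pos hlt (ho i)
      have p2 := mul_nonneg (neg_nonneg.2 hj2) (h.ori_nonneg_vertex i j)
      have p3 := mul_nonneg hj1 (h.ori_nonneg_vertex i (j + 1))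
      linarith
    rw [hz0, zero_smul, zero_add] at hx
    refine mem_segment_of_vec (s := d⁻¹ * -ori o (v (j + 1)) z) (t := d⁻¹ * ori o (v j) z)
      (mul_nonneg (inv_pos.2 hd).le (neg_nonneg.2 hj2)) (mul_nonneg (inv_pos.2 hd).le hj1) ?_
    rw [mul_smul, mul_smul, ← smul_add, ← hx, smul_smul, inv_mul_cancel₀ hd.ne', one_smul]
  · rintro ⟨i, hi⟩
    refine ⟨h.mem_closure_inner fun k => ori_nonneg_of_mem_segment (h.ori_nonneg_vertex k i)
      (h.ori_nonneg_vertex k (i + 1)) hi, fun hz => ?_⟩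
    have := hz i
    obtain ⟨s, t, hs, ht, e⟩ := mem_segment_iff.1 hi
    rw [ori, e, tri_add_right, tri_smul_right, tri_smul_right, tri_self_outer,
      tri_self_right] at this
    simp at this

/-- With a vertex `w` that comes after both edges and is off the first line, the volume of `v (a +
1)`, `v w`, `z` is positive when `z` is read on edge `a` and nonpositive when it is read on edge
`b`. -/
lemma not_mem_both_edges (h : CPoly n v) {a b w : ℕ} (hab : a + 1 ≤ b) (hbw : b + 1 ≤ w)
    (hwa : w ≤ a + n) {z : ℍ} {s t s' t' : ℝ} (hs : 0 < s) (hs' : 0 ≤ s') (ht' : 0 ≤ t')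
    (e : vec z = s • vec (v a) + t • vec (v (a + 1)))
    (e' : vec z = s' • vec (v b) + t' • vec (v (b + 1)))
    (hw : ori (v a) (v (a + 1)) (v w) ≠ 0) : False := by
  have hw : 0 < ori (v a) (v (a + 1)) (v w) :=
    lt_of_le_of_ne (h.ori_nonneg_vertex a w) hw.symm
  have h1 : ori (v (a + 1)) (v w) z = s * ori (v a) (v (a + 1)) (v w) := by
    rw [ori, e, tri_add_right, tri_smul_right, tri_smul_right, tri_self_outer, ori, ← tri_rot]
    ring
  have h2 : ori (v (a + 1)) (v w) z =
      -(s' * ori (v (a + 1)) (v b) (v w) + t' * ori (v (a + 1)) (v (b + 1)) (v w)) := by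
    rw [ori, e', tri_add_right, tri_smul_right, tri_smul_right, tri_swap, tri_swap _ (vec (v (b + 1)))]
    simp only [ori]; ring
  have p1 := mul_nonneg hs' (h.nonneg (a + 1) b w hab (by omega) (by omega))
  have p2 := mul_nonneg ht' (h.nonneg (a + 1) (b + 1) w (by omega) (by omega) (by omega))
  have p3 := mul_pos hs hw
  linarith

lemma pos_left_of_ne {a b z : ℍ} (hz : z ∈ segment a b) (hne : z ≠ b) :
    ∃ s t : ℝ, 0 < s ∧ 0 ≤ t ∧ vec z = s • vec a + t • vec b := by
  obtain ⟨s, t, hs, ht, e⟩ := mem_segment_iff.1 hz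
  refine ⟨s, t, lt_of_le_of_ne hs fun h0 => hne ?_, ht, e⟩
  rw [← h0, zero_smul, zero_add] at e
  have := bil_vec_self z
  rw [e, bil_smul_left, bil_smul_right, bil_vec_self] at this
  have ht1 : t = 1 := by nlinarith
  rw [ht1, one_smul] at e
  exact vec_injective e

/-- A vertex `w` off line `i` settles the matter when it comes after edge `j`. Otherwise `v j` is on
line `i`; then either `w` is off line `j` and the edges exchange roles, or `v (j + 1)` is off line
`i` and serves as the witness. -/
lemma disjoint_edges (h : CPoly n v) {i j : ℕ} (hij : i < j) (hj : j < i + n) :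
    Disjoint (segment (v i) (v (i + 1)) \ {v (i + 1)}) (segment (v j) (v (j + 1)) \ {v (j + 1)}) := by
  rw [Set.disjoint_left]
  rintro z ⟨hz, hz1⟩ ⟨hz', hz1'⟩
  obtain ⟨s, t, hs, ht, e⟩ := pos_left_of_ne hz hz1
  obtain ⟨s', t', hs', ht', e'⟩ := pos_left_of_ne hz' hz1'
  obtain ⟨w, hw1, hw2, hw3⟩ := h.exists_pos i
  rcases lt_or_ge j w with hlt | hle
  · exact h.not_mem_both_edges (w := w) hij (by omega) (by omega) hs hs'.le ht' e e' hw3.ne'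
  have hz0 : ori (v i) (v (i + 1)) z = 0 := by
    rw [ori, e, tri_add_right, tri_smul_right, tri_smul_right, tri_self_outer, tri_self_right]
    ring
  have hz0' := hz0
  rw [ori, e', tri_add_right, tri_smul_right, tri_smul_right] at hz0
  have p1 := h.ori_nonneg_vertex i j
  have p2 := h.ori_nonneg_vertex i (j + 1)
  have hj0 : ori (v i) (v (i + 1)) (v j) = 0 := by
    refine le_antisymm (not_lt.1 fun hlt => ?_) p1
    have := mul_pos hs' hlt
    have := mul_nonneg ht' p2
    simp only [ori] at *
    linarith
  by_cases hw4 : ori (v j) (v (j + 1)) (v w) = 0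
  · by_cases hj1 : ori (v i) (v (i + 1)) (v (j + 1)) = 0
    · have : ori (v j) (v (j + 1)) (v i) = 0 :=
        ori_eq_zero_of_line (h.edge i) hj0 hj1 (by simp)
      have h2 : ori (v j) (v (j + 1)) (v (i + 1)) = 0 :=
        ori_eq_zero_of_line (h.edge i) hj0 hj1 (by simp)
      exact hw3.ne' (ori_eq_zero_of_line (h.edge j) this h2 hw4)
    · have hlt : 0 < ori (v i) (v (i + 1)) (v (j + 1)) := lt_of_le_of_ne p2 (Ne.symm hj1)
      have ht0 : t' = 0 := by
        have := mul_nonneg hs'.le p1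
        simp only [ori] at *
        by_contra hne
        have := mul_pos (lt_of_le_of_ne ht' (Ne.symm hne)) hlt
        linarith
      have hjn : j + 1 ≠ i + n := by
        intro he
        rw [he, h.per] at hj1
        simp at hj1
      exact h.not_mem_both_edges (a := i) (b := j) (w := j + 1) hij le_rfl (by omega) hs hs'.le ht'
        e e' hj1
  · refine h.not_mem_both_edges (a := j) (b := i + n) (w := w + n) (by omega) (by omega) (by omega)
      hs' hs.le ht e' ?_ (by rwa [h.per])
    rwa [h.per, add_right_comm, h.per]

end CPoly

/-! ### Cyclic sequences as periodic sequences. -/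

/-- The periodic extension of a cyclic sequence of vertices. -/
def ext {n : ℕ} [NeZero n] (p : Fin n → ℍ) (k : ℕ) : ℍ := p (Fin.ofNat n k)

lemma ext_per {n : ℕ} [NeZero n] (p : Fin n → ℍ) (k : ℕ) : ext p (k + n) = ext p k := by
  simp [ext, Fin.ofNat]

@[simp] lemma ext_val {n : ℕ} [NeZero n] (p : Fin n → ℍ) (i : Fin n) : ext p i = p i := by
  simp [ext, Fin.ofNat, Nat.mod_eq_of_lt i.2]

lemma ext_succ {n : ℕ} [NeZero n] (p : Fin n → ℍ) (i : Fin n) :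
    ext p (i + 1) = p (finRotate n i) := by
  rw [finRotate_apply, ext]
  congr 1
  ext
  simp [Fin.ofNat, Fin.val_add]

lemma ext_eq_succ {n : ℕ} [NeZero n] (p : Fin n → ℍ) (k : ℕ) :
    ext p (k + 1) = p (finRotate n (Fin.ofNat n k)) := by
  rw [← ext_succ p]
  simp [ext, Fin.ofNat]

lemma curve_eq {n : ℕ} [NeZero n] (p : Fin n → ℍ) :
    curve p = ⋃ k, segment (ext p k) (ext p (k + 1)) := by
  ext z
  simp only [curve, edge, Set.mem_iUnion]
  constructor
  · rintro ⟨i, hi⟩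
    exact ⟨i, by rwa [ext_val, ext_succ]⟩
  · rintro ⟨k, hk⟩
    exact ⟨Fin.ofNat n k, by rw [← ext_eq_succ p]; exact hk⟩

lemma CPoly.isConvexInterior {n : ℕ} [NeZero n] {p : Fin n → ℍ} (h : CPoly n (ext p)) :
    IsConvexInterior p (inner (ext p)) :=
  ⟨⟨_, h.center_mem_inner⟩, h.isOpen_inner, CPoly.isConvex_inner _, by
    rw [h.frontier_inner, curve_eq]⟩

lemma CPoly.isConvexPolygon {n : ℕ} [NeZero n] {p : Fin n → ℍ} (h : CPoly n (ext p)) :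
    IsConvexPolygon p := by
  refine ⟨⟨fun i => ?_, fun i j hij => ?_⟩, _, h.isConvexInterior⟩
  · have := h.edge i
    rwa [ext_val, ext_succ] at this
  · rw [HypPlane.edge, HypPlane.edge, ← ext_succ p i, ← ext_succ p j, ← ext_val p i, ← ext_val p j]
    have hi := i.2
    have hj := j.2
    rcases lt_or_gt_of_ne hij with hlt | hlt
    · exact h.disjoint_edges hlt (by omega)
    · exact (h.disjoint_edges hlt (by omega)).symm

end HypPlane

namespace HypPlane
open Filter Topology

/-! ### Convex polygons are positively oriented, up to reflection -/

lemma exists_comb_of_ori_eq_zero {a b z : ℍ} (hab : a ≠ b) (h : ori a b z = 0) :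
    ∃ s t : ℝ, vec z = s • vec a + t • vec b := by
  have hx := frame_expand (vec a) (vec b) (vec z)
  have h1 := one_lt_bil hab
  set X := bil (vec a) (vec b)
  rw [show tri (vec a) (vec b) (vec z) = 0 from h, zero_smul, sub_zero, bil_vec_self,
    bil_vec_self] at hx
  have hne : X ^ 2 - 1 * 1 ≠ 0 := by nlinarith
  refine ⟨(X ^ 2 - 1 * 1)⁻¹ * (X * bil (vec b) (vec z) - 1 * bil (vec a) (vec z)),
    (X ^ 2 - 1 * 1)⁻¹ * (X * bil (vec a) (vec z) - 1 * bil (vec b) (vec z)), ?_⟩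
  rw [mul_smul, mul_smul, ← smul_add, ← hx, smul_smul, inv_mul_cancel₀ hne, one_smul]

lemma eq_of_vec_eq_smul {z w : ℍ} {s : ℝ} (h : vec z = s • vec w) : z = w := by
  have hs : 0 < s := by
    have h1 := vec_pos z
    rw [h] at h1
    exact pos_of_mul_pos_left h1 (vec_pos w).le
  have := bil_vec_self z
  rw [h, bil_smul_left, bil_smul_right, bil_vec_self] at this
  have hs1 : s = 1 := by nlinarith
  rw [hs1, one_smul] at h
  exact vec_injective h

lemma pos_of_comb {a b z : ℍ} {s t : ℝ} (h : vec z = s • vec a + t • vec b) (hs : s ≤ 0) :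
    0 < t := by
  have h1 := vec_pos z
  rw [h] at h1
  have h1 : 0 < s * (vec a).2.2 + t * (vec b).2.2 := h1
  have h2 := mul_nonneg (neg_nonneg.2 hs) (vec_pos a).le
  have h3 : 0 < t * (vec b).2.2 := by linarith
  exact pos_of_mul_pos_left h3 (vec_pos b).le

lemma ori_comb {a b c d z : ℍ} {s t : ℝ} (h : vec z = s • vec c + t • vec d) :
    ori a b z = s * ori a b c + t * ori a b d := by
  rw [ori, h, tri_add_right, tri_smul_right, tri_smul_right]; rfl

/-- If `c` is the combination `s a + t b` with `t ≤ 0`, then `a` lies between `c` and `b`. -/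
lemma mem_segment_of_neg {a b c : ℍ} {s t : ℝ} (h : vec c = s • vec a + t • vec b) (ht : t ≤ 0) :
    ∃ s' t' : ℝ, 0 < s' ∧ 0 ≤ t' ∧ vec a = s' • vec c + t' • vec b := by
  have hs : 0 < s := pos_of_comb (by rw [add_comm] at h; exact h) ht
  refine ⟨s⁻¹, s⁻¹ * -t, inv_pos.2 hs, mul_nonneg (inv_pos.2 hs).le (by linarith), ?_⟩
  rw [h, smul_add, smul_smul, smul_smul, inv_mul_cancel₀ hs.ne', one_smul, add_assoc, ← add_smul]
  simp

/-- The line of a boundary segment misses the domain: were `z` on it, then `z`, `a` or `b` would be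
a boundary point inside `D`, because points between an interior point and a point of the closure are
interior. -/
lemma ori_ne_zero_of_mem {D : Set ℍ} (ho : IsOpen D) (hD : IsConvex D) {a b z : ℍ} (hab : a ≠ b)
    (hs : segment a b ⊆ frontier D) (hz : z ∈ D) : ori a b z ≠ 0 := by
  intro h0
  have hdis : ∀ w ∈ frontier D, w ∉ D := fun w hw => by
    rw [ho.frontier_eq] at hw; exact hw.2
  have ha := hs (left_mem_segment a b)
  have hb := hs (right_mem_segment a b)
  obtain ⟨s, t, e⟩ := exists_comb_of_ori_eq_zero hab h0
  rcases lt_or_ge s 0 with h1 | h1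
  · rw [add_comm] at e
    obtain ⟨s', t', hs', ht', e'⟩ := mem_segment_of_neg e h1.le
    exact hdis b hb (hD.mem_of_mem_closure ho hz (frontier_subset_closure ha) hs' ht' e')
  rcases lt_or_ge t 0 with h2 | h2
  · obtain ⟨s', t', hs', ht', e'⟩ := mem_segment_of_neg e h2.le
    exact hdis a ha (hD.mem_of_mem_closure ho hz (frontier_subset_closure hb) hs' ht' e')
  · exact hdis z (hs (mem_segment_of_vec h1 h2 e)) hz

lemma ori_pos_of_mem {D : Set ℍ} (ho : IsOpen D) (hD : IsConvex D) {a b z w : ℍ} (hab : a ≠ b)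
    (hs : segment a b ⊆ frontier D) (hz : z ∈ D) (hw : w ∈ D) (h : 0 < ori a b z) :
    0 < ori a b w := by
  by_contra hc
  have hc : ori a b w < 0 := lt_of_le_of_ne (not_lt.1 hc) (ori_ne_zero_of_mem ho hD hab hs hw)
  -- These weights select the point where the segment from `z` to `w` crosses the line `a b`.
  have hm := pt_comb_mem_segment z w (s := -ori a b w) (t := ori a b z) (by linarith) h.le
    (by linarith)
  refine ori_ne_zero_of_mem ho hD hab hs (hD _ hz _ hw hm) ?_
  obtain ⟨c, -, e⟩ := exists_vec_pt (fut_comb (fut_vec z) (fut_vec w) (s := -ori a b w)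
    (t := ori a b z) (by linarith) h.le (by linarith))
  rw [ori, e, tri_smul_right, tri_add_right, tri_smul_right, tri_smul_right]
  simp only [ori]; ring

lemma ori_nonneg_of_mem_closure {D : Set ℍ} {a b w : ℍ} (h : ∀ z ∈ D, 0 < ori a b z)
    (hw : w ∈ closure D) : 0 ≤ ori a b w := by
  have : IsClosed {z | 0 ≤ ori a b z} := isClosed_le continuous_const
    (continuous_ori continuous_const continuous_const continuous_id)
  exact closure_minimal (fun z hz => (h z hz).le) this hw

/-- A simple closed polygon that bounds a convex domain. -/
structure Bounds (n : ℕ) (v : ℕ → ℍ) (D : Set ℍ) : Prop where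
  three_le : 3 ≤ n
  per : ∀ k, v (k + n) = v k
  edge : ∀ i, v i ≠ v (i + 1)
  disj : ∀ i j, i < j → j < i + n →
    Disjoint (segment (v i) (v (i + 1)) \ {v (i + 1)}) (segment (v j) (v (j + 1)) \ {v (j + 1)})
  isOpen : IsOpen D
  conv : IsConvex D
  frontier_eq : frontier D = ⋃ i, segment (v i) (v (i + 1))

namespace Bounds
variable {n : ℕ} {v : ℕ → ℍ} {D : Set ℍ}

lemma segment_subset (h : Bounds n v D) (i : ℕ) : segment (v i) (v (i + 1)) ⊆ frontier D := by
  rw [h.frontier_eq]; exact Set.subset_iUnion (fun i => segment (v i) (v (i + 1))) i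

lemma mem_closure (h : Bounds n v D) (i : ℕ) : v i ∈ closure D :=
  frontier_subset_closure (h.segment_subset i (left_mem_segment _ _))

lemma ne (h : Bounds n v D) {i j : ℕ} (hij : i < j) (hj : j < i + n) : v i ≠ v j := by
  intro he
  exact Set.disjoint_left.1 (h.disj i j hij hj) ⟨left_mem_segment _ _, h.edge i⟩
    (by rw [he]; exact ⟨left_mem_segment _ _, h.edge j⟩)

lemma not_mem_segment (h : Bounds n v D) {i j : ℕ} (hij : i < j) (hj : j + 1 < i + n) :
    v i ∉ segment (v j) (v (j + 1)) := fun hm =>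
  Set.disjoint_left.1 (h.disj i j hij (by omega)) ⟨left_mem_segment _ _, h.edge i⟩
    ⟨hm, h.ne (by omega) hj⟩

/-- If the side changed at `v (i + 1)`, the domain would lie on opposite sides of the two edges and
the three vertices would be collinear. The path would fold back on itself, which simplicity forbids.
-/
lemma sign_succ (h : Bounds n v D) {z : ℍ} (hz : z ∈ D) {i : ℕ}
    (hi : 0 < ori (v i) (v (i + 1)) z) : 0 < ori (v (i + 1)) (v (i + 2)) z := by
  by_contra hc
  have hc : ori (v (i + 1)) (v (i + 2)) z < 0 := lt_of_le_of_ne (not_lt.1 hc)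
    (ori_ne_zero_of_mem h.isOpen h.conv (h.edge (i + 1)) (h.segment_subset (i + 1)) hz)
  have h1 : 0 ≤ ori (v i) (v (i + 1)) (v (i + 2)) :=
    ori_nonneg_of_mem_closure (fun w hw => ori_pos_of_mem h.isOpen h.conv (h.edge i)
      (h.segment_subset i) hz hw hi) (h.mem_closure _)
  have h2 : 0 ≤ ori (v (i + 2)) (v (i + 1)) (v i) := by
    refine ori_nonneg_of_mem_closure (fun w hw => ori_pos_of_mem h.isOpen h.conv
      (h.edge (i + 1)).symm ?_ hz hw ?_) (h.mem_closure _)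
    · rw [segment_comm]; exact h.segment_subset (i + 1)
    · rw [ori_swap_left]; linarith
  have h3 : ori (v i) (v (i + 1)) (v (i + 2)) = 0 := by
    refine le_antisymm ?_ h1
    rw [ori_swap_left, ← ori_rot] at h2
    linarith
  obtain ⟨s, t, e⟩ := exists_comb_of_ori_eq_zero (h.edge i) h3
  have hn := h.three_le
  have hs : 0 < s := by
    rw [← ori_rot z, ori_comb e, ori_self_right, mul_zero, add_zero, ori_rot, ori_swap_left] at hc
    nlinarith
  rcases le_or_gt 0 t with ht | ht
  · exact Set.disjoint_left.1 (h.disj i (i + 2) (by omega) (by omega))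
      ⟨mem_segment_of_vec hs.le ht e, (h.edge (i + 1)).symm⟩ ⟨left_mem_segment _ _, h.edge (i + 2)⟩
  · obtain ⟨s', t', hs', ht', e'⟩ := mem_segment_of_neg e ht.le
    refine Set.disjoint_left.1 (h.disj i (i + 1) (by omega) (by omega))
      ⟨left_mem_segment _ _, h.edge i⟩ ⟨?_, h.ne (by omega) (by omega)⟩
    rw [add_comm] at e'
    exact mem_segment_of_vec ht' hs'.le e'

lemma sign (h : Bounds n v D) {z : ℍ} (hz : z ∈ D) :
    (∀ i, 0 < ori (v i) (v (i + 1)) z) ∨ ∀ i, ori (v i) (v (i + 1)) z < 0 := by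
  by_cases h0 : ∃ i, 0 < ori (v i) (v (i + 1)) z
  · left
    obtain ⟨i, hi⟩ := h0
    have : ∀ k, 0 < ori (v (i + k)) (v (i + k + 1)) z := by
      intro k
      induction k with
      | zero => exact hi
      | succ k ih => exact h.sign_succ hz ih
    intro j
    obtain ⟨j', hj', -, ej⟩ := exists_index_of_per (by have := h.three_le; omega : 0 < n)
      (v := fun k => (v k, v (k + 1))) (fun k => by rw [h.per, add_right_comm, h.per]) i j
    simp only [Prod.mk.injEq] at ej
    rw [← ej.1, ← ej.2]
    obtain ⟨k, rfl⟩ := Nat.exists_eq_add_of_le hj'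
    exact this k
  · right
    push Not at h0
    exact fun i => lt_of_le_of_ne (h0 i) (ori_ne_zero_of_mem h.isOpen h.conv (h.edge i)
      (h.segment_subset i) hz)

/-- Induction on `k` by the Plücker relation in the pencil of lines through `v i`, which needs only
triples containing an edge. It can fail only if `v k` is on the line of edge `i`. If `v k` is behind
`v i`, so is the next vertex and the two signs agree. If it is ahead, then `v j` is also on the
line, and ahead. -/
lemma nonneg_aux (h : Bounds n v D) (hp : ∀ i, ∀ z ∈ D, 0 < ori (v i) (v (i + 1)) z) {i j k : ℕ}
    (hij : i < j) (hjk : j ≤ k) (hk : k < i + n) : 0 ≤ ori (v i) (v j) (v k) := by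
  have H1 : ∀ i j, 0 ≤ ori (v i) (v (i + 1)) (v j) := fun i j =>
    ori_nonneg_of_mem_closure (hp i) (h.mem_closure j)
  have H2 : ∀ j, 0 ≤ ori (v i) (v j) (v (j + 1)) := fun j => by rw [ori_rot]; exact H1 j i
  -- A negative coefficient `t` says that the vertex is on the line of edge `i` behind `v i`. The
  -- next vertex stays there, since `v i` cannot lie on another edge.
  have opp_succ : ∀ k, i < k → k + 1 < i + n →
      (∃ s t : ℝ, t < 0 ∧ vec (v k) = s • vec (v i) + t • vec (v (i + 1))) →
      ∃ s t : ℝ, t < 0 ∧ vec (v (k + 1)) = s • vec (v i) + t • vec (v (i + 1)) := by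
    rintro k hik hk ⟨s, t, ht, e⟩
    have h0 : ori (v i) (v (i + 1)) (v (k + 1)) = 0 := by
      refine le_antisymm ?_ (H1 _ _)
      have := H2 k
      rw [ori_swap, ori_comb e, ori_self_outer, mul_zero, zero_add, ori_swap] at this
      nlinarith
    obtain ⟨s', t', e'⟩ := exists_comb_of_ori_eq_zero (h.edge i) h0
    refine ⟨s', t', not_le.1 fun ht' => ?_, e'⟩
    have ht' : 0 < t' := by
      refine lt_of_le_of_ne ht' fun h00 => ?_
      rw [← h00, zero_smul, add_zero] at e'
      exact h.ne (by omega) hk (eq_of_vec_eq_smul e').symm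
    have hsum : (s * t' - t * s') • vec (v i) = t' • vec (v k) + (-t) • vec (v (k + 1)) := by
      rw [e, e']; module
    have hf := (fut_comb (fut_vec (v k)) (fut_vec (v (k + 1))) ht'.le (by linarith : 0 ≤ -t)
      (by linarith)).1
    rw [← hsum] at hf
    have hc : 0 < s * t' - t * s' := pos_of_mul_pos_left hf (vec_pos _).le
    refine h.not_mem_segment hik hk (mem_segment_of_vec (s := (s * t' - t * s')⁻¹ * t')
      (t := (s * t' - t * s')⁻¹ * -t) (by positivity)
      (mul_nonneg (inv_pos.2 hc).le (by linarith)) ?_)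
    rw [mul_smul, mul_smul, ← smul_add, ← hsum, smul_smul, inv_mul_cancel₀ hc.ne', one_smul]
  have opp_mono : ∀ j k, i < j → j ≤ k → k < i + n →
      (∃ s t : ℝ, t < 0 ∧ vec (v j) = s • vec (v i) + t • vec (v (i + 1))) →
      ∃ s t : ℝ, t < 0 ∧ vec (v k) = s • vec (v i) + t • vec (v (i + 1)) := by
    intro j k hij hjk
    induction k, hjk using Nat.le_induction with
    | base => exact fun _ h => h
    | succ k hjk ih => exact fun hk h0 => opp_succ k (by omega) hk (ih (by omega) h0)
  induction k, hjk using Nat.le_induction with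
  | base => simp
  | succ k hjk ih =>
    have ih := ih (by omega)
    by_contra hc
    push Not at hc
    have hpl := tri_plucker (vec (v i)) (vec (v (i + 1))) (vec (v j)) (vec (v k)) (vec (v (k + 1)))
    change ori (v i) (v (i + 1)) (v j) * ori (v i) (v k) (v (k + 1))
      - ori (v i) (v (i + 1)) (v k) * ori (v i) (v j) (v (k + 1))
      + ori (v i) (v (i + 1)) (v (k + 1)) * ori (v i) (v j) (v k) = 0 at hpl
    have p1 := mul_nonneg (H1 i j) (H2 k)
    have p3 := mul_nonneg (H1 i (k + 1)) ih
    have h0 : ori (v i) (v (i + 1)) (v k) = 0 := by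
      by_contra hne
      have := mul_pos (lt_of_le_of_ne (H1 i k) (Ne.symm hne)) (neg_pos.2 hc)
      linarith
    by_cases hopp : ∃ s t : ℝ, t < 0 ∧ vec (v k) = s • vec (v i) + t • vec (v (i + 1))
    · obtain ⟨s', t', ht', e'⟩ := opp_succ k (by omega) hk hopp
      obtain ⟨s, t, ht, e⟩ := hopp
      rw [ori_comb e, ori_self_outer, mul_zero, zero_add] at ih
      rw [ori_comb e', ori_self_outer, mul_zero, zero_add] at hc
      nlinarith
    · obtain ⟨s, t, e⟩ := exists_comb_of_ori_eq_zero (h.edge i) h0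
      have ht : 0 < t := by
        refine lt_of_le_of_ne (not_lt.1 fun hlt => hopp ⟨s, t, hlt, e⟩) fun h00 => ?_
        rw [← h00, zero_smul, add_zero] at e
        exact h.ne (by omega) (by omega) (eq_of_vec_eq_smul e).symm
      have hj0 : ori (v i) (v (i + 1)) (v j) = 0 := by
        refine le_antisymm ?_ (H1 i j)
        rw [ori_comb e, ori_self_outer, mul_zero, zero_add, ori_swap] at ih
        nlinarith
      obtain ⟨s', t', e'⟩ := exists_comb_of_ori_eq_zero (h.edge i) hj0
      rcases lt_or_ge t' 0 with ht' | ht'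
      · exact hopp (opp_mono j k hij hjk (by omega) ⟨s', t', ht', e'⟩)
      · rw [ori_swap, ori_comb e', ori_self_outer, mul_zero, zero_add, ori_swap] at hc
        have := mul_nonneg ht' (H1 i (k + 1))
        linarith

lemma cpoly (h : Bounds n v D) (hne : D.Nonempty)
    (hp : ∀ i, ∀ z ∈ D, 0 < ori (v i) (v (i + 1)) z) : CPoly n v where
  three_le := h.three_le
  per := h.per
  nonneg i j k hij hjk hki := by
    rcases hij.eq_or_lt with rfl | hij
    · simp
    rcases hki.eq_or_lt with rfl | hki
    · rw [h.per]; simp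
    exact h.nonneg_aux hp hij hjk hki
  edge := h.edge
  noncol := by
    by_contra hc
    push Not at hc
    obtain ⟨z, hz⟩ := hne
    have hn := h.three_le
    -- Seen from `z`, collinear vertices would all advance in one direction along their line, so the
    -- closing edge could not be positive.
    have key : ∀ j, j + 1 < n → 0 < ori z (v 0) (v (j + 1)) := by
      intro j
      induction j with
      | zero => intro _; rw [ori_rot]; exact hp 0 z hz
      | succ j ih =>
        intro hj
        have ih := ih (by omega)
        obtain ⟨s, t, e⟩ := exists_comb_of_ori_eq_zero
          (h.ne (i := 0) (j := j + 1) (by omega) (by omega)) (hc 0 (j + 1) (j + 2))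
        have h1 := hp (j + 1) z hz
        rw [← ori_rot, ori_comb e, ori_self_right, mul_zero, add_zero, ori_swap] at h1
        have hs : s < 0 := by
          by_contra hs
          have := mul_nonneg (not_lt.1 hs) ih.le
          linarith
        have ht := pos_of_comb e hs.le
        rw [ori_comb e, ori_self_right, mul_zero, zero_add]
        exact mul_pos ht ih
    have h1 := hp (n - 1) z hz
    have h2 := key (n - 2) (by omega)
    rw [show n - 2 + 1 = n - 1 by omega] at h2
    rw [show n - 1 + 1 = 0 + n by omega, h.per, ← ori_rot, ori_swap] at h1
    linarith

/-- A point of `inner v` outside `D` would give a frontier point of `D` on a segment inside `inner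
v`. Both sets have the same frontier and `inner v` is open. -/
lemma eq_inner (h : Bounds n v D) (hne : D.Nonempty)
    (hp : ∀ i, ∀ z ∈ D, 0 < ori (v i) (v (i + 1)) z) : D = inner v := by
  have hc := h.cpoly hne hp
  refine Set.Subset.antisymm (fun z hz i => hp i z hz) fun z hz => ?_
  by_contra hzD
  obtain ⟨z0, hz0⟩ := hne
  obtain ⟨w, hw, hw'⟩ := exists_mem_segment_frontier hz0 hzD
  have hwi := CPoly.isConvex_inner v _ (fun i => hp i z0 hz0 : z0 ∈ inner v) _ hz hw
  rw [h.frontier_eq, ← hc.frontier_inner, hc.isOpen_inner.frontier_eq] at hw'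
  exact hw'.2 hwi

end Bounds

/-! ### Reflection and transport of polygons by isometries. -/

/-- The reflection in the imaginary axis. -/
noncomputable def reflect : ℍ ≃ᵢ ℍ where
  toFun z := ⟨⟨-z.re, z.im⟩, z.im_pos⟩
  invFun z := ⟨⟨-z.re, z.im⟩, z.im_pos⟩
  left_inv z := UpperHalfPlane.ext_re_im (neg_neg _) rfl
  right_inv z := UpperHalfPlane.ext_re_im (neg_neg _) rfl
  isometry_toFun := by
    refine Isometry.of_dist_eq fun a b => (dist_eq_dist_iff _ _ _ _).2 ?_
    rw [bil_vec, bil_vec]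
    change 1 + ((-a.re - -b.re) ^ 2 + (a.im - b.im) ^ 2) / (2 * a.im * b.im) = _
    congr 2; ring

lemma reflect_re (z : ℍ) : (reflect z).re = -z.re := rfl

lemma reflect_im (z : ℍ) : (reflect z).im = z.im := rfl

lemma ori_reflect (a b c : ℍ) : ori (reflect a) (reflect b) (reflect c) = -ori a b c := by
  simp only [ori, tri_vec, reflect_re, reflect_im]; ring

lemma image_segment (g : ℍ ≃ᵢ ℍ) (a b : ℍ) : g '' segment a b = segment (g a) (g b) := by
  ext z
  obtain ⟨z, rfl⟩ := g.surjective z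
  rw [g.injective.mem_set_image]
  change dist _ _ + dist _ _ = dist _ _ ↔ dist _ _ + dist _ _ = dist _ _
  simp only [g.dist_eq]

lemma IsConvexInterior.image {n : ℕ} {p : Fin n → ℍ} {D : Set ℍ} (h : IsConvexInterior p D)
    (g : ℍ ≃ᵢ ℍ) : IsConvexInterior (g ∘ p) (g '' D) := by
  obtain ⟨h1, h2, h3, h4⟩ := h
  refine ⟨h1.image _, g.toHomeomorph.isOpenMap _ h2, ?_, ?_⟩
  · rintro _ ⟨x, hx, rfl⟩ _ ⟨y, hy, rfl⟩
    rw [← image_segment]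
    exact Set.image_mono (h3 x hx y hy)
  · have := g.toHomeomorph.image_frontier D
    change g '' frontier D = frontier (g '' D) at this
    rw [← this, h4, curve, curve, Set.image_iUnion]
    exact Set.iUnion_congr fun i => image_segment g _ _

lemma IsSimple.image {n : ℕ} {p : Fin n → ℍ} (h : IsSimple p) (g : ℍ ≃ᵢ ℍ) :
    IsSimple (g ∘ p) := by
  refine ⟨fun i => g.injective.ne (h.1 i), fun i j hij => ?_⟩
  have := (Set.disjoint_image_iff g.injective).2 (h.2 i j hij)
  rw [Set.image_sdiff g.injective, Set.image_sdiff g.injective, Set.image_singleton,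
    Set.image_singleton, edge, edge, image_segment, image_segment] at this
  exact this

lemma bounds_ext {n : ℕ} [NeZero n] (hn : 3 ≤ n) {p : Fin n → ℍ} {D : Set ℍ} (hs : IsSimple p)
    (hD : IsConvexInterior p D) : Bounds n (ext p) D where
  three_le := hn
  per := ext_per p
  edge i := by rw [ext_eq_succ]; exact hs.1 _
  disj i j hij hj := by
    rw [ext_eq_succ, ext_eq_succ]
    refine hs.2 _ _ fun he => ?_
    have := congrArg Fin.val he
    simp only [Fin.ofNat] at this
    have h2 := (Nat.modEq_iff_dvd' hij.le).1 this
    have := Nat.le_of_dvd (by omega) h2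
    omega
  isOpen := hD.2.1
  conv := hD.2.2.1
  frontier_eq := by rw [hD.2.2.2, curve_eq]

lemma ext_comp {n : ℕ} [NeZero n] (g : ℍ → ℍ) (p : Fin n → ℍ) : ext (g ∘ p) = g ∘ ext p := rfl

/-- A convex polygon or its mirror image is positively oriented. -/
theorem IsConvexPolygon.cpoly_or {n : ℕ} [NeZero n] (hn : 3 ≤ n) {p : Fin n → ℍ} (hs : IsSimple p)
    {D : Set ℍ} (hD : IsConvexInterior p D) :
    (CPoly n (ext p) ∧ D = inner (ext p)) ∨
      (CPoly n (ext (reflect ∘ p)) ∧ reflect '' D = inner (ext (reflect ∘ p))) := by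
  have hb := bounds_ext hn hs hD
  obtain ⟨z, hz⟩ := hD.1
  rcases hb.sign hz with h | h
  · left
    have hp : ∀ i, ∀ w ∈ D, 0 < ori (ext p i) (ext p (i + 1)) w := fun i w hw =>
      ori_pos_of_mem hb.isOpen hb.conv (hb.edge i) (hb.segment_subset i) hz hw (h i)
    exact ⟨hb.cpoly hD.1 hp, hb.eq_inner hD.1 hp⟩
  · right
    have hb' := bounds_ext hn (hs.image reflect) (hD.image reflect)
    have hz' : reflect z ∈ reflect '' D := ⟨z, hz, rfl⟩
    have hp : ∀ i, ∀ w ∈ reflect '' D,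
        0 < ori (ext (reflect ∘ p) i) (ext (reflect ∘ p) (i + 1)) w := fun i w hw =>
      ori_pos_of_mem hb'.isOpen hb'.conv (hb'.edge i) (hb'.segment_subset i) hz' hw (by
        rw [ext_comp, Function.comp_apply, Function.comp_apply, ori_reflect]
        linarith [h i])
    exact ⟨hb'.cpoly (hD.1.image _) hp, hb'.eq_inner (hD.1.image _) hp⟩

end HypPlane

namespace HypPlane
open Filter Topology

/-! ### Area of triangles as a cocycle -/

/-- The signed area above the geodesic segment from `u` to `v`. -/
noncomputable def omega (u v : ℍ) : ℝ := 2 * Real.arctan ((v.re - u.re) / (u.im + v.im))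

lemma omega_comm (u v : ℍ) : omega v u = -omega u v := by
  rw [omega, omega, ← mul_neg, ← Real.arctan_neg, ← neg_div, neg_sub, add_comm]

@[simp] lemma omega_self (u : ℍ) : omega u u = 0 := by simp [omega]

/-- The signed area of a triangle. -/
noncomputable def sarea (a b c : ℍ) : ℝ := omega a b + omega b c + omega c a

/-- The sum of the cosines of a hyperbolic triangle. -/
noncomputable def csum (a b c : ℍ) : ℝ :=
  1 + bil (vec a) (vec b) + bil (vec b) (vec c) + bil (vec a) (vec c)

lemma csum_pos (a b c : ℍ) : 0 < csum a b c := by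
  have := one_le_bil a b
  have := one_le_bil b c
  have := one_le_bil a c
  unfold csum; linarith

/-- The cosine of the sum is a product of positive cosines times the denominator. The sum lies
within 3π/2 of 0, so a positive cosine puts it within π/2, where the tangent can be inverted. -/
lemma arctan_add_add {s t u : ℝ} (h : 0 < 1 - s * t - t * u - u * s) :
    Real.arctan s + Real.arctan t + Real.arctan u =
      Real.arctan ((s + t + u - s * t * u) / (1 - s * t - t * u - u * s)) := by
  set A := Real.arctan s with hA
  set B := Real.arctan t with hB
  set C := Real.arctan u with hC
  have a1 := Real.cos_arctan_pos s
  have b1 := Real.cos_arctan_pos t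
  have c1 := Real.cos_arctan_pos u
  rw [← hA] at a1
  rw [← hB] at b1
  rw [← hC] at c1
  have a2 : Real.sin A = s * Real.cos A := by
    rw [hA, Real.sin_arctan, Real.cos_arctan]; ring
  have b2 : Real.sin B = t * Real.cos B := by
    rw [hB, Real.sin_arctan, Real.cos_arctan]; ring
  have c2 : Real.sin C = u * Real.cos C := by
    rw [hC, Real.sin_arctan, Real.cos_arctan]; ring
  have hc : Real.cos (A + B + C) =
      Real.cos A * Real.cos B * Real.cos C * (1 - s * t - t * u - u * s) := by
    rw [Real.cos_add, Real.cos_add, Real.sin_add, a2, b2, c2]; ring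
  have hs : Real.sin (A + B + C) =
      Real.cos A * Real.cos B * Real.cos C * (s + t + u - s * t * u) := by
    rw [Real.sin_add, Real.cos_add, Real.sin_add, a2, b2, c2]; ring
  have hpos : 0 < Real.cos (A + B + C) := by rw [hc]; positivity
  have hA1 := Real.neg_pi_div_two_lt_arctan s
  have hA2 := Real.arctan_lt_pi_div_two s
  have hB1 := Real.neg_pi_div_two_lt_arctan t
  have hB2 := Real.arctan_lt_pi_div_two t
  have hC1 := Real.neg_pi_div_two_lt_arctan u
  have hC2 := Real.arctan_lt_pi_div_two u
  have h1 : A + B + C < Real.pi / 2 := by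
    by_contra hge
    have := Real.cos_nonpos_of_pi_div_two_le_of_le (not_lt.1 hge) (by linarith)
    linarith
  have h2 : -(Real.pi / 2) < A + B + C := by
    by_contra hge
    have := Real.cos_nonpos_of_pi_div_two_le_of_le (x := -(A + B + C)) (by linarith) (by linarith)
    rw [Real.cos_neg] at this
    linarith
  rw [← Real.arctan_tan h2 h1, Real.tan_eq_sin_div_cos, hc, hs]
  congr 1
  field_simp

/-- Half the area has tangent equal to the volume over the sum of cosines. The cocycle built from
half-plane coordinates is therefore invariant under orientation-preserving isometries. -/
lemma sarea_eq (a b c : ℍ) : sarea a b c = 2 * Real.arctan (ori a b c / csum a b c) := by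
  have h1 := a.im_pos
  have h2 := b.im_pos
  have h3 := c.im_pos
  have hpos := csum_pos a b c
  have e1 : 1 - (b.re - a.re) / (a.im + b.im) * ((c.re - b.re) / (b.im + c.im))
      - (c.re - b.re) / (b.im + c.im) * ((a.re - c.re) / (c.im + a.im))
      - (a.re - c.re) / (c.im + a.im) * ((b.re - a.re) / (a.im + b.im))
      = 2 * (a.im * b.im * c.im) * csum a b c /
        ((a.im + b.im) * (b.im + c.im) * (c.im + a.im)) := by
    simp only [csum, bil_vec]
    generalize a.re = x, b.re = y, c.re = z, a.im = p, b.im = q, c.im = r at *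
    field_simp
    ring
  have e2 : (b.re - a.re) / (a.im + b.im) + (c.re - b.re) / (b.im + c.im)
      + (a.re - c.re) / (c.im + a.im) - (b.re - a.re) / (a.im + b.im) *
        ((c.re - b.re) / (b.im + c.im)) * ((a.re - c.re) / (c.im + a.im))
      = 2 * (a.im * b.im * c.im) * ori a b c /
        ((a.im + b.im) * (b.im + c.im) * (c.im + a.im)) := by
    simp only [ori, tri_vec]
    generalize a.re = x, b.re = y, c.re = z, a.im = p, b.im = q, c.im = r at *
    field_simp
    ring
  rw [sarea, omega, omega, omega, ← mul_add, ← mul_add, arctan_add_add (by rw [e1]; positivity),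
    e1, e2]
  congr 2
  field_simp

/-- Half of the area of a hyperbolic triangle whose sides have hyperbolic cosines `X, Y, Z`. -/
noncomputable def halfArea (X Y Z : ℝ) : ℝ :=
  Real.arccos ((1 + X + Y + Z) / √(2 * (1 + X) * (1 + Y) * (1 + Z)))

lemma ori_sq (a b c : ℍ) : ori a b c ^ 2 =
    1 + 2 * bil (vec a) (vec b) * bil (vec b) (vec c) * bil (vec a) (vec c)
      - bil (vec a) (vec b) ^ 2 - bil (vec b) (vec c) ^ 2 - bil (vec a) (vec c) ^ 2 := by
  rw [ori, tri_sq]; simp only [bil_vec_self]; ring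

lemma sarea_eq_halfArea {a b c : ℍ} (h : 0 ≤ ori a b c) : sarea a b c =
    2 * halfArea (bil (vec a) (vec b)) (bil (vec b) (vec c)) (bil (vec a) (vec c)) := by
  have hS := csum_pos a b c
  rw [sarea_eq, Real.arctan_eq_arccos (div_nonneg h hS.le), halfArea]
  congr 2
  have hX := one_le_bil a b
  have hY := one_le_bil b c
  have hZ := one_le_bil a c
  -- The relation that turns the arctangent into an arccosine of distances only, free of the
  -- orientation.
  have e : csum a b c ^ 2 + ori a b c ^ 2 = 2 * (1 + bil (vec a) (vec b)) *
      (1 + bil (vec b) (vec c)) * (1 + bil (vec a) (vec c)) := by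
    rw [ori_sq, csum]; ring
  have e2 : 1 + (ori a b c / csum a b c) ^ 2 = (csum a b c ^ 2 + ori a b c ^ 2) / csum a b c ^ 2 := by
    field_simp
  rw [e2, e, Real.sqrt_div (by positivity), Real.sqrt_sq hS.le, inv_div]
  rfl

/-- The area enclosed by a closed polygon. -/
noncomputable def area (n : ℕ) (v : ℕ → ℍ) : ℝ := ∑ k ∈ Finset.range n, omega (v k) (v (k + 1))

lemma sum_sarea (o : ℍ) (v : ℕ → ℍ) (n : ℕ) :
    ∑ k ∈ Finset.range n, sarea o (v k) (v (k + 1)) = omega o (v 0) + area n v - omega o (v n) := by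
  induction n with
  | zero => simp [area]
  | succ n ih =>
    rw [Finset.sum_range_succ, ih, area, area, Finset.sum_range_succ, sarea,
      omega_comm o (v (n + 1))]
    ring

/-- The terms joining `o` to the vertices telescope, so the base point is arbitrary. -/
lemma area_eq_sum (o : ℍ) {v : ℕ → ℍ} {n : ℕ} (h : v n = v 0) :
    area n v = ∑ k ∈ Finset.range n, sarea o (v k) (v (k + 1)) := by
  rw [sum_sarea, h]; ring

lemma continuous_omega {X : Type*} [TopologicalSpace X] {f g : X → ℍ} (hf : Continuous f)
    (hg : Continuous g) : Continuous fun x => omega (f x) (g x) := by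
  have h1 := UpperHalfPlane.continuous_re
  have h2 := UpperHalfPlane.continuous_im
  unfold omega
  refine continuous_const.mul (Real.continuous_arctan.comp (Continuous.div ?_ ?_ fun x => ?_))
  · exact (h1.comp hg).sub (h1.comp hf)
  · exact (h2.comp hf).add (h2.comp hg)
  · exact (add_pos (f x).im_pos (g x).im_pos).ne'

/-- The area of a positively oriented convex polygon depends only on distances. -/
lemma CPoly.area_eq {n : ℕ} {v : ℕ → ℍ} (h : CPoly n v) : area n v =
    ∑ k ∈ Finset.range n, 2 * halfArea (bil (vec (v 0)) (vec (v k)))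
      (bil (vec (v k)) (vec (v (k + 1)))) (bil (vec (v 0)) (vec (v (k + 1)))) := by
  have hper : v n = v 0 := by have := h.per 0; rwa [zero_add] at this
  rw [area_eq_sum (v 0) hper]
  exact Finset.sum_congr rfl fun k hk => sarea_eq_halfArea
    (h.nonneg 0 k (k + 1) (by omega) (by omega) (by have := Finset.mem_range.1 hk; omega))

/-- If every triangle of the fan from `v 0` were flat, all vertices would lie on the line `v 0`, `v
1`. This positive value is the bound that later gives compactness. -/
lemma CPoly.area_pos {n : ℕ} {v : ℕ → ℍ} (h : CPoly n v) : 0 < area n v := by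
  have hper : v n = v 0 := by have := h.per 0; rwa [zero_add] at this
  rw [area_eq_sum (v 0) hper]
  have hnn : ∀ k ∈ Finset.range n, 0 ≤ ori (v 0) (v k) (v (k + 1)) := fun k hk =>
    h.nonneg 0 k (k + 1) (by omega) (by omega) (by have := Finset.mem_range.1 hk; omega)
  refine Finset.sum_pos' (fun k hk => ?_) ?_
  · rw [sarea_eq]
    exact mul_nonneg two_pos.le (Real.arctan_nonneg.2 (div_nonneg (hnn k hk) (csum_pos _ _ _).le))
  · by_contra hc
    push Not at hc
    have h0 : ∀ k ∈ Finset.range n, ori (v 0) (v k) (v (k + 1)) = 0 := by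
      intro k hk
      refine le_antisymm (not_lt.1 fun hlt => ?_) (hnn k hk)
      have := hc k hk
      rw [sarea_eq] at this
      have h2 := Real.arctan_pos.2 (div_pos hlt (csum_pos (v 0) (v k) (v (k + 1))))
      linarith
    have h1 : ∀ k, k + 1 < n → ori (v 0) (v 1) (v (k + 1)) = 0 := by
      intro k
      induction k with
      | zero => intro _; simp
      | succ k ih =>
        intro hk
        have hne : v 0 ≠ v (k + 1) := h.injective (by omega) (by omega)
        refine ori_eq_zero_of_line hne (by simp) ?_ (h0 (k + 1) (Finset.mem_range.2 (by omega)))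
        rw [ori_swap, ih (by omega), neg_zero]
    obtain ⟨w, hw1, hw2, hw3⟩ := h.exists_pos 0
    obtain ⟨k, rfl⟩ := Nat.exists_eq_add_of_le' (show 1 ≤ w by omega)
    have := h1 k (by omega)
    rw [zero_add] at hw3
    linarith

end HypPlane

namespace HypPlane
open Filter Topology MeasureTheory

/-! ### Hyperbolic area of regions above geodesic segments -/

lemma volume_eq_lintegral_prod (S : Set ℍ) : volume S =
    ∫⁻ p : ℝ × ℝ in {p | ∃ z ∈ S, (z.re, z.im) = p}, ENNReal.ofReal (1 / p.2 ^ 2) := by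
  rw [UpperHalfPlane.volume_eq_lintegral]
  have e : UpperHalfPlane.coe '' S =
      Complex.measurableEquivRealProd ⁻¹' {p | ∃ z ∈ S, (z.re, z.im) = p} := by
    ext w
    simp only [Set.mem_image, Set.mem_preimage, Set.mem_ofPred_eq,
      Complex.measurableEquivRealProd_apply, Prod.mk.injEq]
    refine exists_congr fun z => and_congr_right fun _ => ?_
    rw [Complex.ext_iff]; rfl
  rw [e, ← Complex.volume_preserving_equiv_real_prod.setLIntegral_comp_preimage_emb
    Complex.measurableEquivRealProd.measurableEmbedding]
  refine lintegral_congr fun w => ?_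
  rw [Complex.measurableEquivRealProd_apply]
  simp only
  rw [← ENNReal.ofReal_coe_nnreal]
  congr 1
  simp

lemma volume_eq_zero_of_prod {S : Set ℍ}
    (h : volume {p : ℝ × ℝ | ∃ z ∈ S, (z.re, z.im) = p} = 0) : volume S = 0 := by
  rw [volume_eq_lintegral_prod]
  exact setLIntegral_measure_zero _ _ h

/-- Geodesics are null sets. -/
lemma volume_line {a b : ℍ} (hab : a ≠ b) : volume {z | ori a b z = 0} = 0 := by
  refine volume_eq_zero_of_prod (measure_mono_null (t := {p : ℝ × ℝ | 0 < p.2 ∧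
    (b.re - a.re) * (p.1 ^ 2 + p.2 ^ 2)
      + ((a.re ^ 2 + a.im ^ 2) - (b.re ^ 2 + b.im ^ 2)) * p.1
      + (a.re * (b.re ^ 2 + b.im ^ 2) - b.re * (a.re ^ 2 + a.im ^ 2)) = 0}) ?_ ?_)
  · rintro _ ⟨z, hz, rfl⟩
    refine ⟨z.im_pos, ?_⟩
    have hz : ori a b z = 0 := hz
    rw [ori, tri_vec, div_eq_zero_iff] at hz
    refine hz.resolve_right ?_
    have := a.im_pos
    have := b.im_pos
    have := z.im_pos
    positivity
  · rw [Measure.volume_eq_prod, Measure.measure_prod_null]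
    -- For a vertical geodesic almost every vertical slice is empty; for a half-circle every slice
    -- has at most one point.
    · by_cases hre : a.re = b.re
      · have him : a.im ≠ b.im := fun h => hab (UpperHalfPlane.ext_re_im hre h)
        have : ∀ᵐ x : ℝ, x ≠ a.re := by
          rw [ae_iff]; simp
        filter_upwards [this] with x hx
        rw [Pi.zero_apply]
        convert measure_empty (μ := (volume : Measure ℝ))
        rw [Set.eq_empty_iff_forall_notMem]
        rintro y ⟨hy, h0⟩
        simp only [← hre] at h0
        have h1 : (a.im ^ 2 - b.im ^ 2) * (x - a.re) = 0 := by linarith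
        rcases mul_eq_zero.1 h1 with h1 | h1
        · have h2 : a.im ^ 2 = b.im ^ 2 := by linarith
          exact him ((pow_left_inj₀ a.im_pos.le b.im_pos.le two_ne_zero).1 h2)
        · exact hx (by linarith)
      · refine Eventually.of_forall fun x => ?_
        refine Set.Subsingleton.measure_zero ?_ _
        rintro y ⟨hy, h0⟩ y' ⟨hy', h0'⟩
        simp only at *
        have h1 : (b.re - a.re) * (y ^ 2 - y' ^ 2) = 0 := by linarith
        rcases mul_eq_zero.1 h1 with h1 | h1
        · exact absurd (by linarith) hre
        · exact (pow_left_inj₀ hy.le hy'.le two_ne_zero).1 (by linarith)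
    · exact (measurableSet_lt measurable_const measurable_snd).inter
        (measurableSet_eq_fun (by fun_prop) measurable_const)

lemma lintegral_inv_sq {c : ℝ} (hc : 0 < c) :
    ∫⁻ y in Set.Ioi c, ENNReal.ofReal (1 / y ^ 2) = ENNReal.ofReal (1 / c) := by
  have hi := integrableOn_Ioi_rpow_of_lt (a := -2) (by norm_num) hc
  have hv := integral_Ioi_rpow_of_lt (a := -2) (by norm_num) hc
  have e : ∀ y ∈ Set.Ioi c, y ^ (-2 : ℝ) = 1 / y ^ 2 := by
    intro y hy
    have hy : 0 < y := hc.trans hy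
    rw [Real.rpow_neg hy.le, one_div]; norm_cast
  rw [← ofReal_integral_eq_lintegral_ofReal]
  · congr 1
    rw [← setIntegral_congr_fun measurableSet_Ioi e, hv]
    norm_num
    rw [Real.rpow_neg_one]
  · exact hi.congr_fun e measurableSet_Ioi
  · filter_upwards with y using by positivity

/-- The geodesic arc over an interval as a graph. -/
lemma arc_pos {ya c L x : ℝ} (hL : 0 < L) (hya : 0 < ya) (hyb : 0 < ya ^ 2 + c * L - L ^ 2)
    (hx : 0 ≤ x) (hxL : x ≤ L) : 0 < ya ^ 2 + c * x - x ^ 2 := by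
  have : (ya ^ 2 + c * x - x ^ 2) * L =
      ya ^ 2 * (L - x) + (ya ^ 2 + c * L - L ^ 2) * x + x * (L - x) * L := by ring
  have h1 : 0 < ya ^ 2 * (L - x) + (ya ^ 2 + c * L - L ^ 2) * x := by
    rcases hx.eq_or_lt with rfl | hx
    · nlinarith [pow_pos hya 2]
    · have := mul_nonneg (pow_pos hya 2).le (sub_nonneg.2 hxL)
      have := mul_pos hyb hx
      linarith
  have h2 : 0 ≤ x * (L - x) * L := mul_nonneg (mul_nonneg hx (sub_nonneg.2 hxL)) hL.le
  exact pos_of_mul_pos_left (by rw [this]; linarith) hL.le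

/-- Integrating `1 / y ^ 2` upwards from the arc leaves the reciprocal of its height, and this
arctangent is a primitive of it; its form is that of `omega`. -/
lemma hasDerivAt_arc {ya c x : ℝ} (hya : 0 < ya) (hq : 0 < ya ^ 2 + c * x - x ^ 2) :
    HasDerivAt (fun x => 2 * Real.arctan (x / (ya + √(ya ^ 2 + c * x - x ^ 2))))
      (1 / √(ya ^ 2 + c * x - x ^ 2)) x := by
  have hs := Real.sqrt_pos.2 hq
  have hss := Real.sq_sqrt hq.le
  have h1 : HasDerivAt (fun x : ℝ => ya ^ 2 + c * x - x ^ 2) (c - 2 * x) x := by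
    have := (((hasDerivAt_id x).const_mul c).const_add (ya ^ 2)).sub (hasDerivAt_pow 2 x)
    refine this.congr_deriv ?_
    simp
  have h2 := (h1.sqrt hq.ne').const_add ya
  have h3 := ((hasDerivAt_id x).div h2 (by positivity)).arctan.const_mul 2
  refine h3.congr_deriv ?_
  change 2 * (1 / (1 + (x / (ya + √(ya ^ 2 + c * x - x ^ 2))) ^ 2) * _) = _
  simp only [id]
  set s := √(ya ^ 2 + c * x - x ^ 2)
  have hden : (ya + s) ^ 2 + x ^ 2 ≠ 0 := by positivity
  have : ya + s ≠ 0 := by positivity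
  have e : 1 + (x / (ya + s)) ^ 2 = ((ya + s) ^ 2 + x ^ 2) / (ya + s) ^ 2 := by field_simp
  rw [e]
  field_simp
  linear_combination hss

lemma volume_above {a b : ℍ} (hab : a.re < b.re) :
    volume {z : ℍ | a.re < z.re ∧ z.re < b.re ∧ 0 < ori a b z} = ENNReal.ofReal (omega a b) := by
  have ha := a.im_pos
  have hb := b.im_pos
  set L := b.re - a.re with hL
  have hL0 : 0 < L := sub_pos.2 hab
  -- With the abscissa measured from `a`, this value makes the arc `y² = a.im² + c x - x²` pass
  -- through `b`.
  set c := (b.im ^ 2 - a.im ^ 2 + L ^ 2) / L with hc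
  have hcL : a.im ^ 2 + c * L - L ^ 2 = b.im ^ 2 := by rw [hc]; field_simp; ring
  have hq : ∀ x, 0 ≤ x → x ≤ L → 0 < a.im ^ 2 + c * x - x ^ 2 := fun x h0 h1 =>
    arc_pos hL0 ha (by rw [hcL]; positivity) h0 h1
  have e : {p : ℝ × ℝ | ∃ z ∈ {z : ℍ | a.re < z.re ∧ z.re < b.re ∧ 0 < ori a b z}, (z.re, z.im) = p}
      = {p | p.1 ∈ Set.Ioo a.re b.re ∧
        √(a.im ^ 2 + c * (p.1 - a.re) - (p.1 - a.re) ^ 2) < p.2} := by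
    ext ⟨x, y⟩
    have key : ∀ z : ℍ, 0 < ori a b z ↔ a.im ^ 2 + c * (z.re - a.re) - (z.re - a.re) ^ 2 < z.im ^ 2 := by
      intro z
      have hz := z.im_pos
      have : ori a b z = (z.im ^ 2 - (a.im ^ 2 + c * (z.re - a.re) - (z.re - a.re) ^ 2)) *
          (L / (2 * a.im * b.im * z.im)) := by
        rw [ori, tri_vec, hc]
        have hbre : b.re = a.re + L := by rw [hL]; ring
        rw [hbre]
        field_simp
        ring
      rw [this, mul_pos_iff_of_pos_right (by positivity), sub_pos]
    simp only [Set.mem_ofPred_eq, Set.mem_Ioo, Prod.mk.injEq]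
    constructor
    · rintro ⟨z, ⟨h1, h2, h3⟩, rfl, rfl⟩
      refine ⟨⟨h1, h2⟩, ?_⟩
      rw [key] at h3
      exact (Real.sqrt_lt' z.im_pos).2 h3
    · rintro ⟨⟨h1, h2⟩, h3⟩
      have hy : 0 < y := (Real.sqrt_nonneg _).trans_lt h3
      refine ⟨⟨⟨x, y⟩, hy⟩, ⟨h1, h2, ?_⟩, rfl, rfl⟩
      rw [key]
      exact (Real.sqrt_lt' hy).1 h3
  rw [volume_eq_lintegral_prod, e]
  have hms : MeasurableSet {p : ℝ × ℝ | p.1 ∈ Set.Ioo a.re b.re ∧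
        √(a.im ^ 2 + c * (p.1 - a.re) - (p.1 - a.re) ^ 2) < p.2} :=
    (measurable_fst measurableSet_Ioo).inter (measurableSet_lt (by fun_prop) measurable_snd)
  rw [← lintegral_indicator hms, Measure.volume_eq_prod, lintegral_prod _ (by
    refine Measurable.aemeasurable (Measurable.indicator ?_ hms)
    fun_prop)]
  have inner_eq : ∀ x : ℝ, ∫⁻ y, Set.indicator {p : ℝ × ℝ | p.1 ∈ Set.Ioo a.re b.re ∧
        √(a.im ^ 2 + c * (p.1 - a.re) - (p.1 - a.re) ^ 2) < p.2}
        (fun p => ENNReal.ofReal (1 / p.2 ^ 2)) (x, y) =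
      (Set.Ioo a.re b.re).indicator (fun x =>
        ENNReal.ofReal (1 / √(a.im ^ 2 + c * (x - a.re) - (x - a.re) ^ 2))) x := by
    intro x
    by_cases hx : x ∈ Set.Ioo a.re b.re
    · rw [Set.indicator_of_mem hx, ← lintegral_inv_sq (Real.sqrt_pos.2 (hq (x - a.re)
        (by linarith [hx.1]) (by linarith [hx.2]))), ← lintegral_indicator measurableSet_Ioi]
      refine lintegral_congr fun y => ?_
      simp only [Set.indicator, Set.mem_ofPred_eq, Set.mem_Ioi, hx, true_and]
    · rw [Set.indicator_of_notMem hx]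
      simp only [Set.indicator, Set.mem_ofPred_eq, hx, false_and, if_false, lintegral_zero]
  simp only [inner_eq]
  rw [lintegral_indicator measurableSet_Ioo]
  have hcont : ContinuousOn (fun x => 1 / √(a.im ^ 2 + c * (x - a.re) - (x - a.re) ^ 2))
      (Set.Icc a.re b.re) := by
    refine ContinuousOn.div continuousOn_const (by fun_prop) fun x hx => ?_
    exact (Real.sqrt_pos.2 (hq _ (by linarith [hx.1]) (by linarith [hx.2]))).ne'
  have hint : IntervalIntegrable (fun x => 1 / √(a.im ^ 2 + c * (x - a.re) - (x - a.re) ^ 2))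
      volume a.re b.re :=
    ContinuousOn.intervalIntegrable (by rwa [Set.uIcc_of_le hab.le])
  have hftc : ∫ x in a.re..b.re, 1 / √(a.im ^ 2 + c * (x - a.re) - (x - a.re) ^ 2)
      = omega a b := by
    have := intervalIntegral.integral_eq_sub_of_hasDerivAt (f := fun x => 2 * Real.arctan
      ((x - a.re) / (a.im + √(a.im ^ 2 + c * (x - a.re) - (x - a.re) ^ 2))))
      (fun x hx => by
        rw [Set.uIcc_of_le hab.le] at hx
        exact (hasDerivAt_arc ha (hq (x - a.re) (by linarith [hx.1])
          (by linarith [hx.2]))).comp_sub_const x a.re) hint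
    rw [this]
    simp only [sub_self, zero_div, Real.arctan_zero, mul_zero, sub_zero]
    rw [← hL, hcL, Real.sqrt_sq hb.le, omega]
  rw [← ofReal_integral_eq_lintegral_ofReal, ← hftc, intervalIntegral.integral_of_le hab.le,
    integral_Ioc_eq_integral_Ioo]
  · exact (intervalIntegrable_iff_integrableOn_Ioo_of_le hab.le).1 hint
  · filter_upwards with x using by positivity

end HypPlane

namespace HypPlane
open Filter Topology MeasureTheory

/-! ### The area of a convex polygon -/

/-- The region above the segment from `a` to `b`, if this segment goes to the right. -/
def above (a b : ℍ) : Set ℍ := {z : ℍ | a.re < z.re ∧ z.re < b.re ∧ 0 < ori a b z}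

lemma isOpen_above (a b : ℍ) : IsOpen (above a b) :=
  (isOpen_lt continuous_const UpperHalfPlane.continuous_re).inter
    ((isOpen_lt UpperHalfPlane.continuous_re continuous_const).inter
      (isOpen_lt continuous_const (continuous_ori continuous_const continuous_const continuous_id)))

lemma volume_above' (a b : ℍ) : volume (above a b) = ENNReal.ofReal (omega a b) := by
  rcases lt_or_ge a.re b.re with h | h
  · exact volume_above h
  · have h1 : above a b = ∅ := by
      rw [Set.eq_empty_iff_forall_notMem]
      rintro z ⟨h1, h2, -⟩
      linarith
    rw [h1, measure_empty, ENNReal.ofReal_of_nonpos]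
    refine mul_nonpos_of_nonneg_of_nonpos two_pos.le ?_
    rw [← neg_nonneg, ← Real.arctan_neg, ← neg_div, neg_sub]
    exact Real.arctan_nonneg.2 (div_nonneg (by linarith) (add_pos a.im_pos b.im_pos).le)

/-- The signed indicator of the region above a segment. -/
noncomputable def signedAbove (a b z : ℍ) : ℝ :=
  (above a b).indicator 1 z - (above b a).indicator 1 z

lemma integrable_indicator_above (a b : ℍ) :
    Integrable ((above a b).indicator (1 : ℍ → ℝ)) :=
  (integrable_indicator_iff (isOpen_above a b).measurableSet).2
    (integrableOn_const (by rw [volume_above']; exact ENNReal.ofReal_ne_top))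

lemma integrable_signedAbove (a b : ℍ) : Integrable (signedAbove a b) :=
  (integrable_indicator_above a b).sub (integrable_indicator_above b a)

lemma integral_signedAbove (a b : ℍ) : ∫ z, signedAbove a b z = omega a b := by
  have h : ∀ a b, ∫ z, (above a b).indicator (1 : ℍ → ℝ) z = max (omega a b) 0 := by
    intro a b
    rw [integral_indicator_one (isOpen_above a b).measurableSet, Measure.real, volume_above',
      ENNReal.toReal_ofReal']
  unfold signedAbove
  rw [integral_sub (integrable_indicator_above a b) (integrable_indicator_above b a), h, h,
    omega_comm a b]
  rcases le_total 0 (omega a b) with h | h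
  · rw [max_eq_left h, max_eq_right (by linarith)]; ring
  · rw [max_eq_right h, max_eq_left (by linarith)]; ring

/-- An open triangle. -/
def triangle (a b c : ℍ) : Set ℍ := {z | 0 < ori a b z ∧ 0 < ori b c z ∧ 0 < ori c a z}

/-- Here `x` is a barycentre of `a`, `b`, `c`. Counted with signs, the edges of the triangle below a
point number one if the point is inside and zero otherwise. The balance relation rules out the
impossible sign patterns. -/
lemma sign_identity {p q r a b c x : ℝ} (hp : p ≠ 0) (hq : q ≠ 0) (hr : r ≠ 0) (ha : x ≠ a)
    (hb : x ≠ b) (hc : x ≠ c) (h : p * (a - x) + q * (b - x) + r * (c - x) = 0)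
    (hs : 0 < p + q + r) :
    (if 0 < r ∧ 0 < p ∧ 0 < q then 1 else 0 : ℝ) =
      ((if a < x ∧ x < b ∧ 0 < r then 1 else 0) - (if b < x ∧ x < a ∧ r < 0 then 1 else 0)) +
      ((if b < x ∧ x < c ∧ 0 < p then 1 else 0) - (if c < x ∧ x < b ∧ p < 0 then 1 else 0)) +
      ((if c < x ∧ x < a ∧ 0 < q then 1 else 0) - (if a < x ∧ x < c ∧ q < 0 then 1 else 0)) := by
  have key : ∀ {s t : ℝ}, (0 < s → 0 < t → 0 < s * t) ∧ (s < 0 → t < 0 → 0 < s * t) ∧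
      (0 < s → t < 0 → s * t < 0) ∧ (s < 0 → 0 < t → s * t < 0) :=
    ⟨mul_pos, mul_pos_of_neg_of_neg, mul_neg_of_pos_of_neg, mul_neg_of_neg_of_pos⟩
  have k1 := @key p (a - x)
  have k2 := @key q (b - x)
  have k3 := @key r (c - x)
  clear key
  rcases lt_or_gt_of_ne hp with hp | hp <;> rcases lt_or_gt_of_ne hq with hq | hq <;>
  rcases lt_or_gt_of_ne hr with hr | hr <;> rcases lt_or_gt_of_ne ha with ha | ha <;>
  rcases lt_or_gt_of_ne hb with hb | hb <;> rcases lt_or_gt_of_ne hc with hc | hc <;>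
  simp only [hp, hq, hr, ha, hb, hc, sub_pos, sub_neg, hp.not_gt, hq.not_gt, hr.not_gt, ha.not_gt,
    hb.not_gt, hc.not_gt, forall_true_left, false_imp_iff, and_true,
    true_and, and_false, if_true, if_false] at k1 k2 k3 ⊢ <;>
  first
  | (exfalso; linarith)
  | norm_num

lemma ae_generic (v : ℕ → ℍ) : ∀ᵐ z : ℍ, ∀ i j, v i ≠ v j → ori (v i) (v j) z ≠ 0 := by
  rw [ae_all_iff]; intro i
  rw [ae_all_iff]; intro j
  by_cases h : v i = v j
  · exact Eventually.of_forall fun z hz => absurd h hz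
  · have := volume_line h
    filter_upwards [measure_eq_zero_iff_ae_notMem.1 this] with z hz _
    exact hz

lemma ae_re_ne (c : ℝ) : ∀ᵐ z : ℍ, z.re ≠ c := by
  set a : ℍ := ⟨⟨c, 1⟩, one_pos⟩
  set b : ℍ := ⟨⟨c, 2⟩, two_pos⟩
  have hab : a ≠ b := by
    intro h
    have := congrArg UpperHalfPlane.im h
    change (1 : ℝ) = 2 at this
    norm_num at this
  filter_upwards [measure_eq_zero_iff_ae_notMem.1 (volume_line hab)] with z hz hzc
  apply hz
  have h1 : a.re = z.re := hzc.symm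
  have h2 : b.re = z.re := hzc.symm
  change ori a b z = 0
  rw [ori, tri_vec, h1, h2, div_eq_zero_iff]
  left; ring

lemma indicator_one_eq_ite {S : Set ℍ} {z : ℍ} {P : Prop} [Decidable P] (h : z ∈ S ↔ P) :
    S.indicator (1 : ℍ → ℝ) z = if P then 1 else 0 := by
  by_cases hP : P
  · rw [if_pos hP, Set.indicator_of_mem (h.2 hP)]; rfl
  · rw [if_neg hP, Set.indicator_of_notMem (mt h.1 hP)]

lemma indicator_triangle {a b c : ℍ} (h : 0 < ori a b c) :
    ∀ᵐ z : ℍ, (triangle a b c).indicator (1 : ℍ → ℝ) z =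
      signedAbove a b z + signedAbove b c z + signedAbove c a z := by
  have hab : a ≠ b := by rintro rfl; simp at h
  have hbc : b ≠ c := by rintro rfl; simp at h
  have hca : c ≠ a := by rintro rfl; simp at h
  filter_upwards [ae_re_ne a.re, ae_re_ne b.re, ae_re_ne c.re,
    measure_eq_zero_iff_ae_notMem.1 (volume_line hab),
    measure_eq_zero_iff_ae_notMem.1 (volume_line hbc),
    measure_eq_zero_iff_ae_notMem.1 (volume_line hca)] with z h1 h2 h3 h4 h5 h6
  have ha := a.im_pos
  have hb := b.im_pos
  have hc := c.im_pos
  have hz := z.im_pos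
  have hx := tri_expand (vec a) (vec b) (vec c) (vec z)
  have e1 : tri (vec z) (vec b) (vec c) = ori b c z := tri_rot _ _ _
  have e2 : tri (vec a) (vec z) (vec c) = ori c a z := by rw [ori, ← tri_rot]
  rw [e1, e2] at hx
  change ori a b c • vec z = _ + ori a b z • vec c at hx
  -- This functional sends the vector of a point `w` to `(w.re - z.re) / w.im`, so it vanishes at
  -- `z` and yields the barycentric relation of the real parts, with weights divided by heights.
  have x2 := congrArg (fun w => w.2.1 - z.re * w.2.2) hx
  have x3 := congrArg (fun w => w.2.2) hx
  simp only [vec, Prod.snd_add, Prod.fst_add, Prod.smul_fst, Prod.smul_snd, smul_eq_mul] at x2 x3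
  have y2 : ori b c z / a.im * (a.re - z.re) + ori c a z / b.im * (b.re - z.re)
      + ori a b z / c.im * (c.re - z.re) = 0 := by
    linear_combination -x2
  have y3 : 0 < ori b c z / a.im + ori c a z / b.im + ori a b z / c.im := by
    have : ori b c z / a.im + ori c a z / b.im + ori a b z / c.im = ori a b c * (1 / z.im) := by
      rw [x3]; ring
    rw [this]; positivity
  have := sign_identity (div_ne_zero h5 ha.ne') (div_ne_zero h6 hb.ne') (div_ne_zero h4 hc.ne')
    h1 h2 h3 y2 y3
  have p1 : ∀ {s t : ℝ}, 0 < t → (0 < s / t ↔ 0 < s) := fun ht => div_pos_iff_of_pos_right ht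
  have p2 : ∀ {s t : ℝ}, 0 < t → (s / t < 0 ↔ s < 0) := fun ht => by
    rw [div_lt_iff₀ ht, zero_mul]
  simp only [p1 ha, p1 hb, p1 hc, p2 ha, p2 hb, p2 hc] at this
  have n1 : ori b a z = -ori a b z := ori_swap_left _ _ _
  have n2 : ori c b z = -ori b c z := ori_swap_left _ _ _
  have n3 : ori a c z = -ori c a z := ori_swap_left _ _ _
  have m1 : ∀ x y : ℍ, z ∈ above y x ↔ y.re < z.re ∧ z.re < x.re ∧ ori x y z < 0 := fun x y => by
    rw [above, Set.mem_ofPred_eq, ori_swap_left x y z, Left.neg_pos_iff]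
  have m0 : z ∈ triangle a b c ↔ 0 < ori a b z ∧ 0 < ori b c z ∧ 0 < ori c a z := Iff.rfl
  have m2 : ∀ x y : ℍ, z ∈ above x y ↔ x.re < z.re ∧ z.re < y.re ∧ 0 < ori x y z :=
    fun _ _ => Iff.rfl
  simp only [signedAbove]
  rw [indicator_one_eq_ite m0, indicator_one_eq_ite (m1 a b), indicator_one_eq_ite (m1 b c),
    indicator_one_eq_ite (m1 c a), indicator_one_eq_ite (m2 a b), indicator_one_eq_ite (m2 b c),
    indicator_one_eq_ite (m2 c a), this]

/-- A point inside would make a positive combination of future vectors equal to zero. -/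
lemma triangle_eq_empty {a b c : ℍ} (h : ori a b c = 0) : triangle a b c = ∅ := by
  rw [Set.eq_empty_iff_forall_notMem]
  rintro z ⟨h1, h2, h3⟩
  have hx := tri_expand (vec a) (vec b) (vec c) (vec z)
  have e1 : tri (vec z) (vec b) (vec c) = ori b c z := tri_rot _ _ _
  have e2 : tri (vec a) (vec z) (vec c) = ori c a z := by rw [ori, ← tri_rot]
  rw [e1, e2] at hx
  change ori a b c • vec z = _ + ori a b z • vec c at hx
  rw [h, zero_smul] at hx
  have := (((fut_vec a).smul h2).add ((fut_vec b).smul h3)).add ((fut_vec c).smul h1)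
  rw [← hx] at this
  exact lt_irrefl _ this.1

lemma integral_triangle {a b c : ℍ} (h : 0 ≤ ori a b c) :
    Integrable ((triangle a b c).indicator (1 : ℍ → ℝ)) ∧
      ∫ z, (triangle a b c).indicator (1 : ℍ → ℝ) z = sarea a b c := by
  rcases h.eq_or_lt with h | h
  · rw [triangle_eq_empty h.symm, sarea_eq, ← h]
    simp
  · have hi := ((integrable_signedAbove a b).add (integrable_signedAbove b c)).add
      (integrable_signedAbove c a)
    have he := indicator_triangle h
    refine ⟨hi.congr (he.mono fun z hz => hz.symm), ?_⟩
    rw [integral_congr_ae he]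
    change ∫ z, (signedAbove a b + signedAbove b c + signedAbove c a) z = _
    rw [integral_add' ((integrable_signedAbove a b).add
      (integrable_signedAbove b c)) (integrable_signedAbove c a),
      integral_add' (integrable_signedAbove a b) (integrable_signedAbove b c)]
    simp only [integral_signedAbove, sarea]

/-! ### Fan triangulation of a polygon from its vertex 0. -/

namespace CPoly
variable {n : ℕ} {v : ℕ → ℍ}

/-- The ray from `v 0` through `z` is crossed only once. A second crossing would put `z` on the
wrong side of edge 0, or `v 0` on edge `k`. -/
lemma fan_sign_mono (h : CPoly n v) {z : ℍ} (hz : z ∈ inner v) {k : ℕ} (hk : 1 ≤ k)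
    (hkn : k + 1 < n) (hneg : ori (v 0) (v k) z < 0) : ori (v 0) (v (k + 1)) z ≤ 0 := by
  by_contra hc
  push Not at hc
  have hx := tri_expand (vec (v 0)) (vec (v k)) (vec (v (k + 1))) (vec z)
  have e1 : tri (vec z) (vec (v k)) (vec (v (k + 1))) = ori (v k) (v (k + 1)) z := tri_rot _ _ _
  have e2 : tri (vec (v 0)) (vec z) (vec (v (k + 1))) = -ori (v 0) (v (k + 1)) z := tri_swap _ _ _
  rw [e1, e2] at hx
  change ori (v 0) (v k) (v (k + 1)) • vec z = _ + ori (v 0) (v k) z • vec (v (k + 1)) at hx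
  have hzk := hz k
  have hd := h.nonneg 0 k (k + 1) (by omega) (by omega) (by omega)
  rcases hd.eq_or_lt with hd | hd
  · rw [← hd, zero_smul] at hx
    have hseg : v 0 ∈ segment (v k) (v (k + 1)) := by
      refine mem_segment_of_vec
        (s := (ori (v k) (v (k + 1)) z)⁻¹ * ori (v 0) (v (k + 1)) z)
        (t := (ori (v k) (v (k + 1)) z)⁻¹ * -ori (v 0) (v k) z) (by positivity)
        (mul_nonneg (by positivity) (by linarith)) ?_
      have : ori (v k) (v (k + 1)) z • vec (v 0) =
          ori (v 0) (v (k + 1)) z • vec (v k) + (-ori (v 0) (v k) z) • vec (v (k + 1)) := by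
        rw [← sub_eq_zero, hx]; module
      rw [mul_smul, mul_smul, ← smul_add, ← this, smul_smul, inv_mul_cancel₀ hzk.ne', one_smul]
    exact Set.disjoint_left.1 (h.disjoint_edges (i := 0) (j := k) (by omega) (by omega))
      ⟨left_mem_segment _ _, h.edge 0⟩ ⟨hseg, h.injective (by omega) (by omega)⟩
  · have := congrArg (tri (vec (v 0)) (vec (v (0 + 1)))) hx
    simp only [tri_add_right, tri_smul_right, tri_self_outer, mul_zero, zero_add] at this
    change _ * ori (v 0) (v 1) z = _ * ori (v 0) (v 1) (v k) + _ * ori (v 0) (v 1) (v (k + 1)) at this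
    have p1 := mul_pos hd (hz 0)
    have p2 := mul_nonneg hc.le (h.ori_nonneg_vertex 0 k)
    have p3 := mul_nonneg (neg_pos.2 hneg).le (h.ori_nonneg_vertex 0 (k + 1))
    rw [zero_add] at p1 p2 p3
    linarith

lemma triangle_subset (h : CPoly n v) {z : ℍ} (hg : ∀ i j, v i ≠ v j → ori (v i) (v j) z ≠ 0)
    {k : ℕ} (hz : z ∈ triangle (v 0) (v k) (v (k + 1))) (hk : k < n) : z ∈ inner v := by
  intro i
  have hd : 0 < ori (v 0) (v k) (v (k + 1)) := by
    refine lt_of_le_of_ne (h.nonneg 0 k (k + 1) (by omega) (by omega) (by omega)) fun h0 => ?_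
    rw [triangle_eq_empty h0.symm] at hz
    exact hz
  obtain ⟨h1, h2, h3⟩ := hz
  have hx := tri_expand (vec (v 0)) (vec (v k)) (vec (v (k + 1))) (vec z)
  have e1 : tri (vec z) (vec (v k)) (vec (v (k + 1))) = ori (v k) (v (k + 1)) z := tri_rot _ _ _
  have e2 : tri (vec (v 0)) (vec z) (vec (v (k + 1))) = ori (v (k + 1)) (v 0) z := by
    rw [ori, ← tri_rot]
  rw [e1, e2] at hx
  have := congrArg (tri (vec (v i)) (vec (v (i + 1)))) hx
  simp only [tri_add_right, tri_smul_right] at this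
  change ori (v 0) (v k) (v (k + 1)) * ori (v i) (v (i + 1)) z = _ * ori (v i) (v (i + 1)) (v 0)
    + _ * ori (v i) (v (i + 1)) (v k) + ori (v 0) (v k) z * ori (v i) (v (i + 1)) (v (k + 1)) at this
  have p1 := mul_nonneg h2.le (h.ori_nonneg_vertex i 0)
  have p2 := mul_nonneg h3.le (h.ori_nonneg_vertex i k)
  have p3 := mul_nonneg h1.le (h.ori_nonneg_vertex i (k + 1))
  refine lt_of_le_of_ne ?_ (hg i (i + 1) (h.edge i)).symm
  by_contra hc
  have := mul_pos hd (neg_pos.2 (not_le.1 hc))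
  linarith

lemma indicator_inner (h : CPoly n v) : ∀ᵐ z : ℍ, (inner v).indicator (1 : ℍ → ℝ) z =
    ∑ k ∈ Finset.range n, (triangle (v 0) (v k) (v (k + 1))).indicator (1 : ℍ → ℝ) z := by
  classical
  filter_upwards [ae_generic v] with z hg
  have hn := h.three_le
  by_cases hz : z ∈ inner v
  · have hne : ∀ k, 1 ≤ k → k < n → ori (v 0) (v k) z ≠ 0 := fun k h1 h2 =>
      hg 0 k (h.injective (by omega) (by omega))
    have hper : v n = v 0 := by have := h.per 0; rwa [zero_add] at this
    -- `f` is 1 until the vertices pass the ray from `v 0` through `z`, and 0 afterwards; triangle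
    -- `k` contains `z` exactly when `f` drops after `k`. The value at 0 is set by hand because the
    -- volume there vanishes.
    let f : ℕ → ℝ := fun k => if k = 0 then 1 else if 0 < ori (v 0) (v k) z then 1 else 0
    have e : ∀ k ∈ Finset.range n, (triangle (v 0) (v k) (v (k + 1))).indicator (1 : ℍ → ℝ) z =
        f k - f (k + 1) := by
      intro k hk
      rw [show f (k + 1) = if 0 < ori (v 0) (v (k + 1)) z then 1 else 0 from
        if_neg (Nat.succ_ne_zero k)]
      change _ = (if k = 0 then 1 else if 0 < ori (v 0) (v k) z then 1 else 0) - _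
      have hk := Finset.mem_range.1 hk
      have hm : z ∈ triangle (v 0) (v k) (v (k + 1)) ↔
          0 < ori (v 0) (v k) z ∧ ori (v 0) (v (k + 1)) z < 0 := by
        have : ori (v (k + 1)) (v 0) z = -ori (v 0) (v (k + 1)) z := ori_swap_left _ _ _
        simp only [triangle, Set.mem_ofPred_eq, hz k, true_and, this, Left.neg_pos_iff]
      rw [Set.indicator_apply]
      simp only [hm, Pi.one_apply]
      rcases Nat.eq_zero_or_pos k with rfl | hk0
      · have := hz 0
        simp [this]
      rw [if_neg hk0.ne']
      rcases lt_or_gt_of_ne (hne k hk0 hk) with hlt | hlt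
      · rcases Nat.lt_or_ge (k + 1) n with hk1 | hk1
        · have := h.fan_sign_mono hz hk0 hk1 hlt
          rw [if_neg (by rintro ⟨h1, -⟩; linarith), if_neg hlt.not_gt, if_neg this.not_gt]; simp
        · have : k + 1 = n := by omega
          rw [this, hper, if_neg (by rintro ⟨h1, -⟩; linarith), if_neg hlt.not_gt]; simp
      · rcases Nat.lt_or_ge (k + 1) n with hk1 | hk1
        · rcases lt_or_gt_of_ne (hne (k + 1) (by omega) hk1) with h2 | h2
          · rw [if_pos ⟨hlt, h2⟩, if_pos hlt, if_neg h2.not_gt]; simp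
          · rw [if_neg (by rintro ⟨-, h1⟩; linarith), if_pos hlt, if_pos h2]; simp
        · exfalso
          have : k + 1 = n := by omega
          have h2 := hz k
          rw [this, hper, ori_swap_left] at h2
          linarith
    rw [Finset.sum_congr rfl e, Set.indicator_of_mem hz]
    have fn : f n = 0 := by
      change (if n = 0 then 1 else if 0 < ori (v 0) (v n) z then 1 else 0 : ℝ) = 0
      rw [if_neg h.pos.ne', hper, ori_self_left, if_neg (lt_irrefl _)]
    rw [Finset.sum_range_sub', fn, show f 0 = 1 from if_pos rfl, sub_zero, Pi.one_apply]
  · rw [Set.indicator_of_notMem hz]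
    refine (Finset.sum_eq_zero fun k hk => Set.indicator_of_notMem (fun hk' => hz ?_) _).symm
    exact h.triangle_subset hg hk' (Finset.mem_range.1 hk)

/-- The hyperbolic area of a convex polygon. -/
theorem volume_inner (h : CPoly n v) : volume (inner v) = ENNReal.ofReal (area n v) := by
  have hper : v n = v 0 := by have := h.per 0; rwa [zero_add] at this
  have hT : ∀ k ∈ Finset.range n, Integrable
      ((triangle (v 0) (v k) (v (k + 1))).indicator (1 : ℍ → ℝ)) ∧
      ∫ z, (triangle (v 0) (v k) (v (k + 1))).indicator (1 : ℍ → ℝ) z =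
        sarea (v 0) (v k) (v (k + 1)) := fun k hk => integral_triangle
    (h.nonneg 0 k (k + 1) (by omega) (by omega) (by have := Finset.mem_range.1 hk; omega))
  have hi := integrable_finsetSum (Finset.range n) fun k hk => (hT k hk).1
  have hi' : Integrable ((inner v).indicator (1 : ℍ → ℝ)) :=
    hi.congr (h.indicator_inner.mono fun z hz => hz.symm)
  have he : ∫ z, (inner v).indicator (1 : ℍ → ℝ) z = area n v := by
    rw [integral_congr_ae h.indicator_inner, integral_finsetSum _ fun k hk => (hT k hk).1,
      area_eq_sum (v 0) hper]
    exact Finset.sum_congr rfl fun k hk => (hT k hk).2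
  have hm := h.isOpen_inner.measurableSet
  rw [← he, integral_indicator_one hm, Measure.real, ENNReal.ofReal_toReal]
  have := (integrable_indicator_iff hm).1 hi'
  have h2 := (integrableOn_const_iff (C := (1 : ℝ)) (μ := volume) (s := inner v) (by simp)).1 this
  exact (h2.resolve_left (by simp)).ne

end CPoly

lemma volume_reflect (S : Set ℍ) : volume (reflect '' S) = volume S := by
  rw [← measure_smul (μ := (volume : Measure ℍ)) UpperHalfPlane.J S]
  congr 1
  rw [← Set.image_smul]
  refine Set.image_congr fun z _ => ?_
  apply UpperHalfPlane.coe_injective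
  rw [UpperHalfPlane.coe_J_smul]
  rw [Complex.ext_iff]
  simp [reflect]

end HypPlane

namespace HypPlane
open Filter Topology

/-! ### Placing points by their distances to two given points -/

/-- The vector with products `β`, `γ` with `a`, `c` and volume `o` with them. -/
noncomputable def third (a c : ℝ × ℝ × ℝ) (β γ o : ℝ) : ℝ × ℝ × ℝ :=
  (1 / (bil a c ^ 2 - 1)) • ((bil a c * γ - β) • a + (bil a c * β - γ) • c + (-o) • crs a c)

section Third
variable {a c a' c' : ℍ} {β γ o β' γ' o' : ℝ}

lemma sq_sub_one_pos (h : a ≠ c) : 0 < bil (vec a) (vec c) ^ 2 - 1 := by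
  have := one_lt_bil h
  nlinarith

lemma bil_third (h : a ≠ c) : bil (vec a) (third (vec a) (vec c) β γ o) = β := by
  have := (sq_sub_one_pos h).ne'
  simp only [third, bil_add_right, bil_smul_right, bil_vec_self]
  rw [bil_comm (vec a) (crs _ _), bil_crs_left]
  field_simp; ring

lemma bil_third' (h : a ≠ c) : bil (vec c) (third (vec a) (vec c) β γ o) = γ := by
  have := (sq_sub_one_pos h).ne'
  simp only [third, bil_add_right, bil_smul_right, bil_vec_self]
  rw [bil_comm (vec c) (crs _ _), bil_crs_right, bil_comm (vec c) (vec a)]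
  field_simp; ring

lemma tri_third (h : a ≠ c) : tri (vec a) (vec c) (third (vec a) (vec c) β γ o) = o := by
  have := (sq_sub_one_pos h).ne'
  simp only [third, tri_add_right, tri_smul_right, tri_self_outer, tri_self_right]
  rw [← bil_crs, bil_crs_crs, bil_vec_self, bil_vec_self]
  field_simp; ring

lemma bil_third_third (h : a ≠ c) :
    (bil (vec a) (vec c) ^ 2 - 1) *
      bil (third (vec a) (vec c) β γ o) (third (vec a) (vec c) β' γ' o') =
      bil (vec a) (vec c) * (β * γ' + γ * β') - β * β' - γ * γ' - o * o' := by
  have := (sq_sub_one_pos h).ne'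
  conv_lhs => rw [third, bil_smul_left, bil_add_left, bil_add_left, bil_smul_left, bil_smul_left,
    bil_smul_left, bil_third h, bil_third' h, bil_crs, tri_third h]
  field_simp
  ring

lemma third_self (h : a ≠ c) (z : ℝ × ℝ × ℝ) :
    third (vec a) (vec c) (bil (vec a) z) (bil (vec c) z) (tri (vec a) (vec c) z) = z := by
  have h2 := (sq_sub_one_pos h).ne'
  have := frame_expand (vec a) (vec c) z
  rw [bil_vec_self, bil_vec_self, mul_one, one_mul, one_mul] at this
  rw [third, neg_smul, ← sub_eq_add_neg, ← this, smul_smul, one_div_mul_cancel h2, one_smul]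

/-- The condition on `o` is the Gram identity for a unit vector, and a positive `β` selects the
future sheet. -/
lemma vec_pt_third (h : a ≠ c) (hβ : 0 < β) (ho : o ^ 2 = 1 + 2 * bil (vec a) (vec c) * β * γ
      - bil (vec a) (vec c) ^ 2 - β ^ 2 - γ ^ 2) :
    vec (pt (third (vec a) (vec c) β γ o)) = third (vec a) (vec c) β γ o := by
  have h1 : bil (third (vec a) (vec c) β γ o) (third (vec a) (vec c) β γ o) = 1 := by
    have := bil_third_third (β := β) (γ := γ) (o := o) (β' := β) (γ' := γ) (o' := o) h
    have h2 := (sq_sub_one_pos h).ne'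
    apply mul_left_cancel₀ h2
    rw [this]
    linear_combination -ho
  refine vec_pt_unit (fut_of_bil_pos (fut_vec a) (by rw [h1]; exact one_pos) ?_) h1
  rw [bil_third h]; exact hβ

lemma tendsto_third {X : Type*} {l : Filter X} {f g : X → ℝ × ℝ × ℝ} {p q r : X → ℝ}
    (h : a ≠ c) (hf : Tendsto f l (𝓝 (vec a))) (hg : Tendsto g l (𝓝 (vec c)))
    (hp : Tendsto p l (𝓝 β)) (hq : Tendsto q l (𝓝 γ)) (hr : Tendsto r l (𝓝 o)) :
    Tendsto (fun x => third (f x) (g x) (p x) (q x) (r x)) l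
      (𝓝 (third (vec a) (vec c) β γ o)) := by
  have h2 := (sq_sub_one_pos h).ne'
  have hb := tendsto_bil hf hg
  have hc : Tendsto (fun x => crs (f x) (g x)) l (𝓝 (crs (vec a) (vec c))) := by
    have h2 : Continuous fun p : (ℝ × ℝ × ℝ) × (ℝ × ℝ × ℝ) => crs p.1 p.2 := by
      unfold crs; fun_prop
    exact (h2.tendsto (vec a, vec c)).comp (hf.prodMk_nhds hg)
  unfold third
  exact ((tendsto_const_nhds).div ((hb.pow 2).sub_const 1) h2).smul
    (((((hb.mul hq).sub hp).smul hf).add (((hb.mul hp).sub hq).smul hg)).add (hr.neg.smul hc))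

end Third

/-! ### The isometry that moves a pair of points to a congruent pair -/

/-- The isometry that carries `a`, `b` to `a'`, `b'`, when these are at the same distance. -/
noncomputable def move (a b a' b' z : ℍ) : ℍ :=
  pt (third (vec a') (vec b') (bil (vec a) (vec z)) (bil (vec b) (vec z)) (ori a b z))

section Move
variable {a b a' b' : ℍ}

lemma ne_of_bil_eq (h : a ≠ b) (e : bil (vec a') (vec b') = bil (vec a) (vec b)) : a' ≠ b' := by
  rintro rfl
  rw [bil_vec_self] at e
  exact (one_lt_bil h).ne e

lemma vec_move (h : a ≠ b) (e : bil (vec a') (vec b') = bil (vec a) (vec b)) (z : ℍ) :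
    vec (move a b a' b' z) =
      third (vec a') (vec b') (bil (vec a) (vec z)) (bil (vec b) (vec z)) (ori a b z) := by
  refine vec_pt_third (ne_of_bil_eq h e) (by linarith [one_le_bil a z]) ?_
  rw [e, ori_sq]; ring

/-- Products of vectors depend only on their coordinates with respect to a pair and on the product
of that pair. The move copies the coordinates, and the pairs are congruent. -/
lemma bil_move (h : a ≠ b) (e : bil (vec a') (vec b') = bil (vec a) (vec b)) (z w : ℍ) :
    bil (vec (move a b a' b' z)) (vec (move a b a' b' w)) = bil (vec z) (vec w) := by
  have h' := ne_of_bil_eq h e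
  rw [vec_move h e, vec_move h e]
  apply mul_left_cancel₀ (sq_sub_one_pos h').ne'
  rw [bil_third_third h', e, ori, ori, ← bil_third_third h, third_self h, third_self h]

lemma move_left (h : a ≠ b) (e : bil (vec a') (vec b') = bil (vec a) (vec b)) :
    move a b a' b' a = a' := by
  have h' := ne_of_bil_eq h e
  apply vec_injective
  rw [vec_move h e]
  refine Eq.trans ?_ (third_self h' (vec a'))
  simp [bil_comm (vec b') (vec a'), bil_comm (vec b) (vec a), e]

lemma move_right (h : a ≠ b) (e : bil (vec a') (vec b') = bil (vec a) (vec b)) :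
    move a b a' b' b = b' := by
  have h' := ne_of_bil_eq h e
  apply vec_injective
  rw [vec_move h e]
  refine Eq.trans ?_ (third_self h' (vec b'))
  simp [e]

lemma move_move (h : a ≠ b) (e : bil (vec a') (vec b') = bil (vec a) (vec b)) (z : ℍ) :
    move a' b' a b (move a b a' b' z) = z := by
  have h' := ne_of_bil_eq h e
  apply vec_injective
  rw [vec_move h' e.symm, ori, vec_move h e, bil_third h', bil_third' h', tri_third h', ori,
    third_self h]

/-- `move` as an isometry. -/
noncomputable def moveEquiv (h : a ≠ b) (e : bil (vec a') (vec b') = bil (vec a) (vec b)) :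
    ℍ ≃ᵢ ℍ where
  toFun := move a b a' b'
  invFun := move a' b' a b
  left_inv := move_move h e
  right_inv := move_move (ne_of_bil_eq h e) e.symm
  isometry_toFun := Isometry.of_dist_eq fun z w => (dist_eq_dist_iff _ _ _ _).2 (bil_move h e z w)

lemma ori_move (h : a ≠ b) (e : bil (vec a') (vec b') = bil (vec a) (vec b)) (x y z : ℍ) :
    ori (move a b a' b' x) (move a b a' b' y) (move a b a' b' z) = ori x y z := by
  have h' := ne_of_bil_eq h e
  -- Up to powers of the Gram factor of the pair, the volume of three vectors is the determinant of
  -- their coordinates. Since the volume coordinate is copied with its sign, orientation is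
  -- preserved.
  have key : ∀ {u v : ℍ} (_ : u ≠ v) (p q r p' q' r' p'' q'' r'' : ℝ),
      (bil (vec u) (vec v) ^ 2 - 1) ^ 2 * tri (third (vec u) (vec v) p q r)
        (third (vec u) (vec v) p' q' r') (third (vec u) (vec v) p'' q'' r'') =
      -(bil (vec u) (vec v) ^ 2 - 1) * (p * (q' * r'' - r' * q'')
        - q * (p' * r'' - r' * p'') + r * (p' * q'' - q' * p'')) := by
    intro u v huv p q r p' q' r' p'' q'' r''
    have h2 := (sq_sub_one_pos huv).ne'
    have e0 : tri (vec u) (vec v) (crs (vec u) (vec v)) = 1 - bil (vec u) (vec v) ^ 2 := by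
      rw [← bil_crs, bil_crs_crs, bil_vec_self, bil_vec_self, one_mul]
    have e1 : tri (vec u) (crs (vec u) (vec v)) (vec v) = -(1 - bil (vec u) (vec v) ^ 2) := by
      rw [tri_swap, e0]
    have e2 : tri (vec v) (vec u) (crs (vec u) (vec v)) = -(1 - bil (vec u) (vec v) ^ 2) := by
      rw [tri_swap_left, e0]
    have e3 : tri (vec v) (crs (vec u) (vec v)) (vec u) = 1 - bil (vec u) (vec v) ^ 2 := by
      rw [← tri_rot, e0]
    have e4 : tri (crs (vec u) (vec v)) (vec u) (vec v) = 1 - bil (vec u) (vec v) ^ 2 := by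
      rw [tri_rot, e0]
    have e5 : tri (crs (vec u) (vec v)) (vec v) (vec u) = -(1 - bil (vec u) (vec v) ^ 2) := by
      rw [tri_rot, e2]
    simp only [third, tri_add_left, tri_add_mid, tri_add_right, tri_smul_left, tri_smul_mid,
      tri_smul_right, tri_self_left, tri_self_right, tri_self_outer, e0, e1, e2, e3, e4, e5]
    field_simp
    ring
  rw [ori, vec_move h e, vec_move h e, vec_move h e]
  have h2 := pow_ne_zero 2 (sq_sub_one_pos h').ne'
  apply mul_left_cancel₀ h2
  rw [key h', e, ori, ori, ori, ← key h, third_self h, third_self h, third_self h, ori]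

lemma tendsto_move {X : Type*} {l : Filter X} {f g : X → ℍ} (h : a ≠ b)
    (hf : Tendsto f l (𝓝 a)) (hg : Tendsto g l (𝓝 b)) (z : ℍ) :
    Tendsto (fun x => move a b (f x) (g x) z) l (𝓝 z) := by
  have := tendsto_third h ((continuous_vec.tendsto _).comp hf) ((continuous_vec.tendsto _).comp hg)
    (tendsto_const_nhds (x := bil (vec a) (vec z))) (tendsto_const_nhds (x := bil (vec b) (vec z)))
    (tendsto_const_nhds (x := ori a b z))
  rw [ori, third_self h] at this
  have h2 := (continuousAt_pt (fut_vec z)).tendsto.comp this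
  rw [pt_vec] at h2
  exact h2

lemma sarea_move (h : a ≠ b) (e : bil (vec a') (vec b') = bil (vec a) (vec b)) (x y z : ℍ) :
    sarea (move a b a' b' x) (move a b a' b' y) (move a b a' b' z) = sarea x y z := by
  rw [sarea_eq, sarea_eq, csum, csum, ori_move h e, bil_move h e, bil_move h e, bil_move h e]

end Move

/-! ### Changing a diagonal of a quadrilateral -/

/-- The point on the ray from `a` through `c` with product `X` with `a`. -/
noncomputable def along (a c : ℍ) (X : ℝ) : ℍ :=
  pt (X • vec a + √((X ^ 2 - 1) / (bil (vec a) (vec c) ^ 2 - 1)) •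
    (vec c + (-bil (vec a) (vec c)) • vec a))

/-- Geodesic from `a` with `X` as cosh of the distance: the square root scales the tangent component
of `vec c` so that its sinh becomes that of the new distance. -/
lemma vec_along {a c : ℍ} (h : a ≠ c) {X : ℝ} (hX : 1 ≤ X) :
    vec (along a c X) = X • vec a + √((X ^ 2 - 1) / (bil (vec a) (vec c) ^ 2 - 1)) •
      (vec c + (-bil (vec a) (vec c)) • vec a) := by
  have h2 := sq_sub_one_pos h
  have h3 : 0 ≤ X ^ 2 - 1 := by nlinarith
  have hs := Real.sq_sqrt (div_nonneg h3 h2.le)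
  have h1 : bil (X • vec a + √((X ^ 2 - 1) / (bil (vec a) (vec c) ^ 2 - 1)) •
      (vec c + (-bil (vec a) (vec c)) • vec a)) (X • vec a + √((X ^ 2 - 1) /
      (bil (vec a) (vec c) ^ 2 - 1)) • (vec c + (-bil (vec a) (vec c)) • vec a)) = 1 := by
    simp only [bil_add_left, bil_add_right, bil_smul_left, bil_smul_right, bil_vec_self,
      bil_comm (vec c) (vec a)]
    have : √((X ^ 2 - 1) / (bil (vec a) (vec c) ^ 2 - 1)) ^ 2 * (bil (vec a) (vec c) ^ 2 - 1)
      = X ^ 2 - 1 := by rw [hs]; field_simp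
    linear_combination -this
  refine vec_pt_unit (fut_of_bil_pos (fut_vec a) (by rw [h1]; exact one_pos) ?_) h1
  simp only [bil_add_right, bil_smul_right, bil_vec_self]
  linarith

lemma bil_along {a c : ℍ} (h : a ≠ c) {X : ℝ} (hX : 1 ≤ X) :
    bil (vec a) (vec (along a c X)) = X := by
  rw [vec_along h hX]
  simp only [bil_add_right, bil_smul_right, bil_vec_self]
  ring

lemma tendsto_along {a c : ℍ} (h : a ≠ c) :
    Tendsto (along a c) (𝓝 (bil (vec a) (vec c))) (𝓝 c) := by
  have h2 := (sq_sub_one_pos h).ne'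
  have : Tendsto (fun X : ℝ => X • vec a + √((X ^ 2 - 1) / (bil (vec a) (vec c) ^ 2 - 1)) •
      (vec c + (-bil (vec a) (vec c)) • vec a)) (𝓝 (bil (vec a) (vec c))) (𝓝 (vec c)) := by
    have hc : Continuous (fun X : ℝ => X • vec a + √((X ^ 2 - 1) / (bil (vec a) (vec c) ^ 2 - 1)) •
      (vec c + (-bil (vec a) (vec c)) • vec a)) := by fun_prop
    convert hc.tendsto _ using 2
    rw [div_self h2, Real.sqrt_one]
    module
  have h2 := (continuousAt_pt (fut_vec c)).tendsto.comp this
  rw [pt_vec] at h2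
  exact h2

end HypPlane

namespace HypPlane
open Filter Topology

/-! ### Flat vertices -/

/-- Of three collinear points, one lies between the others. -/
lemma exists_middle {a b z : ℍ} (hab : a ≠ b) (h : ori a b z = 0) :
    z ∈ segment a b ∨ a ∈ segment b z ∨ b ∈ segment z a := by
  obtain ⟨s, t, e⟩ := exists_comb_of_ori_eq_zero hab h
  rcases le_total t 0 with ht | ht
  · obtain ⟨s', t', hs', ht', e'⟩ := mem_segment_of_neg e ht
    right; left
    rw [segment_comm]
    exact mem_segment_of_vec hs'.le ht' e'
  rcases le_total s 0 with hs | hs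
  · rw [add_comm] at e
    obtain ⟨s', t', hs', ht', e'⟩ := mem_segment_of_neg e hs
    exact Or.inr (Or.inr (mem_segment_of_vec hs'.le ht' e'))
  · exact Or.inl (mem_segment_of_vec hs ht e)

namespace CPoly
variable {n : ℕ} {v : ℕ → ℍ}

/-- One triple bounds the volume from below. Another triple, containing `v s` and read through its
expansion in `v r` and `v t`, bounds it from above. -/
lemma flat_arc (h : CPoly n v) {r s t : ℕ} (hrs : r < s) (hst : s < t) (htr : t < r + n)
    (hm : v s ∈ segment (v r) (v t)) {m : ℕ} (h1 : r ≤ m) (h2 : m ≤ t) :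
    ori (v r) (v t) (v m) = 0 := by
  have hsr : v s ≠ v r := (h.injective hrs (by omega)).symm
  have hsm : v s ≠ v t := h.injective hst (by omega)
  have h0 := h.nonneg r m t h1 h2 (by omega)
  rw [ori_swap, neg_eq_zero]
  refine le_antisymm ?_ h0
  rcases le_total m s with hms | hms
  · obtain ⟨α, β, hα, hβ, e⟩ := pos_left_of_ne hm hsm
    have h3 := h.nonneg m s t hms hst.le (by omega)
    rw [← ori_rot, ori_comb e, ori_self_outer, mul_zero, add_zero, ← ori_rot, ori_swap_left,
      ori_rot (v t)] at h3
    nlinarith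
  · rw [segment_comm] at hm
    obtain ⟨α, β, hα, hβ, e⟩ := pos_left_of_ne hm hsr
    have h3 := h.nonneg r s m hrs.le hms (by omega)
    rw [ori_rot, ori_rot, ori_comb e, ← ori_rot, ori_swap, ori_self_right, mul_zero, add_zero, ori_rot (v t)] at h3
    nlinarith

/-- A vertex with angle less than `π`. -/
def Strict (v : ℕ → ℍ) (m : ℕ) : Prop := 0 < ori (v m) (v (m + 1)) (v (m + 2))

lemma flat_of_not_strict (h : CPoly n v) {m : ℕ} (hm : ¬ Strict v m) :
    ori (v m) (v (m + 1)) (v (m + 2)) = 0 :=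
  le_antisymm (not_lt.1 hm) (h.nonneg _ _ _ (by omega) (by omega) (by have := h.three_le; omega))

lemma not_strict_arc (h : CPoly n v) {r s t : ℕ} (hrs : r < s) (hst : s < t) (htr : t < r + n)
    (hm : v s ∈ segment (v r) (v t)) {m : ℕ} (h1 : r < m + 1) (h2 : m + 1 < t) : ¬ Strict v m := by
  intro hs
  have hne : v r ≠ v t := h.injective (by omega) htr
  exact hs.ne' (ori_eq_zero_of_line hne (h.flat_arc hrs hst htr hm (by omega) (by omega))
    (h.flat_arc hrs hst htr hm (by omega) (by omega))
    (h.flat_arc hrs hst htr hm (by omega) (by omega)))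

/-- A flat triple of vertices spans an arc without strict vertices. -/
lemma exists_flat_arc (h : CPoly n v) {r s t : ℕ} (hrs : r < s) (hst : s < t) (htr : t < r + n)
    (h0 : ori (v r) (v s) (v t) = 0) :
    (∀ m, r < m + 1 → m + 1 < t → ¬ Strict v m) ∨
    (∀ m, s < m + 1 → m + 1 < r + n → ¬ Strict v m) ∨
    (∀ m, t < m + 1 → m + 1 < s + n → ¬ Strict v m) := by
  have hne : v r ≠ v t := h.injective (by omega) htr
  have h0' : ori (v t) (v r) (v s) = 0 := by rw [ori_rot]; exact h0
  rcases exists_middle hne.symm h0' with hm | hm | hm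
  · rw [segment_comm] at hm
    exact Or.inl fun m => h.not_strict_arc hrs hst htr hm
  · rw [segment_comm, ← h.per r] at hm
    exact Or.inr (Or.inl fun m => h.not_strict_arc hst htr (by omega) hm)
  · rw [segment_comm, ← h.per r, ← h.per s] at hm
    exact Or.inr (Or.inr fun m => h.not_strict_arc htr (by omega) (by omega) hm)

lemma all_pos (h : CPoly n v) (hs : ∀ m, Strict v m) {r s t : ℕ} (hrs : r < s) (hst : s < t)
    (htr : t < r + n) : 0 < ori (v r) (v s) (v t) := by
  refine lt_of_le_of_ne (h.nonneg r s t hrs.le hst.le htr.le) fun h0 => ?_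
  rcases h.exists_flat_arc hrs hst htr h0.symm with hf | hf | hf
  -- `Strict v m` concerns the vertex `m + 1`, so the indices are one less than the vertices `s`,
  -- `t` and `r + n` inside the three arcs.
  · exact hf (s - 1) (by omega) (by omega) (hs _)
  · exact hf (t - 1) (by omega) (by omega) (hs _)
  · exact hf (r + n - 1) (by omega) (by omega) (hs _)

/-- A run of vertices that are not strict is collinear. -/
lemma collinear_run (h : CPoly n v) {i j : ℕ} (hf : ∀ m, i ≤ m → m + 2 ≤ j → ¬ Strict v m) :
    ∀ k, i + k ≤ j → ori (v i) (v (i + 1)) (v (i + k)) = 0 := by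
  intro k
  induction k using Nat.strong_induction_on with
  | _ k ih =>
    intro hk
    match k with
    | 0 => simp
    | 1 => simp
    | k + 2 =>
      have e0 := h.flat_of_not_strict (hf (i + k) (by omega) (by omega))
      have e1 := ih k (by omega) (by omega)
      have e2 := ih (k + 1) (by omega) (by omega)
      have hl : ∀ {z : ℍ}, ori (v (i + k)) (v (i + k + 1)) z = 0 → ori (v i) (v (i + 1)) z = 0 := by
        intro z hz
        have hne := h.edge i
        have hne' := h.edge (i + k)
        have c1 : ori (v (i + k)) (v (i + k + 1)) (v i) = 0 :=
          ori_eq_zero_of_line hne e1 e2 (by simp)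
        have c2 : ori (v (i + k)) (v (i + k + 1)) (v (i + 1)) = 0 :=
          ori_eq_zero_of_line hne e1 e2 (by simp)
        exact ori_eq_zero_of_line hne' c1 c2 hz
      exact hl e0

/-- A cyclic triple is a rotation of an increasing triple below `n`, and rotation preserves the
volume. -/
lemma of_lt (hn : 3 ≤ n) (hper : ∀ k, v (k + n) = v k)
    (hnn : ∀ i j k, i < j → j < k → k < n → 0 ≤ ori (v i) (v j) (v k))
    (he : ∀ i, v i ≠ v (i + 1)) (hc : ∃ i j k, ori (v i) (v j) (v k) ≠ 0) : CPoly n v where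
  three_le := hn
  per := hper
  edge := he
  noncol := hc
  nonneg := by
    have hnn' : ∀ i j k, i ≤ j → j ≤ k → k < n → 0 ≤ ori (v i) (v j) (v k) := by
      intro i j k h1 h2 h3
      rcases h1.eq_or_lt with rfl | h1
      · simp
      rcases h2.eq_or_lt with rfl | h2
      · simp
      exact hnn i j k h1 h2 h3
    have h0 : ∀ i j k, i < n → i ≤ j → j ≤ k → k ≤ i + n → 0 ≤ ori (v i) (v j) (v k) := by
      intro i j k hi h1 h2 h3
      rcases lt_or_ge k n with hk | hk
      · exact hnn' i j k h1 h2 hk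
      obtain ⟨k, rfl⟩ := Nat.exists_eq_add_of_le' hk
      rw [hper k]
      rcases lt_or_ge j n with hj | hj
      · rw [← ori_rot]
        exact hnn' k i j (by omega) h1 hj
      · obtain ⟨j, rfl⟩ := Nat.exists_eq_add_of_le' hj
        rw [hper j, ori_rot]
        exact hnn' j k i (by omega) (by omega) hi
    intro i
    induction i using Nat.strong_induction_on with
    | _ i ih =>
      intro j k h1 h2 h3
      rcases lt_or_ge i n with hi | hi
      · exact h0 i j k hi h1 h2 h3
      · obtain ⟨i, rfl⟩ := Nat.exists_eq_add_of_le' hi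
        obtain ⟨j, rfl⟩ := Nat.exists_eq_add_of_le' (show n ≤ j by omega)
        obtain ⟨k, rfl⟩ := Nat.exists_eq_add_of_le' (show n ≤ k by omega)
        rw [hper, hper, hper]
        exact ih i (by omega) j k (by omega) (by omega) (by omega)

end CPoly

/-! ### Bending a polygon at the vertices of a quadrilateral -/

/-- `w` is obtained from `v` by rigid motions of the arcs between the vertices `0, 1, c, d`. -/
structure Bend (n c d : ℕ) (v w : ℕ → ℍ) : Prop where
  one_lt : 1 < c
  lt : c < d
  lt_n : d < n
  per : ∀ k, w (k + n) = w k
  bil1 : bil (vec (w 0)) (vec (w 1)) = bil (vec (v 0)) (vec (v 1))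
  bil2 : bil (vec (w 1)) (vec (w c)) = bil (vec (v 1)) (vec (v c))
  bil3 : bil (vec (w c)) (vec (w d)) = bil (vec (v c)) (vec (v d))
  bil4 : bil (vec (w d)) (vec (w 0)) = bil (vec (v d)) (vec (v 0))
  move2 : ∀ k, 1 ≤ k → k ≤ c → w k = move (v 1) (v c) (w 1) (w c) (v k)
  move3 : ∀ k, c ≤ k → k ≤ d → w k = move (v c) (v d) (w c) (w d) (v k)
  move4 : ∀ k, d ≤ k → k ≤ n → w k = move (v d) (v 0) (w d) (w 0) (v k)

lemma sum_Ico_omega (v : ℕ → ℍ) (i m : ℕ) :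
    ∑ k ∈ Finset.range m, omega (v (i + k)) (v (i + k + 1)) =
      ∑ k ∈ Finset.range m, sarea (v i) (v (i + k)) (v (i + k + 1)) + omega (v i) (v (i + m)) := by
  have := sum_sarea (v i) (fun k => v (i + k)) m
  simp only [add_zero, omega_self, area] at this
  simp only [← add_assoc] at this
  rw [this]
  ring

lemma sum_Ico_omega' (v : ℕ → ℍ) {i j : ℕ} (hij : i ≤ j) :
    ∑ k ∈ Finset.Ico i j, omega (v k) (v (k + 1)) =
      ∑ k ∈ Finset.Ico i j, sarea (v i) (v k) (v (k + 1)) + omega (v i) (v j) := by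
  rw [Finset.sum_Ico_eq_sum_range, Finset.sum_Ico_eq_sum_range, sum_Ico_omega,
    Nat.add_sub_cancel' hij]

namespace Bend
variable {n c d : ℕ} {v w : ℕ → ℍ}

lemma ne2 (hv : CPoly n v) (h : Bend n c d v w) : v 1 ≠ v c :=
  hv.injective h.one_lt (by have := h.lt; have := h.lt_n; omega)

lemma ne3 (hv : CPoly n v) (h : Bend n c d v w) : v c ≠ v d :=
  hv.injective h.lt (by have := h.lt_n; omega)

lemma ne4 (hv : CPoly n v) (h : Bend n c d v w) : v d ≠ v 0 :=
  (hv.injective (by have := h.one_lt; have := h.lt; omega) (by have := h.lt_n; omega)).symm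

/-- The polygon is the quadrilateral `0, 1, c, d` together with caps cut off by its sides. The caps
move rigidly, so only the two triangles of the quadrilateral contribute. -/
lemma area_sub (hv : CPoly n v) (h : Bend n c d v w) :
    area n w - area n v = (sarea (w 0) (w 1) (w c) + sarea (w 0) (w c) (w d)) -
      (sarea (v 0) (v 1) (v c) + sarea (v 0) (v c) (v d)) := by
  have h1 := h.one_lt
  have h2 := h.lt
  have h3 := h.lt_n
  have split : ∀ u : ℕ → ℍ, u n = u 0 → area n u = sarea (u 0) (u 1) (u c)
      + sarea (u 0) (u c) (u d) + (∑ k ∈ Finset.Ico 1 c, sarea (u 1) (u k) (u (k + 1))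
      + ∑ k ∈ Finset.Ico c d, sarea (u c) (u k) (u (k + 1))
      + ∑ k ∈ Finset.Ico d n, sarea (u d) (u k) (u (k + 1))) := by
    intro u hu
    have e1 := Finset.sum_Ico_consecutive (fun k => omega (u k) (u (k + 1))) (Nat.zero_le 1) h1.le
    have e2 := Finset.sum_Ico_consecutive (fun k => omega (u k) (u (k + 1))) (Nat.zero_le c) h2.le
    have e3 := Finset.sum_Ico_consecutive (fun k => omega (u k) (u (k + 1))) (Nat.zero_le d) h3.le
    have e0 : ∑ k ∈ Finset.Ico 0 1, omega (u k) (u (k + 1)) = omega (u 0) (u 1) := by simp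
    rw [area, Finset.range_eq_Ico, ← e3, ← e2, ← e1, e0, sum_Ico_omega' u h1.le,
      sum_Ico_omega' u h2.le, sum_Ico_omega' u h3.le, hu, sarea, sarea, omega_comm (u 0) (u c)]
    ring
  have pv : v n = v 0 := by have := hv.per 0; rwa [zero_add] at this
  have pw : w n = w 0 := by have := h.per 0; rwa [zero_add] at this
  rw [split v pv, split w pw]
  have c1 : ∀ k ∈ Finset.Ico 1 c, sarea (w 1) (w k) (w (k + 1)) = sarea (v 1) (v k) (v (k + 1)) := by
    intro k hk
    have hk := Finset.mem_Ico.1 hk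
    rw [h.move2 k (by omega) (by omega), h.move2 (k + 1) (by omega) (by omega)]
    conv_lhs => rw [h.move2 1 le_rfl h1.le, move_left (ne2 hv h) h.bil2]
    conv_lhs => arg 1; rw [← move_left (ne2 hv h) h.bil2]
    exact sarea_move (ne2 hv h) h.bil2 _ _ _
  have c2 : ∀ k ∈ Finset.Ico c d, sarea (w c) (w k) (w (k + 1)) = sarea (v c) (v k) (v (k + 1)) := by
    intro k hk
    have hk := Finset.mem_Ico.1 hk
    rw [h.move3 k (by omega) (by omega), h.move3 (k + 1) (by omega) (by omega)]
    conv_lhs => arg 1; rw [← move_left (ne3 hv h) h.bil3]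
    exact sarea_move (ne3 hv h) h.bil3 _ _ _
  have c3 : ∀ k ∈ Finset.Ico d n, sarea (w d) (w k) (w (k + 1)) = sarea (v d) (v k) (v (k + 1)) := by
    intro k hk
    have hk := Finset.mem_Ico.1 hk
    rw [h.move4 k (by omega) (by omega), h.move4 (k + 1) (by omega) (by omega)]
    conv_lhs => arg 1; rw [← move_left (ne4 hv h) h.bil4]
    exact sarea_move (ne4 hv h) h.bil4 _ _ _
  rw [Finset.sum_congr rfl c1, Finset.sum_congr rfl c2, Finset.sum_congr rfl c3]
  ring

lemma bil_edge (hv : CPoly n v) (h : Bend n c d v w) (k : ℕ) :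
    bil (vec (w k)) (vec (w (k + 1))) = bil (vec (v k)) (vec (v (k + 1))) := by
  have h1 := h.one_lt
  have h2 := h.lt
  have h3 := h.lt_n
  induction k using Nat.strong_induction_on with
  | _ k ih =>
    rcases lt_or_ge k n with hk | hk
    · rcases Nat.eq_zero_or_pos k with rfl | hk0
      · exact h.bil1
      rcases lt_or_ge k c with hkc | hkc
      · rw [h.move2 k hk0 hkc.le, h.move2 (k + 1) (by omega) hkc]
        exact bil_move (ne2 hv h) h.bil2 _ _
      rcases lt_or_ge k d with hkd | hkd
      · rw [h.move3 k hkc hkd.le, h.move3 (k + 1) (by omega) hkd]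
        exact bil_move (ne3 hv h) h.bil3 _ _
      · rw [h.move4 k hkd hk.le, h.move4 (k + 1) (by omega) hk]
        exact bil_move (ne4 hv h) h.bil4 _ _
    · obtain ⟨k, rfl⟩ := Nat.exists_eq_add_of_le' hk
      have := ih k (by omega)
      rw [add_right_comm, h.per, h.per, hv.per, hv.per, this]

lemma ori2 (hv : CPoly n v) (h : Bend n c d v w) {r s t : ℕ} (hr : 1 ≤ r ∧ r ≤ c)
    (hs : 1 ≤ s ∧ s ≤ c) (ht : 1 ≤ t ∧ t ≤ c) :
    ori (w r) (w s) (w t) = ori (v r) (v s) (v t) := by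
  rw [h.move2 r hr.1 hr.2, h.move2 s hs.1 hs.2, h.move2 t ht.1 ht.2]
  exact ori_move (ne2 hv h) h.bil2 _ _ _

lemma ori3 (hv : CPoly n v) (h : Bend n c d v w) {r s t : ℕ} (hr : c ≤ r ∧ r ≤ d)
    (hs : c ≤ s ∧ s ≤ d) (ht : c ≤ t ∧ t ≤ d) :
    ori (w r) (w s) (w t) = ori (v r) (v s) (v t) := by
  rw [h.move3 r hr.1 hr.2, h.move3 s hs.1 hs.2, h.move3 t ht.1 ht.2]
  exact ori_move (ne3 hv h) h.bil3 _ _ _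

lemma ori4 (hv : CPoly n v) (h : Bend n c d v w) {r s t : ℕ} (hr : d ≤ r ∧ r ≤ n)
    (hs : d ≤ s ∧ s ≤ n) (ht : d ≤ t ∧ t ≤ n) :
    ori (w r) (w s) (w t) = ori (v r) (v s) (v t) := by
  rw [h.move4 r hr.1 hr.2, h.move4 s hs.1 hs.2, h.move4 t ht.1 ht.2]
  exact ori_move (ne4 hv h) h.bil4 _ _ _

/-- The coefficients of a vertex of a straight arc are kept by the motion. -/
lemma ori_bent (hv : CPoly n v) (h : Bend n c d v w) {s t : ℕ} (hs : 1 ≤ s) (hst : s < t)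
    (ht : t ≤ c) (fs : ori (v 1) (v c) (v s) = 0) (ft : ori (v 1) (v c) (v t) = 0)
    (hp : 0 < ori (v 1) (v c) (v d)) (hw : 0 ≤ ori (w 0) (w 1) (w c)) :
    0 ≤ ori (w 0) (w s) (w t) := by
  have h1 := h.one_lt
  have h2 := h.lt
  have h3 := h.lt_n
  have hne := ne2 hv h
  have hne' := ne_of_bil_eq hne h.bil2
  have comb : ∀ k, 1 ≤ k → k ≤ c → ori (v 1) (v c) (v k) = 0 → ∃ p q : ℝ,
      vec (v k) = p • vec (v 1) + q • vec (v c) ∧ vec (w k) = p • vec (w 1) + q • vec (w c) := by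
    intro k hk hkc h0
    have e := third_self hne (vec (v k))
    have e' : vec (w k) = _ := (congrArg vec (h.move2 k hk hkc)).trans (vec_move hne h.bil2 (v k))
    rw [third, show tri (vec (v 1)) (vec (v c)) (vec (v k)) = 0 from h0, neg_zero, zero_smul,
      add_zero, smul_add, smul_smul, smul_smul] at e
    rw [third, h0, neg_zero, zero_smul, add_zero, smul_add, smul_smul, smul_smul, h.bil2] at e'
    exact ⟨_, _, e.symm, e'⟩
  obtain ⟨p, q, es, es'⟩ := comb s hs (by omega) fs
  obtain ⟨p', q', et, et'⟩ := comb t (by omega) ht ft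
  have key : ∀ u : ℕ → ℍ, ∀ z : ℍ, vec (u s) = p • vec (u 1) + q • vec (u c) →
      vec (u t) = p' • vec (u 1) + q' • vec (u c) →
      ori z (u s) (u t) = (p * q' - q * p') * ori z (u 1) (u c) := by
    intro u z e1 e2
    rw [ori, e1, e2]
    simp only [tri_add_mid, tri_add_right, tri_smul_mid, tri_smul_right, tri_self_right, ori]
    rw [tri_swap (vec z) (vec (u 1)) (vec (u c))]
    ring
  rw [key w (w 0) es' et']
  -- The common coefficient is nonnegative because the same formula holds for `v` seen from `v d`,
  -- which is on the positive side of the straight arc.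
  have hd := hv.nonneg s t d hst.le (by omega) (by omega)
  rw [← ori_rot, key v (v d) es et, ori_rot] at hd
  exact mul_nonneg (nonneg_of_mul_nonneg_left hd hp) hw

/-- Convexity of a bent polygon. -/
lemma cpoly (hv : CPoly n v) (h : Bend n c d v w)
    (hpos : ∀ r s t, r < s → s < t → t < n → 0 < ori (v r) (v s) (v t) → 0 < ori (w r) (w s) (w t))
    (hw : 0 ≤ ori (w 0) (w 1) (w c)) (hp : 0 < ori (v 1) (v c) (v d))
    (hzero : ∀ r s t, r < s → s < t → t < n → ori (v r) (v s) (v t) = 0 →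
      (t ≤ c ∧ ori (v 1) (v c) (v s) = 0 ∧ ori (v 1) (v c) (v t) = 0) ∨
      (c ≤ r ∧ t ≤ d) ∨ d ≤ r ∨ (r = 0 ∧ d ≤ s)) : CPoly n w := by
  have h1 := h.one_lt
  have h2 := h.lt
  have h3 := h.lt_n
  refine CPoly.of_lt hv.three_le h.per ?_ ?_ ⟨1, c, d, (hpos 1 c d h1 h2 h3 hp).ne'⟩
  · intro r s t hrs hst ht
    rcases (hv.nonneg r s t hrs.le hst.le (by omega)).eq_or_lt with h0 | h0
    · rcases hzero r s t hrs hst ht h0.symm with ⟨htc, fs, ft⟩ | ⟨hr, htd⟩ | hr | ⟨rfl, hs⟩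
      · rcases Nat.eq_zero_or_pos r with rfl | hr
        · exact h.ori_bent hv hrs hst htc fs ft hp hw
        · rw [h.ori2 hv ⟨hr, by omega⟩ ⟨by omega, by omega⟩ ⟨by omega, htc⟩, ← h0]
      · rw [h.ori3 hv ⟨hr, by omega⟩ ⟨by omega, by omega⟩ ⟨by omega, htd⟩, ← h0]
      · rw [h.ori4 hv ⟨hr, by omega⟩ ⟨by omega, by omega⟩ ⟨by omega, by omega⟩, ← h0]
      · have pv : v n = v 0 := by have := hv.per 0; rwa [zero_add] at this
        have pw : w n = w 0 := by have := h.per 0; rwa [zero_add] at this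
        rw [← pw, h.ori4 hv ⟨by omega, by omega⟩ ⟨by omega, by omega⟩ ⟨by omega, by omega⟩, pv, ← h0]
    · exact (hpos r s t hrs hst ht h0).le
  · intro i hi
    have := h.bil_edge hv i
    rw [hi, bil_vec_self] at this
    exact (one_lt_bil (hv.edge i)).ne this

end Bend

end HypPlane

namespace HypPlane
open Filter Topology

/-! ### Varying the diagonal of a quadrilateral -/

/-- The square of the volume of three unit vectors with products `β, γ, X`. -/
def gram (β γ X : ℝ) : ℝ := 1 + 2 * X * β * γ - X ^ 2 - β ^ 2 - γ ^ 2

lemma gram_ori (a b c : ℍ) :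
    gram (bil (vec a) (vec b)) (bil (vec b) (vec c)) (bil (vec a) (vec c)) = ori a b c ^ 2 := by
  rw [ori_sq, gram]; ring

lemma gram_ori' (a b c : ℍ) :
    gram (bil (vec a) (vec c)) (bil (vec b) (vec c)) (bil (vec a) (vec b)) = ori a b c ^ 2 := by
  rw [ori_sq, gram]; ring

/-- The area of a triangle with sides `β, γ, X`. -/
noncomputable def sideArea (β γ X : ℝ) : ℝ := 2 * Real.arctan (√(gram β γ X) / (1 + β + γ + X))

/-- The polygon with rigid arcs, for which the diagonal from `0` to `c` has product `X`. -/
noncomputable def deform (n c d : ℕ) (v : ℕ → ℍ) (X : ℝ) (k : ℕ) : ℍ :=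
  let C := along (v 0) (v c) X
  -- Vertex 1 lies on the right of the diagonal from 0 to `c` and vertex `d` on its left, hence the
  -- opposite signs of the two roots.
  let B := pt (third (vec (v 0)) (vec C) (bil (vec (v 0)) (vec (v 1))) (bil (vec (v 1)) (vec (v c)))
    (-√(gram (bil (vec (v 0)) (vec (v 1))) (bil (vec (v 1)) (vec (v c))) X)))
  let D := pt (third (vec (v 0)) (vec C) (bil (vec (v 0)) (vec (v d))) (bil (vec (v c)) (vec (v d)))
    (√(gram (bil (vec (v 0)) (vec (v d))) (bil (vec (v c)) (vec (v d))) X)))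
  if k % n = 0 then v 0 else if k % n ≤ c then move (v 1) (v c) B C (v (k % n))
  else if k % n ≤ d then move (v c) (v d) C D (v (k % n)) else move (v d) (v 0) D (v 0) (v (k % n))

section Deform
variable {n c d : ℕ} {v : ℕ → ℍ} {X : ℝ}

/-- The two Gram conditions say that triangles with the prescribed sides exist on either side of the
diagonal; `1 < X` keeps the diagonal nondegenerate. -/
lemma bend_deform (hv : CPoly n v) (h1 : 1 < c) (h2 : c < d) (h3 : d < n) (hX : 1 < X)
    (g1 : 0 ≤ gram (bil (vec (v 0)) (vec (v 1))) (bil (vec (v 1)) (vec (v c))) X)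
    (g2 : 0 ≤ gram (bil (vec (v 0)) (vec (v d))) (bil (vec (v c)) (vec (v d))) X) :
    Bend n c d v (deform n c d v X) ∧
    ori (deform n c d v X 0) (deform n c d v X 1) (deform n c d v X c) =
      √(gram (bil (vec (v 0)) (vec (v 1))) (bil (vec (v 1)) (vec (v c))) X) ∧
    ori (deform n c d v X 0) (deform n c d v X c) (deform n c d v X d) =
      √(gram (bil (vec (v 0)) (vec (v d))) (bil (vec (v c)) (vec (v d))) X) ∧
    bil (vec (deform n c d v X 0)) (vec (deform n c d v X c)) = X := by
  have ne0c : v 0 ≠ v c := hv.injective (by omega) (by omega)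
  have ne1c : v 1 ≠ v c := hv.injective h1 (by omega)
  have necd : v c ≠ v d := hv.injective h2 (by omega)
  have ned0 : v d ≠ v 0 := (hv.injective (by omega) (by omega)).symm
  have p01 := one_le_bil (v 0) (v 1)
  have p0d := one_le_bil (v 0) (v d)
  set β := bil (vec (v 0)) (vec (v 1)) with hβ
  set γ := bil (vec (v 1)) (vec (v c)) with hγ
  set β' := bil (vec (v 0)) (vec (v d)) with hβ'
  set γ' := bil (vec (v c)) (vec (v d)) with hγ'
  obtain ⟨C, hC⟩ : ∃ C, C = along (v 0) (v c) X := ⟨_, rfl⟩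
  obtain ⟨B, hB⟩ : ∃ B, B = pt (third (vec (v 0)) (vec C) β γ (-√(gram β γ X))) := ⟨_, rfl⟩
  obtain ⟨D, hD⟩ : ∃ D, D = pt (third (vec (v 0)) (vec C) β' γ' (√(gram β' γ' X))) := ⟨_, rfl⟩
  have e0C : bil (vec (v 0)) (vec C) = X := by rw [hC]; exact bil_along ne0c hX.le
  have ne0C : v 0 ≠ C := by
    intro h; rw [← h, bil_vec_self] at e0C; linarith
  have vB : vec B = third (vec (v 0)) (vec C) β γ (-√(gram β γ X)) := by
    rw [hB]
    refine vec_pt_third ne0C (by linarith) ?_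
    rw [neg_sq, Real.sq_sqrt g1, e0C, gram]
  have vD : vec D = third (vec (v 0)) (vec C) β' γ' (√(gram β' γ' X)) := by
    rw [hD]
    refine vec_pt_third ne0C (by linarith) ?_
    rw [Real.sq_sqrt g2, e0C, gram]
  have b0B : bil (vec (v 0)) (vec B) = β := by rw [vB, bil_third ne0C]
  have bBC : bil (vec B) (vec C) = γ := by rw [bil_comm, vB, bil_third' ne0C]
  have b0D : bil (vec D) (vec (v 0)) = bil (vec (v d)) (vec (v 0)) := by
    rw [bil_comm, vD, bil_third ne0C, hβ', bil_comm]
  have bCD : bil (vec C) (vec D) = γ' := by rw [vD, bil_third' ne0C]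
  have w0 : ∀ k, k % n = 0 → deform n c d v X k = v 0 := fun k hk => by
    rw [deform, if_pos hk]
  have hmod : ∀ {k}, k < n → k % n = k := fun h => Nat.mod_eq_of_lt h
  have w2 : ∀ k, 1 ≤ k → k ≤ c → deform n c d v X k = move (v 1) (v c) B C (v k) := by
    intro k hk hkc
    rw [deform, hmod (by omega), if_neg (by omega), if_pos hkc, hB, hC]
  have w1 : deform n c d v X 1 = B := by rw [w2 1 le_rfl h1.le, move_left ne1c bBC]
  have wc : deform n c d v X c = C := by rw [w2 c h1.le le_rfl, move_right ne1c bBC]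
  have w3 : ∀ k, c ≤ k → k ≤ d → deform n c d v X k = move (v c) (v d) C D (v k) := by
    intro k hk hkd
    rcases hk.eq_or_lt with rfl | hk
    · rw [wc, move_left necd bCD]
    rw [deform, hmod (by omega), if_neg (by omega), if_neg (by omega), if_pos hkd, hD, hC]
  have wd : deform n c d v X d = D := by rw [w3 d h2.le le_rfl, move_right necd bCD]
  have pv : v n = v 0 := by have := hv.per 0; rwa [zero_add] at this
  have w4 : ∀ k, d ≤ k → k ≤ n → deform n c d v X k = move (v d) (v 0) D (v 0) (v k) := by
    intro k hk hkn
    rcases hk.eq_or_lt with rfl | hk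
    · rw [wd, move_left ned0 b0D]
    rcases hkn.eq_or_lt with rfl | hkn
    · rw [w0 k (Nat.mod_self _), pv, move_right ned0 b0D]
    rw [deform, hmod hkn, if_neg (by omega), if_neg (by omega), if_neg (by omega), hD, hC]
  have w00 := w0 0 (Nat.zero_mod _)
  refine ⟨⟨h1, h2, h3, ?_, ?_, ?_, ?_, ?_, ?_, ?_, ?_⟩, ?_, ?_, ?_⟩
  · intro k; simp [deform]
  · rw [w00, w1, b0B]
  · rw [w1, wc, bBC]
  · rw [wc, wd, bCD]
  · rw [w00, wd, b0D]
  · rw [w1, wc]; exact w2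
  · rw [wc, wd]; exact w3
  · rw [wd, w00]; exact w4
  · rw [w00, w1, wc, ori_swap, ori, vB, tri_third ne0C, neg_neg]
  · rw [w00, wc, wd, ori, vD, tri_third ne0C]
  · rw [w00, wc, e0C]

lemma continuous_gram (β γ : ℝ) : Continuous (gram β γ) := by unfold gram; fun_prop

lemma tendsto_deform (hv : CPoly n v) (h1 : 1 < c) (h2 : c < d) (h3 : d < n) :
    Tendsto (deform n c d v) (𝓝 (bil (vec (v 0)) (vec (v c)))) (𝓝 v) := by
  have ne0c : v 0 ≠ v c := hv.injective (by omega) (by omega)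
  have ne1c : v 1 ≠ v c := hv.injective h1 (by omega)
  have necd : v c ≠ v d := hv.injective h2 (by omega)
  have ned0 : v d ≠ v 0 := (hv.injective (by omega) (by omega)).symm
  have tC := tendsto_along ne0c
  have tC' := (continuous_vec.tendsto _).comp tC
  have tB : Tendsto (fun X => pt (third (vec (v 0)) (vec (along (v 0) (v c) X))
      (bil (vec (v 0)) (vec (v 1))) (bil (vec (v 1)) (vec (v c)))
      (-√(gram (bil (vec (v 0)) (vec (v 1))) (bil (vec (v 1)) (vec (v c))) X))))
      (𝓝 (bil (vec (v 0)) (vec (v c)))) (𝓝 (v 1)) := by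
    have := tendsto_third ne0c (tendsto_const_nhds (x := vec (v 0))) tC'
      (tendsto_const_nhds (x := bil (vec (v 0)) (vec (v 1))))
      (tendsto_const_nhds (x := bil (vec (v 1)) (vec (v c))))
      (((Real.continuous_sqrt.comp (continuous_gram (bil (vec (v 0)) (vec (v 1)))
        (bil (vec (v 1)) (vec (v c))))).neg).tendsto _)
    rw [Pi.neg_apply, Function.comp_apply, gram_ori, Real.sqrt_sq (hv.nonneg 0 1 c (by omega) h1.le (by omega)),
      ← ori_swap, ori, bil_comm (vec (v 1)), third_self ne0c] at this
    have h2 := (continuousAt_pt (fut_vec _)).tendsto.comp this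
    rw [pt_vec] at h2
    rw [bil_comm (vec (v 1))]
    exact h2
  have tD : Tendsto (fun X => pt (third (vec (v 0)) (vec (along (v 0) (v c) X))
      (bil (vec (v 0)) (vec (v d))) (bil (vec (v c)) (vec (v d)))
      (√(gram (bil (vec (v 0)) (vec (v d))) (bil (vec (v c)) (vec (v d))) X))))
      (𝓝 (bil (vec (v 0)) (vec (v c)))) (𝓝 (v d)) := by
    have := tendsto_third ne0c (tendsto_const_nhds (x := vec (v 0))) tC'
      (tendsto_const_nhds (x := bil (vec (v 0)) (vec (v d))))
      (tendsto_const_nhds (x := bil (vec (v c)) (vec (v d))))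
      (((Real.continuous_sqrt.comp (continuous_gram (bil (vec (v 0)) (vec (v d)))
        (bil (vec (v c)) (vec (v d)))))).tendsto _)
    rw [Function.comp_apply, gram_ori', Real.sqrt_sq (hv.nonneg 0 c d (by omega) h2.le (by omega)),
      ori, third_self ne0c] at this
    have h2 := (continuousAt_pt (fut_vec _)).tendsto.comp this
    rw [pt_vec] at h2
    exact h2
  rw [tendsto_pi_nhds]
  intro k
  have hk : v (k % n) = v k := by
    have hm : ∀ q r, v (r + n * q) = v r := by
      intro q
      induction q with
      | zero => simp
      | succ q ih => intro r; rw [Nat.mul_succ, ← add_assoc, hv.per, ih]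
    conv_rhs => rw [← Nat.mod_add_div k n, hm]
  rw [← hk]
  unfold deform
  by_cases e0 : k % n = 0
  · simp only [e0]; exact tendsto_const_nhds
  by_cases e1 : k % n ≤ c
  · simp only [if_neg e0, if_pos e1]; exact tendsto_move ne1c tB tC _
  by_cases e2 : k % n ≤ d
  · simp only [if_neg e0, if_neg e1, if_pos e2]; exact tendsto_move necd tC tD _
  · simp only [if_neg e0, if_neg e1, if_neg e2]
    exact tendsto_move ned0 tD tendsto_const_nhds _

/-- The polygons near `v` with the same edge lengths and larger area. -/
def Improvable (n : ℕ) (v : ℕ → ℍ) : Prop :=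
  ∃ᶠ w in 𝓝 v, CPoly n w ∧
    (∀ k, bil (vec (w k)) (vec (w (k + 1))) = bil (vec (v k)) (vec (v (k + 1)))) ∧
    area n v < area n w

/-- Reduces improvement to the two triangle areas as functions of the diagonal. The first triangle
may be flat at the start, so its Gram condition is asked of each `X`; for the second it persists by
continuity. -/
lemma improvable_of_frequently (hv : CPoly n v) (h1 : 1 < c) (h2 : c < d) (h3 : d < n)
    (hf : ∃ᶠ X in 𝓝 (bil (vec (v 0)) (vec (v c))),
      0 ≤ gram (bil (vec (v 0)) (vec (v 1))) (bil (vec (v 1)) (vec (v c))) X ∧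
      sideArea (bil (vec (v 0)) (vec (v 1))) (bil (vec (v 1)) (vec (v c)))
        (bil (vec (v 0)) (vec (v c))) +
      sideArea (bil (vec (v 0)) (vec (v d))) (bil (vec (v c)) (vec (v d)))
        (bil (vec (v 0)) (vec (v c))) <
      sideArea (bil (vec (v 0)) (vec (v 1))) (bil (vec (v 1)) (vec (v c))) X +
      sideArea (bil (vec (v 0)) (vec (v d))) (bil (vec (v c)) (vec (v d))) X)
    (hp : 0 < ori (v 1) (v c) (v d)) (hp' : 0 < ori (v 0) (v c) (v d))
    (hzero : ∀ r s t, r < s → s < t → t < n → ori (v r) (v s) (v t) = 0 →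
      (t ≤ c ∧ ori (v 1) (v c) (v s) = 0 ∧ ori (v 1) (v c) (v t) = 0) ∨
      (c ≤ r ∧ t ≤ d) ∨ d ≤ r ∨ (r = 0 ∧ d ≤ s)) : Improvable n v := by
  have tw := tendsto_deform hv h1 h2 h3
  refine tw.frequently ?_
  have ne0c : v 0 ≠ v c := hv.injective (by omega) (by omega)
  have ev1 : ∀ᶠ X in 𝓝 (bil (vec (v 0)) (vec (v c))), 1 < X := lt_mem_nhds (one_lt_bil ne0c)
  have ev2 : ∀ᶠ X in 𝓝 (bil (vec (v 0)) (vec (v c))),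
      0 < gram (bil (vec (v 0)) (vec (v d))) (bil (vec (v c)) (vec (v d))) X := by
    refine (continuous_gram _ _).continuousAt.eventually (lt_mem_nhds ?_)
    rw [gram_ori']; positivity
  have ev3 : ∀ᶠ X in 𝓝 (bil (vec (v 0)) (vec (v c))), ∀ r < n, ∀ s < n, ∀ t < n,
      0 < ori (v r) (v s) (v t) →
      0 < ori (deform n c d v X r) (deform n c d v X s) (deform n c d v X t) := by
    simp only [← Finset.mem_range]
    rw [Filter.eventually_all_finset]; intro r _
    rw [Filter.eventually_all_finset]; intro s _
    rw [Filter.eventually_all_finset]; intro t _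
    rw [Filter.eventually_imp_distrib_left]
    intro h0
    have tk := fun k => (continuous_vec.tendsto _).comp ((tendsto_pi_nhds.1 tw) k)
    exact (tendsto_tri (tk r) (tk s) (tk t)).eventually (lt_mem_nhds h0)
  refine (hf.and_eventually (ev1.and (ev2.and ev3))).mono ?_
  rintro X ⟨⟨g1, hA⟩, hX, g2, h3'⟩
  obtain ⟨hb, o1, o2, e⟩ := bend_deform hv h1 h2 h3 hX g1 g2.le
  refine ⟨hb.cpoly hv (fun r s t hrs hst ht => h3' r (by omega) s (by omega) t ht)
    (by rw [o1]; exact Real.sqrt_nonneg _) hp hzero, hb.bil_edge hv, ?_⟩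
  have ha := hb.area_sub hv
  have s1 : sarea (deform n c d v X 0) (deform n c d v X 1) (deform n c d v X c) =
      sideArea (bil (vec (v 0)) (vec (v 1))) (bil (vec (v 1)) (vec (v c))) X := by
    rw [sarea_eq, o1, csum, hb.bil1, hb.bil2, e, sideArea]
  have s2 : sarea (deform n c d v X 0) (deform n c d v X c) (deform n c d v X d) =
      sideArea (bil (vec (v 0)) (vec (v d))) (bil (vec (v c)) (vec (v d))) X := by
    have h4 := hb.bil4
    rw [bil_comm, bil_comm (vec (v d))] at h4
    rw [sarea_eq, o2, csum, h4, hb.bil3, e, sideArea]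
    congr 3; ring
  have s3 : sarea (v 0) (v 1) (v c) = sideArea (bil (vec (v 0)) (vec (v 1)))
      (bil (vec (v 1)) (vec (v c))) (bil (vec (v 0)) (vec (v c))) := by
    rw [sarea_eq, csum, sideArea, gram_ori,
      Real.sqrt_sq (hv.nonneg 0 1 c (by omega) h1.le (by omega))]
  have s4 : sarea (v 0) (v c) (v d) = sideArea (bil (vec (v 0)) (vec (v d)))
      (bil (vec (v c)) (vec (v d))) (bil (vec (v 0)) (vec (v c))) := by
    rw [sarea_eq, csum, sideArea, gram_ori', Real.sqrt_sq hp'.le]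
    congr 3; ring
  rw [s1, s2, s3, s4] at ha
  linarith

end Deform

/-! ### Derivatives of the area -/

lemma eventually_lt_of_hasDerivAt_pos {f : ℝ → ℝ} {m x : ℝ} (h : HasDerivAt f m x) (hm : 0 < m) :
    ∀ᶠ y in 𝓝[>] x, f x < f y := by
  have h1 := (hasDerivAt_iff_tendsto_slope.1 h).eventually (lt_mem_nhds hm)
  have h2 : 𝓝[>] x ≤ 𝓝[≠] x := nhdsWithin_mono _ fun y hy => ne_of_gt hy
  filter_upwards [h2 h1, self_mem_nhdsWithin] with y hy hxy
  rw [slope_def_field, div_pos_iff_of_pos_right (sub_pos.2 hxy)] at hy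
  linarith

lemma frequently_lt_of_hasDerivAt_ne {f : ℝ → ℝ} {m x : ℝ} (h : HasDerivAt f m x) (hm : m ≠ 0) :
    ∃ᶠ y in 𝓝 x, f x < f y := by
  rcases lt_or_gt_of_ne hm with hm | hm
  · have h1 : HasDerivAt (fun y => f (-y)) (-m) (-x) := by
      have := HasDerivAt.comp (-x) (h₂ := f) (h := fun y => -y) (h₂' := m) (h' := -1)
        (by simpa using h) (hasDerivAt_neg _)
      exact this.congr_deriv (mul_neg_one m)
    have h2 := (eventually_lt_of_hasDerivAt_pos h1 (by linarith)).frequently.filter_mono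
      nhdsWithin_le_nhds
    have h3 : Tendsto (fun y : ℝ => -y) (𝓝 (-x)) (𝓝 x) := by
      have := (continuous_neg (G := ℝ)).tendsto (-x); rwa [neg_neg] at this
    refine h3.frequently ?_
    simpa using h2
  · exact (eventually_lt_of_hasDerivAt_pos h hm).frequently.filter_mono nhdsWithin_le_nhds

/-- Only the numerator changes sign. For two triangles on a common diagonal, the numerators combine
by `fourVol_identity`. -/
lemma hasDerivAt_sideArea {β γ X : ℝ} (hβ : 1 ≤ β) (hγ : 1 ≤ γ) (hX : 1 ≤ X)
    (hg : 0 < gram β γ X) :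
    HasDerivAt (sideArea β γ) ((β + γ - 1 - X) / ((1 + X) * √(gram β γ X))) X := by
  have hG : HasDerivAt (gram β γ) (2 * β * γ - 2 * X) X := by
    have h1 := ((((((hasDerivAt_id X).const_mul 2).mul_const β).mul_const γ).const_add 1).sub
        ((hasDerivAt_id X).pow 2)).sub_const (β ^ 2) |>.sub_const (γ ^ 2)
    refine HasDerivAt.congr_deriv h1 ?_
    simp
  have hS : HasDerivAt (fun X => 1 + β + γ + X) 1 X := (hasDerivAt_id X).const_add _
  have hSp : 0 < 1 + β + γ + X := by linarith
  have hq := ((hG.sqrt hg.ne').div hS hSp.ne').arctan.const_mul 2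
  refine HasDerivAt.congr_deriv hq ?_
  have h0 := Real.sqrt_pos.2 hg
  have h2 := Real.sq_sqrt hg.le
  have e : (1 + β + γ + X) ^ 2 + gram β γ X = 2 * (1 + β) * (1 + γ) * (1 + X) := by
    unfold gram; ring
  set s := √(gram β γ X)
  have e3 : 1 + ((fun X => √(gram β γ X)) / fun X => 1 + β + γ + X) X ^ 2
      = 2 * (1 + β) * (1 + γ) * (1 + X) / (1 + β + γ + X) ^ 2 := by
    rw [Pi.div_apply, div_pow]
    change 1 + s ^ 2 / _ = _
    rw [h2, ← e]; field_simp
  rw [e3]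
  have : 0 < 1 + β := by linarith
  have : 0 < 1 + γ := by linarith
  have : 0 < 1 + X := by linarith
  field_simp
  unfold gram at h2
  rw [h2]
  ring

end HypPlane

/-! ### Polygons that are not coplanar can be improved. -/

namespace HypPlane
open Filter Topology

/-- The vertices lie on a plane section of the hyperboloid that misses the origin. -/
def Coplanar (v : ℕ → ℍ) : Prop := ∃ N, ∀ i, bil N (vec (v i)) = 1

/-- The volume of four points. -/
noncomputable def fourVol (a b c d : ℍ) : ℝ := ori b c d - ori a c d + ori a b d - ori a b c

/-- Pair the expansion of `d` in `a, b, c` with `a + c`. The left side is, up to positive factors,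
the derivative of the area of the quadrilateral in its diagonal, so the area is stationary exactly
at coplanar vertices. -/
lemma fourVol_identity (a b c d : ℍ) :
    (bil (vec a) (vec b) + bil (vec b) (vec c) - 1 - bil (vec a) (vec c)) * ori a c d +
      (bil (vec a) (vec d) + bil (vec c) (vec d) - 1 - bil (vec a) (vec c)) * ori a b c =
      (1 + bil (vec a) (vec c)) * fourVol a b c d := by
  have h := congrArg (bil (vec a + vec c)) (tri_expand (vec a) (vec b) (vec c) (vec d))
  simp only [bil_add_right, bil_smul_right, bil_add_left, bil_vec_self] at h
  have e1 : tri (vec d) (vec b) (vec c) = ori b c d := tri_rot _ _ _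
  have e2 : tri (vec a) (vec d) (vec c) = -ori a c d := tri_swap _ _ _
  have e3 : tri (vec a) (vec b) (vec d) = ori a b d := rfl
  have e4 : tri (vec a) (vec b) (vec c) = ori a b c := rfl
  rw [e1, e2, e3, e4, bil_comm (vec c) (vec a), bil_comm (vec c) (vec b)] at h
  rw [fourVol]
  linear_combination h

lemma fourVol_eq (a b c d : ℍ) : fourVol a b c d =
    bil (crs (vec b) (vec c) + crs (vec c) (vec a) + crs (vec a) (vec b)) (vec d) - ori a b c := by
  simp only [bil_add_left, bil_crs, fourVol]
  rw [tri_swap_left (vec a) (vec c)]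
  simp only [ori]; ring

lemma coplanar_of_fourVol {v : ℕ → ℍ} {a b c : ℍ} (h : ori a b c ≠ 0)
    (hf : ∀ i, fourVol a b c (v i) = 0) : Coplanar v := by
  refine ⟨(ori a b c)⁻¹ • (crs (vec b) (vec c) + crs (vec c) (vec a) + crs (vec a) (vec b)),
    fun i => ?_⟩
  rw [bil_smul_left, sub_eq_zero.1 ((fourVol_eq _ _ _ _).symm.trans (hf i)), inv_mul_cancel₀ h]

section Improve
variable {n : ℕ} {v : ℕ → ℍ}

/-- Take `d` off the plane of the vertices 0, 1, 2. Since every triple is strictly positive, small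
bends in either direction stay convex, so a nonzero derivative of the area suffices. -/
lemma improvable_of_strict (hv : CPoly n v) (hs : ∀ m, CPoly.Strict v m) (hc : ¬ Coplanar v) :
    Improvable n v := by
  have hn := hv.three_le
  have h012 : 0 < ori (v 0) (v 1) (v 2) := hs 0
  obtain ⟨k, hk⟩ : ∃ k, fourVol (v 0) (v 1) (v 2) (v k) ≠ 0 := by
    by_contra hcon
    push Not at hcon
    exact hc (coplanar_of_fourVol h012.ne' hcon)
  obtain ⟨d, -, hdn, ed⟩ := exists_index_of_per hv.pos hv.per 0 k
  rw [← ed] at hk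
  rw [zero_add] at hdn
  have hd : 2 < d := by
    by_contra hle
    apply hk
    rw [fourVol]
    interval_cases d
    · rw [ori_rot (v 0) (v 1) (v 2)]; simp
    · rw [ori_swap (v 0) (v 1) (v 2)]; simp
    · simp
  have h02d : 0 < ori (v 0) (v 2) (v d) := hv.all_pos hs (by omega) hd (by omega)
  have p1 := one_le_bil (v 0) (v 1)
  have p2 := one_le_bil (v 1) (v 2)
  have p3 := one_le_bil (v 0) (v 2)
  have p4 := one_le_bil (v 0) (v d)
  have p5 := one_le_bil (v 2) (v d)
  have g1 : 0 < gram (bil (vec (v 0)) (vec (v 1))) (bil (vec (v 1)) (vec (v 2)))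
      (bil (vec (v 0)) (vec (v 2))) := by rw [gram_ori]; positivity
  have g2 : 0 < gram (bil (vec (v 0)) (vec (v d))) (bil (vec (v 2)) (vec (v d)))
      (bil (vec (v 0)) (vec (v 2))) := by rw [gram_ori']; positivity
  refine improvable_of_frequently hv one_lt_two hd hdn ?_
    (hv.all_pos hs one_lt_two hd (by omega)) h02d ?_
  · have hd1 := hasDerivAt_sideArea p1 p2 p3 g1
    have hd2 := hasDerivAt_sideArea p4 p5 p3 g2
    have hev : ∀ᶠ X in 𝓝 (bil (vec (v 0)) (vec (v 2))),
        0 < gram (bil (vec (v 0)) (vec (v 1))) (bil (vec (v 1)) (vec (v 2))) X :=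
      (continuous_gram _ _).continuousAt.eventually (lt_mem_nhds g1)
    refine ((frequently_lt_of_hasDerivAt_ne (hd1.add hd2) ?_).and_eventually hev).mono
      fun X hX => ⟨hX.2.le, hX.1⟩
    rw [gram_ori, gram_ori', Real.sqrt_sq h012.le, Real.sqrt_sq h02d.le]
    have hid := fourVol_identity (v 0) (v 1) (v 2) (v d)
    have hpos : 0 < 1 + bil (vec (v 0)) (vec (v 2)) := by linarith
    rw [div_add_div _ _ (by positivity) (by positivity)]
    refine div_ne_zero ?_ (by positivity)
    intro h0
    have : (1 + bil (vec (v 0)) (vec (v 2))) * ((1 + bil (vec (v 0)) (vec (v 2))) *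
        fourVol (v 0) (v 1) (v 2) (v d)) = 0 := by rw [← hid, ← h0]; ring
    simp only [mul_eq_zero, hpos.ne', false_or] at this
    exact hk this
  · intro r s t hrs hst ht h0
    exact absurd h0 (hv.all_pos hs hrs hst (by omega)).ne'

/-- A flat triangle is a root of the Gram polynomial. Lowering the diagonal by a square extracts
that square, so the height becomes of exact order `Y` when `β * γ < X`. -/
lemma gram_flat_sub (β γ X Y : ℝ) (h : gram β γ X = 0) :
    gram β γ (X - Y ^ 2) = Y ^ 2 * (2 * (X - β * γ) - Y ^ 2) := by
  unfold gram at *; linear_combination h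

lemma lt_bil_of_mem_segment {a b c : ℍ} (hab : a ≠ b) (hbc : b ≠ c) (h : b ∈ segment a c) :
    bil (vec a) (vec b) * bil (vec b) (vec c) < bil (vec a) (vec c) := by
  rw [← cosh_dist_eq, ← cosh_dist_eq, ← cosh_dist_eq, ← show dist a b + dist b c = dist a c from h,
    Real.cosh_add]
  have h1 := Real.sinh_pos_iff.2 (dist_pos.2 hab)
  have h2 := Real.sinh_pos_iff.2 (dist_pos.2 hbc)
  have := mul_pos h1 h2
  linarith

/-- In the parameter `s` with `Y = X - s ^ 2`, the area of the flat triangle has positive derivative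
at 0, while that of the other one has derivative 0. The hypothesis `β * γ < X` makes the shortened
diagonal admissible. -/
lemma frequently_flat {β γ β' γ' X : ℝ} (hX : 1 ≤ X) (hβ' : 1 ≤ β') (hγ' : 1 ≤ γ')
    (hβ : 1 ≤ β) (hγ : 1 ≤ γ)
    (g1 : gram β γ X = 0) (hlt : β * γ < X) (g2 : 0 < gram β' γ' X) :
    ∃ᶠ Y in 𝓝 X, 0 ≤ gram β γ Y ∧
      sideArea β γ X + sideArea β' γ' X < sideArea β γ Y + sideArea β' γ' Y := by
  have hκ : 0 < 2 * (X - β * γ) := by linarith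
  have htend : Tendsto (fun s : ℝ => X - s ^ 2) (𝓝[>] 0) (𝓝 X) := by
    have : Continuous fun s : ℝ => X - s ^ 2 := by fun_prop
    have := this.tendsto 0
    simp only [ne_eq, OfNat.ofNat_ne_zero, not_false_eq_true, zero_pow, sub_zero] at this
    exact this.mono_left nhdsWithin_le_nhds
  refine htend.frequently (Eventually.frequently ?_)
  have hsq : HasDerivAt (fun s : ℝ => s ^ 2) 0 0 := by
    have := hasDerivAt_pow 2 (0 : ℝ)
    exact this.congr_deriv (by simp)
  have hXs : HasDerivAt (fun s : ℝ => X - s ^ 2) 0 0 := (hsq.const_sub X).congr_deriv neg_zero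
  have e0 : X - (0 : ℝ) ^ 2 = X := by simp
  have hd2 : HasDerivAt (fun s : ℝ => sideArea β' γ' (X - s ^ 2)) 0 0 := by
    have := HasDerivAt.comp (0 : ℝ) (h₂ := sideArea β' γ') (h := fun s : ℝ => X - s ^ 2)
      (by rw [e0]; exact hasDerivAt_sideArea hβ' hγ' hX g2) hXs
    exact this.congr_deriv (mul_zero _)
  have hnum : HasDerivAt (fun s : ℝ => s * √(2 * (X - β * γ) - s ^ 2))
      (√(2 * (X - β * γ))) 0 := by
    have hr : HasDerivAt (fun s : ℝ => √(2 * (X - β * γ) - s ^ 2)) _ 0 :=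
      (hsq.const_sub (2 * (X - β * γ))).sqrt (by simpa using hκ.ne')
    refine ((hasDerivAt_id (0 : ℝ)).mul hr).congr_deriv ?_
    simp
  have hpos : 0 < 1 + β + γ + X := by linarith
  have hd1 := ((hnum.div (hXs.const_add (1 + β + γ)) (by rw [e0]; exact hpos.ne')).arctan.const_mul
    2).add hd2
  have hm := eventually_lt_of_hasDerivAt_pos hd1 (by
    simp only [Pi.div_apply, ne_eq, OfNat.ofNat_ne_zero, not_false_eq_true, zero_pow, sub_zero,
      zero_mul, mul_zero, zero_div, add_zero]
    positivity)
  have hev : ∀ᶠ s : ℝ in 𝓝[>] 0, s ^ 2 < 2 * (X - β * γ) := by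
    refine nhdsWithin_le_nhds ?_
    exact (continuous_pow 2).continuousAt.eventually (gt_mem_nhds (by simpa using hκ))
  filter_upwards [hm, hev, self_mem_nhdsWithin] with s hs h2 h0
  have h0 : 0 < s := h0
  have hg := gram_flat_sub β γ X s g1
  have hk : 0 ≤ 2 * (X - β * γ) - s ^ 2 := by linarith
  refine ⟨by rw [hg]; positivity, ?_⟩
  have z1 : sideArea β γ X = 0 := by simp [sideArea, g1]
  have z2 : sideArea β γ (X - s ^ 2) =
      2 * Real.arctan (s * √(2 * (X - β * γ) - s ^ 2) / (1 + β + γ + (X - s ^ 2))) := by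
    rw [sideArea, hg, Real.sqrt_mul (by positivity), Real.sqrt_sq h0.le]
  rw [z1, z2]
  simpa using hs

/-- Vertices 0, `c` and `d` are strict and those between 0 and `c` are flat; the straight arc is
bent outwards at vertex 1. The strict vertices confine every flat triple to one of the three arcs
they bound. -/
lemma improvable_of_flat_zero (hv : CPoly n v) {c d : ℕ} (h1 : 1 < c) (h2 : c < d) (h3 : d < n)
    (s0 : CPoly.Strict v (n - 1)) (hflat : ∀ m, m + 1 < c → ¬ CPoly.Strict v m)
    (sc : CPoly.Strict v (c - 1)) (sd : CPoly.Strict v (d - 1)) : Improvable n v := by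
  have hn := hv.three_le
  have sn : CPoly.Strict v (2 * n - 1) := by
    have e : ∀ k, v (n - 1 + k + n) = v (n - 1 + k) := fun k => hv.per _
    have := s0
    unfold CPoly.Strict at this ⊢
    rw [show 2 * n - 1 = n - 1 + 0 + n by omega, e,
      show n - 1 + 0 + n + 1 = n - 1 + 1 + n by omega, e,
      show n - 1 + 0 + n + 2 = n - 1 + 2 + n by omega, e]
    exact this
  have key : ∀ {r s t}, r < s → s < t → t < n → ori (v r) (v s) (v t) = 0 →
      t ≤ c ∨ (c ≤ r ∧ t ≤ d) ∨ d ≤ r ∨ (r = 0 ∧ d ≤ s) := by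
    intro r s t hrs hst ht h0
    by_contra hcon
    rcases hv.exists_flat_arc hrs hst (by omega) h0 with hf | hf | hf
    · have e1 : ¬ (r < c ∧ c < t) := fun h => hf (c - 1) (by omega) (by omega) sc
      have e2 : ¬ (r < d ∧ d < t) := fun h => hf (d - 1) (by omega) (by omega) sd
      omega
    · have e1 : ¬ (s < d ∧ d < r + n) := fun h => hf (d - 1) (by omega) (by omega) sd
      have e2 : ¬ (s < n ∧ n < r + n) := fun h => hf (n - 1) (by omega) (by omega) s0
      omega
    · exact hf (n - 1) (by omega) (by omega) s0
  have h1cd : 0 < ori (v 1) (v c) (v d) := by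
    refine lt_of_le_of_ne (hv.nonneg 1 c d h1.le h2.le (by omega)) fun h0 => ?_
    have := key h1 h2 h3 h0.symm
    omega
  have h0cd : 0 < ori (v 0) (v c) (v d) := by
    refine lt_of_le_of_ne (hv.nonneg 0 c d (by omega) h2.le (by omega)) fun h0 => ?_
    have := key (by omega) h2 h3 h0.symm
    omega
  have col : ∀ k, k ≤ c → ori (v 0) (v 1) (v k) = 0 := by
    intro k hk
    have := hv.collinear_run (i := 0) (j := c) (fun m _ hm => hflat m (by omega)) k (by omega)
    rwa [zero_add, zero_add] at this
  have ne01 := hv.edge 0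
  rw [zero_add] at ne01
  have ne1c : v 1 ≠ v c := hv.injective h1 (by omega)
  have h01c := col c le_rfl
  have p1 := one_le_bil (v 0) (v 1)
  have p2 := one_le_bil (v 1) (v c)
  have p3 := one_le_bil (v 0) (v c)
  have p4 := one_le_bil (v 0) (v d)
  have p5 := one_le_bil (v c) (v d)
  -- In the two other orders of the collinear points, a flat arc would contain the strict vertex
  -- `d`.
  have hmid : v 1 ∈ segment (v 0) (v c) := by
    rcases exists_middle ne01 h01c with hm | hm | hm
    · exfalso
      refine hv.not_strict_arc (r := 1) (s := c) (t := 0 + n) h1 (by omega) (by omega)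
        (by rw [hv.per, segment_comm]; exact hm) (m := d - 1) (by omega) (by omega) sd
    · exfalso
      refine hv.not_strict_arc (r := c) (s := 0 + n) (t := 1 + n) (by omega) (by omega) (by omega)
        (by rw [hv.per, hv.per, segment_comm]; exact hm) (m := d - 1) (by omega) (by omega) sd
    · rw [segment_comm]; exact hm
  refine improvable_of_frequently hv h1 h2 h3 (frequently_flat p3 p4 p5 p1 p2 ?_
    (lt_bil_of_mem_segment ne01 ne1c hmid) ?_) h1cd h0cd ?_
  · rw [gram_ori, h01c]; ring
  · rw [gram_ori']; positivity
  · intro r s t hrs hst ht h0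
    rcases key hrs hst ht h0 with h | h
    · exact Or.inl ⟨h, ori_eq_zero_of_line ne01 (by simp) h01c (col s (by omega)),
        ori_eq_zero_of_line ne01 (by simp) h01c (col t h)⟩
    · exact Or.inr h

lemma area_shift (hper : ∀ k, v (k + n) = v k) (i : ℕ) : area n (fun k => v (k + i)) = area n v := by
  induction i with
  | zero => rfl
  | succ i ih =>
    rw [← ih, area, area]
    have h1 := Finset.sum_range_succ (fun k => omega (v (k + i)) (v (k + 1 + i))) n
    have h2 := Finset.sum_range_succ' (fun k => omega (v (k + i)) (v (k + 1 + i))) n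
    rw [h1] at h2
    have e : omega (v (n + i)) (v (n + 1 + i)) = omega (v (0 + i)) (v (0 + 1 + i)) := by
      rw [show n + i = 0 + i + n by omega, show n + 1 + i = 0 + 1 + i + n by omega, hper, hper]
    rw [e] at h2
    have h3 := add_right_cancel h2
    rw [h3]
    refine Finset.sum_congr rfl fun k _ => ?_
    congr 2 <;> ring

lemma per_mul {α : Type*} {v : ℕ → α} (hper : ∀ k, v (k + n) = v k) (q k : ℕ) :
    v (k + q * n) = v k := by
  induction q with
  | zero => simp
  | succ q ih => rw [Nat.succ_mul, ← add_assoc, hper, ih]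

lemma Improvable.of_shift (hv : CPoly n v) (i : ℕ) (h : Improvable n fun k => v (k + i)) :
    Improvable n v := by
  -- Shifting by `i * n - i` undoes a shift by `i` up to whole periods.
  have hi : i ≤ i * n := Nat.le_mul_of_pos_right _ hv.pos
  have hc : Continuous fun w : ℕ → ℍ => fun k => w (k + (i * n - i)) :=
    continuous_pi fun k => continuous_apply _
  have ht := hc.tendsto fun k => v (k + i)
  have e : (fun k => v (k + (i * n - i) + i)) = v := by
    funext k
    rw [show k + (i * n - i) + i = k + i * n by omega, per_mul hv.per]
  rw [e] at ht
  refine ht.frequently (h.mono ?_)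
  rintro w ⟨hw, hb, ha⟩
  refine ⟨hw.shift _, fun k => ?_, ?_⟩
  · have := hb (k + (i * n - i))
    beta_reduce at this ⊢
    rw [show k + (i * n - i) + i = k + i * n by omega,
      show k + (i * n - i) + 1 + i = k + 1 + i * n by omega, per_mul hv.per, per_mul hv.per] at this
    rw [← this, add_right_comm]
  · rw [area_shift hv.per] at ha
    rw [area_shift hw.per]
    exact ha

namespace CPoly

lemma strict_per (hv : CPoly n v) (m : ℕ) : Strict v (m + n) ↔ Strict v m := by
  unfold Strict
  rw [show m + n + 1 = m + 1 + n by omega, show m + n + 2 = m + 2 + n by omega, hv.per, hv.per,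
    hv.per]

/-- Within `n - 1` consecutive vertices there is a strict one. -/
lemma exists_strict (hv : CPoly n v) (i : ℕ) : ∃ m, i ≤ m ∧ m + 2 ≤ i + n ∧ Strict v m := by
  by_contra hc
  push Not at hc
  obtain ⟨w, h1, h2, h3⟩ := hv.exists_pos i
  have := hv.collinear_run (i := i) (j := i + n) hc (w - i) (by omega)
  rw [show i + (w - i) = w by omega] at this
  exact h3.ne' this

/-- Number the vertices so that 0 is strict and followed by a flat run. The run ends at a strict
vertex `c + 1`; a third strict vertex must exist, since two straight runs between the same ends
would be collinear. -/
lemma improvable_of_flat (hv : CPoly n v) {m : ℕ} (hm : ¬ Strict v m) : Improvable n v := by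
  classical
  have hn := hv.three_le
  -- a strict vertex followed by a flat one
  obtain ⟨i, hi, hi'⟩ : ∃ i, Strict v i ∧ ¬ Strict v (i + 1) := by
    by_contra hc
    push Not at hc
    obtain ⟨j, hj, -, hjs⟩ := hv.exists_strict 0
    have hall : ∀ k, Strict v (j + k) := by
      intro k
      induction k with
      | zero => exact hjs
      | succ k ih => exact hc _ ih
    obtain ⟨m', h1, -, e⟩ := exists_index_of_per (α := Prop) hv.pos
      (v := Strict v) (fun k => propext (hv.strict_per k)) j m
    rw [← e] at hm
    exact hm (by have := hall (m' - j); rwa [Nat.add_sub_cancel' h1] at this)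
  refine Improvable.of_shift hv (i + 1) ?_
  have hu := hv.shift (i + 1)
  set u := fun k => v (k + (i + 1)) with hu'
  have hst : ∀ k, Strict u k ↔ Strict v (k + (i + 1)) := by
    intro k
    simp only [Strict, hu']
    rw [add_right_comm k 1, add_right_comm k 2]
  have u0 : ¬ Strict u 0 := by rw [hst, zero_add]; exact hi'
  have un : Strict u (n - 1) := by
    rw [hst, show n - 1 + (i + 1) = i + n by omega, hv.strict_per]; exact hi
  have hex : ∃ m, Strict u m := ⟨_, un⟩
  obtain ⟨m0, h00, h01, h02⟩ := hu.exists_strict 0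
  have hc1 := Nat.find_spec hex
  have hc2 := fun k => Nat.find_min hex (m := k)
  have hc3 : Nat.find hex ≤ m0 := Nat.find_min' hex h02
  set c := Nat.find hex
  have hcpos : 0 < c := by
    rcases Nat.eq_zero_or_pos c with h | h
    · rw [h] at hc1; exact absurd hc1 u0
    · exact h
  -- a third strict vertex
  obtain ⟨d, hd1, hd2, hd3⟩ : ∃ d, c < d ∧ d + 1 < n ∧ Strict u d := by
    by_contra hcon
    push Not at hcon
    have l1 := hu.collinear_run (i := 0) (j := c + 1) (fun m _ hm => hc2 m (by omega))
    have l2 := hu.collinear_run (i := c + 1) (j := n)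
      (fun m h1 h2 => hcon m (by omega) (by omega))
    have hne : u 0 ≠ u (c + 1) := hu.injective (by omega) (by omega)
    have pn : u n = u 0 := by have := hu.per 0; rwa [zero_add] at this
    have m1 : ∀ k, k ≤ c + 1 → ori (u 0) (u (c + 1)) (u k) = 0 := by
      intro k hk
      have e1 := l1 k (by omega)
      have e2 := l1 (c + 1) (by omega)
      have ne := hu.edge 0
      simp only [zero_add] at e1 e2 ne
      exact ori_eq_zero_of_line ne (by simp) e2 e1
    have m2 : ∀ k, c + 1 ≤ k → k ≤ n → ori (u 0) (u (c + 1)) (u k) = 0 := by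
      intro k hk hkn
      have e1 := l2 (k - (c + 1)) (by omega)
      have e2 := l2 (n - (c + 1)) (by omega)
      rw [show c + 1 + (k - (c + 1)) = k by omega] at e1
      rw [show c + 1 + (n - (c + 1)) = n by omega, pn] at e2
      exact ori_eq_zero_of_line (hu.edge (c + 1)) e2 (by simp) e1
    obtain ⟨w, -, hw, h3⟩ := hu.exists_off_line hne 0
    rcases le_total w (c + 1) with h | h
    · exact h3 (m1 w h)
    · exact h3 (m2 w h (by omega))
  refine improvable_of_flat_zero hu (c := c + 1) (d := d + 1) (by omega) (by omega) (by omega) un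
    (fun m hm => hc2 m (by omega)) hc1 hd3

end CPoly

/-- A convex polygon whose vertices are not on a plane section can be improved. -/
theorem CPoly.improvable (hv : CPoly n v) (hc : ¬ Coplanar v) : Improvable n v := by
  by_cases hs : ∀ m, CPoly.Strict v m
  · exact improvable_of_strict hv hs hc
  · push Not at hs
    obtain ⟨m, hm⟩ := hs
    exact hv.improvable_of_flat hm

end Improve

end HypPlane

namespace HypPlane
open Filter Topology

/-! ### Chains of points on a central conic -/

/-- Points `(x k, z k)` on the conic `x² + z² - 2gxz = L²`, from `(0, L)` to `(L, 0)`, with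
consecutive determinants `a k * L`. -/
structure Chain (N : ℕ) (L g : ℝ) (a x z : ℕ → ℝ) : Prop where
  x_zero : x 0 = 0
  z_zero : z 0 = L
  z_last : z N = 0
  x_pos : ∀ k, 1 ≤ k → k ≤ N → 0 < x k
  z_nonneg : ∀ k, k ≤ N → 0 ≤ z k
  conic : ∀ k, k ≤ N → x k ^ 2 + z k ^ 2 - 2 * g * (x k * z k) = L ^ 2
  det : ∀ k, k < N → x (k + 1) * z k - x k * z (k + 1) = a k * L

lemma sub_div_strictMono {e s t : ℝ} (he : 0 ≤ e) (hs : 0 < s) (h : s < t) :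
    s - e / s < t - e / t := by
  have := div_le_div_of_nonneg_left he hs h.le
  linarith

section ChainStep
variable {N : ℕ} {L g g' : ℝ} {a x z x' z' : ℕ → ℝ}

/-- The step of a chain in terms of the slope `m = z / x`. -/
lemma Chain.exists_step (hL : 0 < L) (ha : ∀ k, k < N → 0 < a k) (h : Chain N L g a x z) {k : ℕ}
    (hk : 1 ≤ k) (hkN : k < N) : ∃ t : ℝ, 0 < t ∧
      t - (L ^ 2 / a k ^ 2 - 1) / t = 2 * g ∧ 0 < z k / x k ∧ 0 ≤ z (k + 1) / x (k + 1) ∧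
      (z k / x k) * (t - z (k + 1) / x (k + 1)) -
        (z (k + 1) / x (k + 1)) * ((L ^ 2 / a k ^ 2 - 1) / t) - 1 = 0 := by
  have hx := h.x_pos k hk hkN.le
  have hx1 := h.x_pos (k + 1) (by omega) hkN
  have hz := h.z_nonneg k hkN.le
  have hz1 := h.z_nonneg (k + 1) hkN
  have hc := h.conic k hkN.le
  have hc1 := h.conic (k + 1) hkN
  have hd := h.det k hkN
  have hak := ha k hkN
  obtain ⟨m, hm⟩ : ∃ m, m = z k / x k := ⟨_, rfl⟩
  obtain ⟨μ, hμ⟩ : ∃ μ, μ = z (k + 1) / x (k + 1) := ⟨_, rfl⟩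
  have em : z k = m * x k := by rw [hm]; field_simp
  have eμ : z (k + 1) = μ * x (k + 1) := by rw [hμ]; field_simp
  have hμ0 : 0 ≤ μ := by rw [hμ]; positivity
  rw [← hm, ← hμ]
  rw [em] at hc hd
  rw [eμ] at hc1 hd
  have c0 : x k ^ 2 * (1 + m ^ 2 - 2 * g * m) = L ^ 2 := by rw [← hc]; ring
  have c1 : x (k + 1) ^ 2 * (1 + μ ^ 2 - 2 * g * μ) = L ^ 2 := by rw [← hc1]; ring
  have d0 : x k * x (k + 1) * (m - μ) = a k * L := by rw [← hd]; ring
  have hmμ : 0 < m - μ := by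
    have : 0 < x k * x (k + 1) * (m - μ) := by rw [d0]; positivity
    exact pos_of_mul_pos_right this (by positivity)
  have q1 : 0 < 1 + μ ^ 2 - 2 * g * μ := by
    have : 0 < x (k + 1) ^ 2 * (1 + μ ^ 2 - 2 * g * μ) := by rw [c1]; positivity
    exact pos_of_mul_pos_right this (by positivity)
  have hprod : a k ^ 2 * ((1 + m ^ 2 - 2 * g * m) * (1 + μ ^ 2 - 2 * g * μ)) =
      L ^ 2 * (m - μ) ^ 2 := by
    have hne : (x k ^ 2 * x (k + 1) ^ 2) ≠ 0 := by positivity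
    apply mul_left_cancel₀ hne
    calc x k ^ 2 * x (k + 1) ^ 2 * (a k ^ 2 * ((1 + m ^ 2 - 2 * g * m) * (1 + μ ^ 2 - 2 * g * μ)))
        = a k ^ 2 * (x k ^ 2 * (1 + m ^ 2 - 2 * g * m)) *
          (x (k + 1) ^ 2 * (1 + μ ^ 2 - 2 * g * μ)) := by ring
      _ = L ^ 2 * (a k * L) ^ 2 := by rw [c0, c1]; ring
      _ = _ := by rw [← d0]; ring
  set e := L ^ 2 / a k ^ 2 - 1 with he
  -- The two factors, divided by `m - μ`, have product `e` and differ by `2 * g`. They are `t` and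
  -- `e / t`.
  have hprod' : (m * μ + 1 - 2 * g * μ) * (m * μ + 1 - 2 * g * m) = e * (m - μ) ^ 2 := by
    have e1 : (1 + m ^ 2 - 2 * g * m) * (1 + μ ^ 2 - 2 * g * μ) = L ^ 2 / a k ^ 2 * (m - μ) ^ 2 := by
      field_simp; linarith
    rw [he, sub_mul (L ^ 2 / a k ^ 2), ← e1]; ring
  have ht : 0 < m * μ + 1 - 2 * g * μ := by nlinarith
  have et : e / ((m * μ + 1 - 2 * g * μ) / (m - μ)) = (m * μ + 1 - 2 * g * m) / (m - μ) := by
    rw [div_div_eq_mul_div, div_eq_div_iff ht.ne' hmμ.ne']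
    linear_combination -hprod'
  refine ⟨(m * μ + 1 - 2 * g * μ) / (m - μ), div_pos ht hmμ, ?_, by linarith, hμ0, ?_⟩
  · rw [et]; field_simp; ring
  · rw [et]; field_simp; ring

/-- The first determinant gives `x 1 = a 0`, so the first slope itself plays the part of `t` in the
conic equation. -/
lemma Chain.first (hL : 0 < L) (hN : 1 ≤ N) (h : Chain N L g a x z) (hz : 0 < z 1) :
    0 < z 1 / x 1 ∧ z 1 / x 1 - (L ^ 2 / a 0 ^ 2 - 1) / (z 1 / x 1) = 2 * g := by
  have hx := h.x_pos 1 le_rfl hN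
  have hc := h.conic 1 hN
  have hd := h.det 0 hN
  rw [h.x_zero, h.z_zero, zero_mul, sub_zero, zero_add] at hd
  have ha := mul_right_cancel₀ hL.ne' hd
  refine ⟨by positivity, ?_⟩
  rw [← ha, ← hc]
  field_simp
  ring

/-- The relation is `m (t - μ) = 1 + μ e / t`. With `e ≥ 0`, the left side decreases and the right
side increases in `μ`, so `μ` increases with `m` and with `t`. -/
lemma step_lt {e m m' μ μ' t t' : ℝ} (he : 0 ≤ e) (hm : 0 < m) (hμ : 0 ≤ μ) (hμ' : 0 ≤ μ')
    (ht' : 0 < t') (hm' : 0 < m') (h : m * (t - μ) - μ * (e / t) - 1 = 0)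
    (h' : m' * (t' - μ') - μ' * (e / t') - 1 = 0) (hmm : m' ≤ m) (htt : t' < t) : μ' < μ := by
  by_contra hc
  push Not at hc
  have h0 : 0 ≤ μ' * (e / t') := by positivity
  have h1 : 0 < t' - μ' := by
    have : 0 < m' * (t' - μ') := by linarith
    exact pos_of_mul_pos_right this hm'.le
  have h2 : m' * (t' - μ') ≤ m * (t' - μ') := by gcongr
  have h3 : m * (t' - μ') ≤ m * (t' - μ) := by gcongr
  have h4 : m * (t' - μ) < m * (t - μ) := by gcongr
  have h5 : μ * (e / t') ≤ μ' * (e / t') := by gcongr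
  have h6 : μ * (e / t) ≤ μ * (e / t') := by gcongr
  linarith

lemma step_eq {e m μ μ' t : ℝ} (he : 0 ≤ e) (hm : 0 < m) (ht : 0 < t)
    (h : m * (t - μ) - μ * (e / t) - 1 = 0)
    (h' : m * (t - μ') - μ' * (e / t) - 1 = 0) : μ' = μ := by
  have h1 : (m + e / t) * (μ' - μ) = 0 := by linear_combination h - h'
  have h2 : 0 < m + e / t := by positivity
  have := (mul_eq_zero.1 h1).resolve_left h2.ne'
  linarith

/-- A smaller parameter makes every slope strictly smaller, but both chains end with slope 0. The
bound `a k ≤ L` gives `e ≥ 0`; this is why the base must be a longest edge. -/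
lemma Chain.param_le (hL : 0 < L) (hN : 2 ≤ N) (ha : ∀ k, k < N → 0 < a k ∧ a k ≤ L)
    (h : Chain N L g a x z) (h' : Chain N L g' a x' z') (hz : 0 < z 1) (hz' : 0 < z' 1) :
    g ≤ g' := by
  by_contra hg
  rw [not_le] at hg
  have he : ∀ k, k < N → 0 ≤ L ^ 2 / a k ^ 2 - 1 := by
    intro k hk
    have := (ha k hk).1
    rw [sub_nonneg, one_le_div (by positivity)]
    have := (ha k hk).2
    gcongr
  have mono : ∀ {e t t' : ℝ}, 0 ≤ e → 0 < t → 0 < t' → t - e / t = 2 * g → t' - e / t' = 2 * g' →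
      t' < t := by
    intro e t t' he ht ht' h1 h2
    by_contra hc
    rcases (not_lt.1 hc).eq_or_lt with rfl | hc
    · linarith
    · have := sub_div_strictMono he ht hc; linarith
  have key : ∀ k, k + 1 ≤ N → z' (k + 1) / x' (k + 1) < z (k + 1) / x (k + 1) := by
    intro k
    induction k with
    | zero =>
      intro _
      obtain ⟨p1, q1⟩ := h.first hL (by omega) hz
      obtain ⟨p2, q2⟩ := h'.first hL (by omega) hz'
      exact mono (he 0 (by omega)) p1 p2 q1 q2
    | succ k ih =>
      intro hk
      obtain ⟨t, t1, t2, t3, t4, t5⟩ := h.exists_step hL (fun k hk => (ha k hk).1)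
        (k := k + 1) (by omega) hk
      obtain ⟨t', t1', t2', t3', t4', t5'⟩ := h'.exists_step hL (fun k hk => (ha k hk).1)
        (k := k + 1) (by omega) hk
      have hee := he (k + 1) hk
      exact step_lt hee t3 t4 t4' t1' t3' t5 t5' (ih (by omega)).le
        (mono hee t1 t1' t2 t2')
  have := key (N - 1) (by omega)
  rw [show N - 1 + 1 = N by omega, h.z_last, h'.z_last] at this
  simp at this

/-- A chain is determined by its determinants. -/
lemma Chain.unique (hL : 0 < L) (hN : 2 ≤ N) (ha : ∀ k, k < N → 0 < a k ∧ a k ≤ L)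
    (h : Chain N L g a x z) (h' : Chain N L g' a x' z') (hz : 0 < z 1) (hz' : 0 < z' 1) :
    ∀ k, k ≤ N → x' k = x k ∧ z' k = z k := by
  have hg : g' = g := le_antisymm (h'.param_le hL hN ha h hz' hz)
    (h.param_le hL hN ha h' hz hz')
  subst hg
  have he : ∀ k, k < N → 0 ≤ L ^ 2 / a k ^ 2 - 1 := by
    intro k hk
    have := (ha k hk).1
    rw [sub_nonneg, one_le_div (by positivity)]
    have := (ha k hk).2
    gcongr
  have inj : ∀ {e t t' : ℝ}, 0 ≤ e → 0 < t → 0 < t' → t - e / t = 2 * g' → t' - e / t' = 2 * g' →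
      t' = t := by
    intro e t t' he ht ht' h1 h2
    rcases lt_trichotomy t' t with hc | hc | hc
    · have := sub_div_strictMono he ht' hc; linarith
    · exact hc
    · have := sub_div_strictMono he ht hc; linarith
  have key : ∀ k, k + 1 ≤ N → z' (k + 1) / x' (k + 1) = z (k + 1) / x (k + 1) := by
    intro k
    induction k with
    | zero =>
      intro _
      obtain ⟨p1, q1⟩ := h.first hL (by omega) hz
      obtain ⟨p2, q2⟩ := h'.first hL (by omega) hz'
      exact inj (he 0 (by omega)) p1 p2 q1 q2
    | succ k ih =>
      intro hk
      obtain ⟨t, t1, t2, t3, t4, t5⟩ := h.exists_step hL (fun k hk => (ha k hk).1)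
        (k := k + 1) (by omega) hk
      obtain ⟨t', t1', t2', t3', t4', t5'⟩ := h'.exists_step hL (fun k hk => (ha k hk).1)
        (k := k + 1) (by omega) hk
      have hee := he (k + 1) hk
      rw [ih (by omega), inj hee t1 t1' t2 t2'] at t5'
      exact step_eq hee t3 t1 t5 t5'
  intro k hk
  rcases Nat.eq_zero_or_pos k with rfl | hk0
  · rw [h.x_zero, h.z_zero, h'.x_zero, h'.z_zero]; exact ⟨rfl, rfl⟩
  have hx := h.x_pos k hk0 hk
  have hx' := h'.x_pos k hk0 hk
  have hc := h.conic k hk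
  have hc' := h'.conic k hk
  have hm := key (k - 1) (by omega)
  rw [Nat.sub_add_cancel hk0] at hm
  obtain ⟨m, hm0⟩ : ∃ m, m = z k / x k := ⟨_, rfl⟩
  have e1 : z k = m * x k := by rw [hm0]; field_simp
  have e2 : z' k = m * x' k := by rw [hm0, ← hm]; field_simp
  rw [e1] at hc
  rw [e2] at hc'
  have c0 : x k ^ 2 * (1 + m ^ 2 - 2 * g' * m) = L ^ 2 := by rw [← hc]; ring
  have c1 : x' k ^ 2 * (1 + m ^ 2 - 2 * g' * m) = L ^ 2 := by rw [← hc']; ring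
  have hne : 1 + m ^ 2 - 2 * g' * m ≠ 0 := by
    intro h0; rw [h0, mul_zero] at c0; exact (pow_pos hL 2).ne c0
  have hsq : x' k ^ 2 = x k ^ 2 := mul_right_cancel₀ hne (c1.trans c0.symm)
  have hxx : x' k = x k := by
    rwa [sq_eq_sq₀ hx'.le hx.le] at hsq
  exact ⟨hxx, by rw [e2, e1, hxx]⟩

end ChainStep

/-! ### Half chords of points on a plane section -/

/-- Half the chord of two points: the hyperbolic sine of half their distance. -/
noncomputable def chord (a b : ℍ) : ℝ := √((bil (vec a) (vec b) - 1) / 2)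

lemma chord_comm (a b : ℍ) : chord a b = chord b a := by rw [chord, bil_comm, chord]

lemma chord_nonneg (a b : ℍ) : 0 ≤ chord a b := Real.sqrt_nonneg _

lemma chord_pos {a b : ℍ} (h : a ≠ b) : 0 < chord a b :=
  Real.sqrt_pos.2 (by linarith [one_lt_bil h])

@[simp] lemma chord_self (a : ℍ) : chord a a = 0 := by simp [chord]

lemma bil_eq_chord (a b : ℍ) : bil (vec a) (vec b) = 1 + 2 * chord a b ^ 2 := by
  rw [chord, Real.sq_sqrt (by linarith [one_le_bil a b])]; ring

lemma tri_smul_dual (a b c N : ℝ × ℝ × ℝ) : tri a b c • N =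
    bil N a • crs b c + bil N b • crs c a + bil N c • crs a b := by
  obtain ⟨a1, a2, a3⟩ := a
  obtain ⟨b1, b2, b3⟩ := b
  obtain ⟨c1, c2, c3⟩ := c
  obtain ⟨d1, d2, d3⟩ := N
  simp only [tri, bil, crs, Prod.smul_mk, smul_eq_mul, Prod.mk_add_mk, Prod.mk.injEq]
  refine ⟨?_, ?_, ?_⟩ <;> ring

lemma crs_sub_sub (a b c : ℝ × ℝ × ℝ) :
    crs (b + (-1 : ℝ) • a) (c + (-1 : ℝ) • a) = crs b c + crs c a + crs a b := by
  obtain ⟨a1, a2, a3⟩ := a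
  obtain ⟨b1, b2, b3⟩ := b
  obtain ⟨c1, c2, c3⟩ := c
  simp only [crs, Prod.smul_mk, smul_eq_mul, Prod.mk_add_mk, Prod.mk.injEq]
  refine ⟨?_, ?_, ?_⟩ <;> ring

/-- Three points on a plane section span a volume proportional to the product of the chords. -/
lemma ori_sq_of_plane {N : ℝ × ℝ × ℝ} {a b c : ℍ} (ha : bil N (vec a) = 1) (hb : bil N (vec b) = 1)
    (hc : bil N (vec c) = 1) : (1 - bil N N) * ori a b c ^ 2 =
      (4 * (chord a b * chord b c * chord a c)) ^ 2 := by
  have key := tri_smul_dual (vec a) (vec b) (vec c) N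
  -- The volume times `N` is the cross product of two edge vectors of the triangle. Taking norms and
  -- comparing with the Gram determinant leaves the product of chords.
  rw [ha, hb, hc, one_smul, one_smul, one_smul, ← crs_sub_sub] at key
  have h2 := congrArg (fun w => bil w w) key
  simp only [bil_smul_left, bil_smul_right, bil_crs_crs, bil_add_left, bil_add_right,
    bil_vec_self] at h2
  rw [bil_comm (vec b) (vec a), bil_comm (vec c) (vec a), bil_eq_chord, bil_eq_chord,
    bil_eq_chord] at h2
  have h3 := ori_sq a b c
  rw [bil_eq_chord, bil_eq_chord, bil_eq_chord] at h3
  change ori a b c * (ori a b c * _) = _ at h2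
  linear_combination h3 - h2

/-- The points of a plane section are in general position. -/
lemma ori_ne_zero_of_plane {N : ℝ × ℝ × ℝ} {a b c : ℍ} (ha : bil N (vec a) = 1)
    (hb : bil N (vec b) = 1) (hc : bil N (vec c) = 1) (hab : a ≠ b) (hbc : b ≠ c) (hac : a ≠ c) :
    ori a b c ≠ 0 := by
  intro h0
  have h1 := ori_sq_of_plane ha hb hc
  have := chord_pos hab
  have := chord_pos hbc
  have := chord_pos hac
  rw [h0] at h1
  have h2 : 0 < (4 * (chord a b * chord b c * chord a c)) ^ 2 := by positivity
  rw [← h1] at h2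
  simp at h2

lemma fourVol_eq_zero {N : ℝ × ℝ × ℝ} {a b c d : ℍ} (ha : bil N (vec a) = 1)
    (hb : bil N (vec b) = 1) (hc : bil N (vec c) = 1) (hd : bil N (vec d) = 1) :
    fourVol a b c d = 0 := by
  have key := tri_smul_dual (vec a) (vec b) (vec c) N
  rw [ha, hb, hc, one_smul, one_smul, one_smul] at key
  rw [fourVol_eq, ← key, bil_smul_left, hd, ori]; ring

/-- The volume constant of a plane section. -/
lemma ori_eq_chord {N : ℝ × ℝ × ℝ} {a b c : ℍ} (hp : 0 < 1 - bil N N) (ha : bil N (vec a) = 1)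
    (hb : bil N (vec b) = 1) (hc : bil N (vec c) = 1) (h : 0 ≤ ori a b c) :
    √(1 - bil N N) * ori a b c = 4 * (chord a b * chord b c * chord a c) := by
  have h1 := ori_sq_of_plane ha hb hc
  have h2 := chord_nonneg a b
  have h3 := chord_nonneg b c
  have h4 := chord_nonneg a c
  rw [← sq_eq_sq₀ (by positivity) (by positivity), ← h1, mul_pow, Real.sq_sqrt hp.le]

/-- Pair the expansion of `d` with `d` and with `a`, subtract, and cancel the constants by pairing
with `N`. -/
lemma plane_identity {N : ℝ × ℝ × ℝ} {a b c d : ℍ} (ha : bil N (vec a) = 1)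
    (hb : bil N (vec b) = 1) (hc : bil N (vec c) = 1) (hd : bil N (vec d) = 1) :
    2 * ori a b c * chord a d ^ 2 = ori a c d * (chord b d ^ 2 - chord a b ^ 2 - chord a d ^ 2) -
      ori a b d * (chord c d ^ 2 - chord a c ^ 2 - chord a d ^ 2) := by
  have hx := tri_expand (vec a) (vec b) (vec c) (vec d)
  have h1 := congrArg (bil N) hx
  have h2 := congrArg (bil (vec d)) hx
  have h3 := congrArg (bil (vec a)) hx
  simp only [bil_add_right, bil_smul_right, ha, hb, hc, hd, bil_vec_self] at h1 h2 h3
  rw [bil_comm (vec d) (vec a), bil_comm (vec d) (vec b), bil_comm (vec d) (vec c)] at h2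
  rw [bil_eq_chord, bil_eq_chord, bil_eq_chord] at h2 h3
  have e2 : tri (vec a) (vec d) (vec c) = -ori a c d := tri_swap _ _ _
  have e3 : tri (vec a) (vec b) (vec d) = ori a b d := rfl
  have e4 : tri (vec a) (vec b) (vec c) = ori a b c := rfl
  rw [e2, e3, e4] at h1 h2 h3
  linear_combination (-1 / 2) * (h2 - h3) + chord a d ^ 2 * h1

end HypPlane

/-! ### Rigidity of polygons on a plane section. -/

namespace HypPlane
open Filter Topology

namespace CPoly
variable {n : ℕ} {v w : ℕ → ℍ}

lemma pos_of_plane (hv : CPoly n v) {N : ℝ × ℝ × ℝ} (hN : ∀ i, bil N (vec (v i)) = 1) {i j k : ℕ}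
    (hij : i < j) (hjk : j < k) (hk : k < i + n) : 0 < ori (v i) (v j) (v k) :=
  lt_of_le_of_ne (hv.nonneg i j k hij.le hjk.le hk.le) (ori_ne_zero_of_plane (hN i) (hN j) (hN k)
    (hv.injective hij (by omega)) (hv.injective hjk (by omega))
    (hv.injective (hij.trans hjk) hk)).symm

/-- The constant times a squared volume is the square of a product of chords, which is positive for
three distinct vertices. -/
lemma plane_const (hv : CPoly n v) {N : ℝ × ℝ × ℝ} (hN : ∀ i, bil N (vec (v i)) = 1) :
    0 < 1 - bil N N := by
  have hn := hv.three_le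
  have h := hv.pos_of_plane hN (i := 0) (j := 1) (k := 2) (by omega) (by omega) (by omega)
  have h2 := ori_sq_of_plane (hN 0) (hN 1) (hN 2)
  have c1 := chord_pos (hv.injective (i := 0) (j := 1) (by omega) (by omega))
  have c2 := chord_pos (hv.injective (i := 1) (j := 2) (by omega) (by omega))
  have c3 := chord_pos (hv.injective (i := 0) (j := 2) (by omega) (by omega))
  have h3 : 0 < (1 - bil N N) * ori (v 0) (v 1) (v 2) ^ 2 := by rw [h2]; positivity
  exact pos_of_mul_pos_left h3 (by positivity)

/-- The law of cosines at the vertices of a polygon on a plane section. -/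
lemma exists_conic (hv : CPoly n v) {N : ℝ × ℝ × ℝ} (hN : ∀ i, bil N (vec (v i)) = 1) :
    ∃ g : ℝ, ∀ k, k ≤ n - 1 → chord (v 0) (v k) ^ 2 + chord (v k) (v (n - 1)) ^ 2 -
      2 * g * (chord (v 0) (v k) * chord (v k) (v (n - 1))) = chord (v 0) (v (n - 1)) ^ 2 := by
  have hn := hv.three_le
  have hp := hv.plane_const hN
  have cp : ∀ {i j : ℕ}, i < j → j < n → 0 < chord (v i) (v j) := fun h h' =>
    chord_pos (hv.injective h (by omega))
  have x1 := cp (i := 0) (j := 1) (by omega) (by omega)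
  have z1 := cp (i := 1) (j := n - 1) (by omega) (by omega)
  have hL := cp (i := 0) (j := n - 1) (by omega) (by omega)
  refine ⟨(chord (v 0) (v 1) ^ 2 + chord (v 1) (v (n - 1)) ^ 2 - chord (v 0) (v (n - 1)) ^ 2) /
    (2 * (chord (v 0) (v 1) * chord (v 1) (v (n - 1)))), fun k hk => ?_⟩
  rcases Nat.eq_zero_or_pos k with rfl | hk0
  · simp
  rcases hk.eq_or_lt with rfl | hk
  · simp
  have xk := cp (i := 0) (j := k) (by omega) (by omega)
  have zk := cp (i := k) (j := n - 1) (by omega) (by omega)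
  -- The parameter is read off at vertex 1. Coplanarity with vertex `k` equates the two ratios, once
  -- volumes are replaced by products of chords.
  have hid := fourVol_identity (v 0) (v 1) (v (n - 1)) (v k)
  rw [fourVol_eq_zero (hN 0) (hN 1) (hN _) (hN k), mul_zero, ori_swap (v 0) (v k) (v (n - 1))] at hid
  have o1 := ori_eq_chord hp (hN 0) (hN 1) (hN (n - 1))
    (hv.nonneg 0 1 (n - 1) (by omega) (by omega) (by omega))
  have ok := ori_eq_chord hp (hN 0) (hN k) (hN (n - 1))
    (hv.nonneg 0 k (n - 1) (by omega) (by omega) (by omega))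
  have hs := Real.sqrt_pos.2 hp
  rw [bil_eq_chord, bil_eq_chord, bil_eq_chord, bil_eq_chord, bil_eq_chord,
    chord_comm (v (n - 1)) (v k)] at hid
  set L := chord (v 0) (v (n - 1))
  set a := chord (v 0) (v 1)
  set b := chord (v 1) (v (n - 1))
  set x := chord (v 0) (v k)
  set z := chord (v k) (v (n - 1))
  have h1 : (a ^ 2 + b ^ 2 - L ^ 2) * (x * z) = (x ^ 2 + z ^ 2 - L ^ 2) * (a * b) := by
    have : 8 * L * ((a ^ 2 + b ^ 2 - L ^ 2) * (x * z)) =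
        8 * L * ((x ^ 2 + z ^ 2 - L ^ 2) * (a * b)) := by
      linear_combination (-√(1 - bil N N)) * hid - (2 * (a ^ 2 + b ^ 2 - L ^ 2)) * ok +
        (2 * (x ^ 2 + z ^ 2 - L ^ 2)) * o1
    exact mul_left_cancel₀ (by positivity) this
  field_simp
  linear_combination -h1

/-- Ptolemy's relation. -/
lemma chord_det (hv : CPoly n v) {N : ℝ × ℝ × ℝ} (hN : ∀ i, bil N (vec (v i)) = 1) {j k : ℕ}
    (hjk : j < k) (hk : k < n) :
    chord (v 0) (v k) * chord (v j) (v (n - 1)) - chord (v 0) (v j) * chord (v k) (v (n - 1)) =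
      chord (v j) (v k) * chord (v 0) (v (n - 1)) := by
  have hn := hv.three_le
  rcases Nat.eq_zero_or_pos j with rfl | hj
  · simp
  rcases (show k ≤ n - 1 by omega).eq_or_lt with rfl | hk1
  · simp [mul_comm]
  obtain ⟨g, hg⟩ := hv.exists_conic hN
  have hp := hv.plane_const hN
  have hs := Real.sqrt_pos.2 hp
  have gj := hg j (by omega)
  have gk := hg k (by omega)
  have cp : ∀ {i j : ℕ}, i < j → j < n → 0 < chord (v i) (v j) := fun h h' =>
    chord_pos (hv.injective h (by omega))
  have xk := cp (i := 0) (j := k) (by omega) (by omega)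
  have xj := cp (i := 0) (j := j) (by omega) (by omega)
  have hL := cp (i := 0) (j := n - 1) (by omega) (by omega)
  have hid := plane_identity (hN 0) (hN j) (hN k) (hN (n - 1))
  have o1 := ori_eq_chord hp (hN 0) (hN j) (hN k)
    (hv.nonneg 0 j k (by omega) (by omega) (by omega))
  have o2 := ori_eq_chord hp (hN 0) (hN j) (hN (n - 1))
    (hv.nonneg 0 j (n - 1) (by omega) (by omega) (by omega))
  have o3 := ori_eq_chord hp (hN 0) (hN k) (hN (n - 1))
    (hv.nonneg 0 k (n - 1) (by omega) (by omega) (by omega))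
  set L := chord (v 0) (v (n - 1))
  set x := chord (v 0) (v j)
  set z := chord (v j) (v (n - 1))
  set x' := chord (v 0) (v k)
  set z' := chord (v k) (v (n - 1))
  set s := chord (v j) (v k)
  have : 8 * L * x * x' * (x' * z - x * z') = 8 * L * x * x' * (s * L) := by
    -- Multiplication by the constant of the plane turns every volume into a product of chords; the
    -- conic then linearizes the remaining squares.
    have h1 := congrArg (fun t => √(1 - bil N N) * t) hid
    have h2 : 8 * (x * s * x') * L ^ 2 = 4 * (x' * z' * L) * (z ^ 2 - x ^ 2 - L ^ 2) -
        4 * (x * z * L) * (z' ^ 2 - x' ^ 2 - L ^ 2) := by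
      linear_combination h1 - 2 * L ^ 2 * o1 + (z ^ 2 - x ^ 2 - L ^ 2) * o3 -
        (z' ^ 2 - x' ^ 2 - L ^ 2) * o2
    have e1 : z ^ 2 - x ^ 2 - L ^ 2 = -2 * (x ^ 2 - g * (x * z)) := by rw [← gj]; ring
    have e2 : z' ^ 2 - x' ^ 2 - L ^ 2 = -2 * (x' ^ 2 - g * (x' * z')) := by rw [← gk]; ring
    rw [e1, e2] at h2
    linear_combination -h2
  exact mul_left_cancel₀ (by positivity) this

lemma exists_chain (hv : CPoly n v) {N : ℝ × ℝ × ℝ} (hN : ∀ i, bil N (vec (v i)) = 1) :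
    ∃ g, Chain (n - 1) (chord (v 0) (v (n - 1))) g (fun k => chord (v k) (v (k + 1)))
      (fun k => chord (v 0) (v k)) (fun k => chord (v k) (v (n - 1))) := by
  have hn := hv.three_le
  obtain ⟨g, hg⟩ := hv.exists_conic hN
  exact ⟨g, chord_self _, rfl, chord_self _, fun k h1 h2 => chord_pos (hv.injective h1 (by omega)),
    fun k _ => chord_nonneg _ _, hg, fun k hk => hv.chord_det hN (by omega) (by omega)⟩

/-- With the longest edge as base, `Chain.unique` gives the chords to its two ends; Ptolemy's
relation gives all the others. -/
lemma chord_eq_of_longest (hv : CPoly n v) (hw : CPoly n w) (hpv : Coplanar v) (hpw : Coplanar w)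
    (he : ∀ k, chord (w k) (w (k + 1)) = chord (v k) (v (k + 1)))
    (hl : ∀ k, chord (v k) (v (k + 1)) ≤ chord (v (n - 1)) (v n)) {j k : ℕ} (hjk : j < k)
    (hk : k < n) : chord (w j) (w k) = chord (v j) (v k) := by
  have hn := hv.three_le
  obtain ⟨N, hN⟩ := hpv
  obtain ⟨M, hM⟩ := hpw
  obtain ⟨g, hg⟩ := hv.exists_chain hN
  obtain ⟨g', hg'⟩ := hw.exists_chain hM
  have pv : v n = v 0 := by have := hv.per 0; rwa [zero_add] at this
  have pw : w n = w 0 := by have := hw.per 0; rwa [zero_add] at this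
  have e0 := he (n - 1)
  rw [show n - 1 + 1 = n by omega, pv, pw, chord_comm (w _), chord_comm (v _)] at e0
  rw [pv, chord_comm (v (n - 1))] at hl
  have hL : 0 < chord (v 0) (v (n - 1)) := chord_pos (hv.injective (by omega) (by omega))
  simp only [he, e0] at hg'
  have hu := hg.unique hL (by omega) (fun k hk => ⟨chord_pos (hv.edge k), hl k⟩) hg'
    (chord_pos (hv.injective (by omega) (by omega))) (chord_pos (hw.injective (by omega) (by omega)))
  have d1 := hv.chord_det hN hjk hk
  have d2 := hw.chord_det hM hjk hk
  have uj := hu j (by omega)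
  have uk := hu k (by omega)
  beta_reduce at uj uk
  rw [uj.1, uj.2, uk.1, uk.2, d1, e0] at d2
  exact (mul_right_cancel₀ hL.ne' d2).symm

/-- Polygons on plane sections are determined by their edge lengths. -/
theorem congruent_of_coplanar (hv : CPoly n v) (hw : CPoly n w) (hpv : Coplanar v)
    (hpw : Coplanar w)
    (he : ∀ k, bil (vec (w k)) (vec (w (k + 1))) = bil (vec (v k)) (vec (v (k + 1)))) :
    ∃ g : ℍ ≃ᵢ ℍ, ∀ k, g (v k) = w k := by
  have hn := hv.three_le
  have he' : ∀ k, chord (w k) (w (k + 1)) = chord (v k) (v (k + 1)) := fun k => by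
    rw [chord, he, chord]
  obtain ⟨i, -, hi⟩ := Finset.exists_max_image (Finset.range n) (fun k => chord (v k) (v (k + 1)))
    ⟨0, Finset.mem_range.2 hv.pos⟩
  have hi' : ∀ k, chord (v k) (v (k + 1)) ≤ chord (v i) (v (i + 1)) := by
    intro k
    obtain ⟨k', -, h2, e⟩ := exists_index_of_per (v := fun k => chord (v k) (v (k + 1))) hv.pos
      (fun k => by rw [add_right_comm, hv.per, hv.per]) 0 k
    rw [← e]
    exact hi k' (Finset.mem_range.2 (by omega))
  -- start after the longest edge
  have hv' := hv.shift (i + 1)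
  have hw' := hw.shift (i + 1)
  have hc : ∀ {j k}, j < k → k < n → chord (w (j + (i + 1))) (w (k + (i + 1))) =
      chord (v (j + (i + 1))) (v (k + (i + 1))) := by
    intro j k hjk hk
    refine hv'.chord_eq_of_longest hw' ?_ ?_ (fun k => ?_) (fun k => ?_) hjk hk
    · obtain ⟨N, hN⟩ := hpv; exact ⟨N, fun k => hN _⟩
    · obtain ⟨N, hN⟩ := hpw; exact ⟨N, fun k => hN _⟩
    · have := he' (k + (i + 1)); rwa [add_right_comm] at this
    · have h1 := hi' (k + (i + 1))
      rw [add_right_comm] at h1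
      refine h1.trans ?_
      rw [show n - 1 + (i + 1) = i + n by omega, show n + (i + 1) = i + 1 + n by omega, hv.per,
        hv.per]
  have hb : ∀ {j k}, j < n → k < n → bil (vec (w (j + (i + 1)))) (vec (w (k + (i + 1)))) =
      bil (vec (v (j + (i + 1)))) (vec (v (k + (i + 1)))) := by
    intro j k hj hk
    rcases lt_trichotomy j k with h | rfl | h
    · rw [bil_eq_chord, hc h hk, bil_eq_chord]
    · rw [bil_vec_self, bil_vec_self]
    · rw [bil_comm, bil_eq_chord, hc h hj, bil_comm (vec (v _)), bil_eq_chord]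
  have hne : v (0 + (i + 1)) ≠ v (1 + (i + 1)) := by
    have := hv.edge (i + 1); rwa [zero_add, add_comm 1]
  have hbb := hb (j := 0) (k := 1) (by omega) (by omega)
  refine ⟨moveEquiv hne hbb, fun k => ?_⟩
  obtain ⟨k', h1, h2, e⟩ := exists_index_of_per (v := fun k => (v k, w k)) hv.pos
    (fun k => by rw [hv.per, hw.per]) (i + 1) k
  obtain ⟨j, rfl⟩ := Nat.exists_eq_add_of_le' h1
  rw [Prod.mk.injEq] at e
  rw [← e.1, ← e.2]
  have hj : j < n := by omega
  apply vec_injective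
  change vec (move _ _ _ _ _) = _
  rw [vec_move hne hbb]
  -- The distances determine only the square of the volume; both polygons are positively oriented,
  -- which fixes its sign.
  have ho : ori (v (0 + (i + 1))) (v (1 + (i + 1))) (v (j + (i + 1))) =
      ori (w (0 + (i + 1))) (w (1 + (i + 1))) (w (j + (i + 1))) := by
    have nn : ∀ {u : ℕ → ℍ}, CPoly n u →
        0 ≤ ori (u (0 + (i + 1))) (u (1 + (i + 1))) (u (j + (i + 1))) := by
      intro u hu
      rcases Nat.eq_zero_or_pos j with rfl | hj0
      · simp
      · exact hu.nonneg _ _ _ (by omega) (by omega) (by omega)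
    rw [← sq_eq_sq₀ (nn hv) (nn hw), ori_sq, ori_sq, hb (by omega) (by omega),
      hb (by omega) hj, hb (by omega) hj]
  rw [ho, ← hb (by omega) hj, ← hb (by omega) hj, ori, third_self (ne_of_bil_eq hne hbb)]

end CPoly

end HypPlane

namespace HypPlane
open Filter Topology

/-! ### Circles, horocycles and equidistant curves as plane sections -/

section Line
variable {M : ℝ × ℝ × ℝ}

lemma bil_vec_eq (M : ℝ × ℝ × ℝ) (z : ℍ) :
    bil M (vec z) = (M.1 + M.2.2 * (z.re ^ 2 + z.im ^ 2) - 2 * M.2.1 * z.re) / (2 * z.im) := by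
  have := z.im_ne_zero
  simp only [bil, vec]; field_simp

/-- Geodesics are zero sets of unit spacelike vectors `M`; they are vertical lines when the last
coordinate is 0. Otherwise the normalization gives the half-circle radius `1 / |c|`. -/
lemma isGeodesic_iff {g : Set ℍ} : IsGeodesic g ↔ ∃ M, bil M M = -1 ∧ g = {z | bil M (vec z) = 0} := by
  constructor
  · rintro (⟨a, rfl⟩ | ⟨a, r, hr, rfl⟩)
    · refine ⟨(2 * a, 1, 0), by simp [bil], ?_⟩
      ext z
      have := z.im_ne_zero
      change z.re = a ↔ bil _ _ = 0
      rw [bil_vec_eq, div_eq_zero_iff]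
      constructor
      · rintro h; left; rw [h]; ring
      · rintro (h | h)
        · simp only at h; linarith
        · exact absurd h (by simpa using this)
    · refine ⟨((a ^ 2 - r ^ 2) / r, a / r, 1 / r), by simp only [bil]; field_simp; ring, ?_⟩
      ext z
      have := z.im_ne_zero
      change _ = _ ↔ bil _ _ = 0
      rw [bil_vec_eq, div_eq_zero_iff, or_iff_left (by simpa using this)]
      simp only
      field_simp
      constructor <;> intro h <;> linarith
  · rintro ⟨⟨a, b, c⟩, hM, rfl⟩
    simp only [bil] at hM
    by_cases hc : c = 0
    · left
      subst hc
      have hb : b ≠ 0 := by rintro rfl; norm_num at hM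
      refine ⟨a / (2 * b), ?_⟩
      ext z
      have := z.im_ne_zero
      change bil _ _ = 0 ↔ z.re = _
      rw [bil_vec_eq, div_eq_zero_iff, or_iff_left (by simpa using this), eq_div_iff (by simpa using hb)]
      simp only
      constructor <;> intro h <;> linarith
    · right
      refine ⟨b / c, 1 / |c|, by positivity, ?_⟩
      ext z
      have := z.im_ne_zero
      change bil _ _ = 0 ↔ _ = _
      rw [bil_vec_eq, div_eq_zero_iff, or_iff_left (by simpa using this), div_pow, sq_abs]
      simp only
      have e : ((z.re - b / c) ^ 2 + z.im ^ 2 = 1 ^ 2 / c ^ 2) ↔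
          c * (a + c * (z.re ^ 2 + z.im ^ 2) - 2 * b * z.re) = 0 := by
        field_simp
        constructor <;> intro h
        · linear_combination h + hM
        · linear_combination h - hM
      rw [e, mul_eq_zero, or_iff_right hc]

/-- The foot of the perpendicular from `z` to the geodesic `M = 0`. -/
lemma exists_foot (hM : bil M M = -1) (z : ℍ) : ∃ γ : ℍ, bil M (vec γ) = 0 ∧
    vec z = √(1 + bil M (vec z) ^ 2) • vec γ + (-bil M (vec z)) • M := by
  set s := bil M (vec z) with hs
  have hb : bil (vec z + s • M) (vec z + s • M) = 1 + s ^ 2 := by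
    simp only [bil_add_left, bil_add_right, bil_smul_left, bil_smul_right, bil_vec_self, hM,
      bil_comm (vec z) M, ← hs]
    ring
  have hf : Fut (vec z + s • M) := by
    refine fut_of_bil_pos (fut_vec z) (by rw [hb]; positivity) ?_
    rw [bil_add_right, bil_smul_right, bil_vec_self, bil_comm, ← hs]
    nlinarith [mul_self_nonneg s]
  have hp : 0 < √(1 + s ^ 2) := Real.sqrt_pos.2 (by positivity)
  have e := vec_pt hf
  rw [hb] at e
  refine ⟨pt (vec z + s • M), ?_, ?_⟩
  · rw [e, bil_smul_right, bil_add_right, bil_smul_right, hM, ← hs]; ring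
  · rw [e, smul_smul, mul_one_div_cancel hp.ne', one_smul]; module

lemma exists_vec_push {γ : ℍ} (hM : bil M M = -1) (h0 : bil M (vec γ) = 0) (s : ℝ) :
    Fut (√(1 + s ^ 2) • vec γ + (-s) • M) ∧
    vec (pt (√(1 + s ^ 2) • vec γ + (-s) • M)) = √(1 + s ^ 2) • vec γ + (-s) • M := by
  have hp : 0 < √(1 + s ^ 2) := Real.sqrt_pos.2 (by positivity)
  have hq := Real.sq_sqrt (show 0 ≤ 1 + s ^ 2 by positivity)
  have hb : bil (√(1 + s ^ 2) • vec γ + (-s) • M) (√(1 + s ^ 2) • vec γ + (-s) • M) = 1 := by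
    simp only [bil_add_left, bil_add_right, bil_smul_left, bil_smul_right, bil_vec_self, hM,
      bil_comm (vec γ) M, h0]
    linear_combination hq
  have hf := fut_of_bil_pos (fut_vec γ) (by rw [hb]; exact one_pos)
    (show 0 < bil (vec γ) (√(1 + s ^ 2) • vec γ + (-s) • M) by
      simp only [bil_add_right, bil_smul_right, bil_vec_self, bil_comm (vec γ) M, h0]
      linarith)
  exact ⟨hf, vec_pt_unit hf hb⟩

/-- Hyperbolic Pythagoras: the cosh of the distance from `z` to a point of the line is the cosh of
the height times the cosh of the distance from the foot. -/
lemma infDist_line (hM : bil M M = -1) (z : ℍ) :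
    Metric.infDist z {w | bil M (vec w) = 0} = Real.arsinh |bil M (vec z)| := by
  obtain ⟨γ, hγ, e⟩ := exists_foot hM z
  have hs : 0 ≤ Real.arsinh |bil M (vec z)| := Real.arsinh_nonneg_iff.2 (abs_nonneg _)
  have hcosh : Real.cosh (Real.arsinh |bil M (vec z)|) = √(1 + bil M (vec z) ^ 2) := by
    rw [Real.cosh_arsinh, sq_abs]
  have hd : ∀ w : ℍ, bil M (vec w) = 0 →
      Real.cosh (dist z w) = √(1 + bil M (vec z) ^ 2) * bil (vec γ) (vec w) := by
    intro w hw
    rw [cosh_dist_eq]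
    conv_lhs => rw [e]
    rw [bil_add_left, bil_smul_left, bil_smul_left, hw]; ring
  apply le_antisymm
  · refine (Metric.infDist_le_dist_of_mem (show γ ∈ {w | bil M (vec w) = 0} from hγ)).trans ?_
    have h1 := hd γ hγ
    rw [bil_vec_self, mul_one, ← hcosh] at h1
    have := Real.cosh_le_cosh.1 h1.le
    rwa [abs_of_nonneg dist_nonneg, abs_of_nonneg hs] at this
  · refine (Metric.le_infDist ⟨γ, hγ⟩).2 fun w hw => ?_
    have h1 : Real.cosh (Real.arsinh |bil M (vec z)|) ≤ Real.cosh (dist z w) := by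
      rw [hcosh, hd w hw]
      exact le_mul_of_one_le_right (Real.sqrt_nonneg _) (one_le_bil γ w)
    have := Real.cosh_le_cosh.1 h1
    rwa [abs_of_nonneg dist_nonneg, abs_of_nonneg hs] at this

lemma isPreconnected_line (M : ℝ × ℝ × ℝ) : IsPreconnected {w : ℍ | bil M (vec w) = 0} := by
  refine isPreconnected_of_forall_pair fun x hx y hy => ⟨segment x y, ?_, left_mem_segment _ _,
    right_mem_segment _ _, isPreconnected_segment x y⟩
  intro z hz
  obtain ⟨s, t, -, -, e⟩ := mem_segment_iff.1 hz
  have hx : bil M (vec x) = 0 := hx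
  have hy : bil M (vec y) = 0 := hy
  change bil M (vec z) = 0
  rw [e, bil_add_right, bil_smul_right, bil_smul_right, hx, hy]; ring

/-- The level set is the image of the geodesic under a push of signed height `s` along its normals.
It therefore lies in one component of the set at fixed distance. -/
lemma isPreconnected_equidistant (hM : bil M M = -1) (s : ℝ) :
    IsPreconnected {w : ℍ | bil M (vec w) = s} := by
  have : {w : ℍ | bil M (vec w) = s} =
      (fun γ => pt (√(1 + s ^ 2) • vec γ + (-s) • M)) '' {w : ℍ | bil M (vec w) = 0} := by
    ext z
    constructor
    · intro hz
      have hz : bil M (vec z) = s := hz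
      obtain ⟨γ, hγ, e⟩ := exists_foot hM z
      refine ⟨γ, hγ, ?_⟩
      beta_reduce
      rw [← hz, ← e, pt_vec]
    · rintro ⟨γ, hγ, rfl⟩
      have hγ : bil M (vec γ) = 0 := hγ
      change bil M (vec _) = s
      rw [(exists_vec_push hM hγ s).2, bil_add_right, bil_smul_right, bil_smul_right, hγ, hM]
      ring
  rw [this]
  refine (isPreconnected_line M).image _ fun γ hγ => ContinuousAt.continuousWithinAt ?_
  have hc : Continuous fun γ : ℍ => √(1 + s ^ 2) • vec γ + (-s) • M :=
    (continuous_vec.const_smul (√(1 + s ^ 2))).add (continuous_const (y := (-s) • M))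
  exact ContinuousAt.comp (g := pt) (f := fun γ : ℍ => √(1 + s ^ 2) • vec γ + (-s) • M)
    (continuousAt_pt (exists_vec_push hM hγ s).1) hc.continuousAt

end Line

/-- Circles have timelike `N`, horocycles null `N`, equidistant branches spacelike `N`. In the last
case the pairing with `M` has constant nonzero absolute value on the branch, so it cannot change
sign on a connected set. -/
lemma exists_plane_of_inscribed {C : Set ℍ}
    (hC : IsCircle C ∨ IsHorocycle C ∨ IsEquidistantBranch C) :
    ∃ N, ∀ z ∈ C, bil N (vec z) = 1 := by
  rcases hC with ⟨c, r, hr, rfl⟩ | (⟨c, hc, rfl⟩ | ⟨a, k, hk, rfl⟩) | ⟨g, d, hg, hd, x, hx, rfl⟩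
  · refine ⟨(Real.cosh r)⁻¹ • vec c, fun z hz => ?_⟩
    rw [Metric.mem_sphere] at hz
    rw [bil_smul_left, bil_comm, ← cosh_dist_eq, hz, inv_mul_cancel₀ (Real.cosh_pos r).ne']
  · refine ⟨(2 * c, 0, 0), fun z hz => ?_⟩
    have hz : z.im = c := hz
    have := z.im_ne_zero
    rw [bil_vec_eq, ← hz]; simp only; field_simp; ring
  · refine ⟨(2 * a ^ 2 / k, 2 * a / k, 2 / k), fun z hz => ?_⟩
    have hz : (z.re - a) ^ 2 + z.im ^ 2 = k * z.im := hz
    have := z.im_ne_zero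
    rw [bil_vec_eq, div_eq_one_iff_eq (by simpa using this)]
    simp only; field_simp
    linear_combination hz
  · obtain ⟨M, hM, rfl⟩ := isGeodesic_iff.1 hg
    have hS : ∀ z ∈ connectedComponentIn {z : ℍ | Metric.infDist z {z | bil M (vec z) = 0} = d} x,
        |bil M (vec z)| = Real.sinh d := by
      intro z hz
      have h1 : z ∈ {z : ℍ | Metric.infDist z {z | bil M (vec z) = 0} = d} :=
        connectedComponentIn_subset _ _ hz
      change Metric.infDist z {z | bil M (vec z) = 0} = d at h1
      rw [infDist_line hM] at h1
      rw [← h1, Real.sinh_arsinh]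
    have hsd := Real.sinh_pos_iff.2 hd
    have hx' := mem_connectedComponentIn hx
    have hcst : ∀ z ∈ connectedComponentIn
        {z : ℍ | Metric.infDist z {z | bil M (vec z) = 0} = d} x,
        bil M (vec z) = bil M (vec x) := by
      intro z hz
      have h1 := hS z hz
      have h2 := hS x hx'
      by_contra hne
      have hpre := isPreconnected_connectedComponentIn (x := x)
        (F := {z : ℍ | Metric.infDist z {z | bil M (vec z) = 0} = d})
      have hcont : Continuous fun z : ℍ => bil M (vec z) :=
        Continuous.bil continuous_const continuous_vec
      have hz0 : ∀ w ∈ connectedComponentIn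
          {z : ℍ | Metric.infDist z {z | bil M (vec z) = 0} = d} x, bil M (vec w) ≠ 0 := by
        intro w hw h0
        have := hS w hw
        rw [h0, abs_zero] at this
        exact hsd.ne this
      rcases abs_choice (bil M (vec z)) with a1 | a1 <;>
        rcases abs_choice (bil M (vec x)) with a2 | a2
      · apply hne; linarith
      · obtain ⟨w, hw, h0⟩ := hpre.intermediate_value hx' hz hcont.continuousOn
          (show (0 : ℝ) ∈ Set.Icc _ _ from ⟨by linarith, by linarith⟩)
        exact hz0 w hw h0
      · obtain ⟨w, hw, h0⟩ := hpre.intermediate_value hz hx' hcont.continuousOn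
          (show (0 : ℝ) ∈ Set.Icc _ _ from ⟨by linarith, by linarith⟩)
        exact hz0 w hw h0
      · apply hne; linarith
    have hx0 : bil M (vec x) ≠ 0 := by
      intro h0
      have := hS x hx'
      rw [h0, abs_zero] at this
      exact hsd.ne this
    refine ⟨(bil M (vec x))⁻¹ • M, fun z hz => ?_⟩
    rw [bil_smul_left, hcst z hz, inv_mul_cancel₀ hx0]

lemma IsInscribed.coplanar {n : ℕ} [NeZero n] {p : Fin n → ℍ} (h : IsInscribed p) :
    Coplanar (ext p) := by
  obtain ⟨C, hC, hp⟩ := h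
  obtain ⟨N, hN⟩ := exists_plane_of_inscribed hC
  exact ⟨N, fun k => hN _ (hp _)⟩

/-- The sign of `bil N N` decides among equidistant branch, horocycle and circle; `bil N N < 1`
makes the radius of the circle positive. -/
lemma CPoly.isInscribed {n : ℕ} [NeZero n] {p : Fin n → ℍ} (h : CPoly n (ext p))
    (hc : Coplanar (ext p)) : IsInscribed p := by
  obtain ⟨N, hN⟩ := hc
  have hp := h.plane_const hN
  have hN' : ∀ i, bil N (vec (p i)) = 1 := fun i => by have := hN i; rwa [ext_val] at this
  rcases lt_trichotomy (bil N N) 0 with h0 | h0 | h0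
  · have hs : 0 < √(-bil N N) := Real.sqrt_pos.2 (by linarith)
    have hq := Real.sq_sqrt (show 0 ≤ -bil N N by linarith)
    have hM : bil ((√(-bil N N))⁻¹ • N) ((√(-bil N N))⁻¹ • N) = -1 := by
      rw [bil_smul_left, bil_smul_right]
      field_simp
      linear_combination hq
    have hv : ∀ i, bil ((√(-bil N N))⁻¹ • N) (vec (p i)) = (√(-bil N N))⁻¹ := fun i => by
      rw [bil_smul_left, hN' i, mul_one]
    have hpos : 0 < (√(-bil N N))⁻¹ := inv_pos.2 hs
    set M := (√(-bil N N))⁻¹ • N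
    set s := (√(-bil N N))⁻¹
    have hsub : {w : ℍ | bil M (vec w) = s} ⊆
        {z : ℍ | Metric.infDist z {z | bil M (vec z) = 0} = Real.arsinh s} := by
      intro z hz
      have hz : bil M (vec z) = s := hz
      change Metric.infDist _ _ = _
      rw [infDist_line hM, hz, abs_of_pos hpos]
    refine ⟨connectedComponentIn {z : ℍ | Metric.infDist z {z | bil M (vec z) = 0} = Real.arsinh s}
      (p 0), Or.inr (Or.inr ⟨_, _, isGeodesic_iff.2 ⟨M, hM, rfl⟩, Real.arsinh_pos_iff.2 hpos, p 0,
        hsub (hv 0), rfl⟩), fun i => ?_⟩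
    exact (isPreconnected_equidistant hM s).subset_connectedComponentIn (hv 0) hsub (hv i)
  · obtain ⟨a, b, c⟩ := N
    simp only [bil] at h0
    have hN'' : ∀ i, a + c * ((p i).re ^ 2 + (p i).im ^ 2) - 2 * b * (p i).re = 2 * (p i).im := by
      intro i
      have := hN' i
      have h1 := (p i).im_ne_zero
      rwa [bil_vec_eq, div_eq_one_iff_eq (by simpa using h1)] at this
    by_cases hc : c = 0
    · subst hc
      have hb : b = 0 := by nlinarith
      subst hb
      have e : ∀ i, (p i).im = a / 2 := fun i => by have := hN'' i; linarith
      exact ⟨_, Or.inr (Or.inl (Or.inl ⟨a / 2, by rw [← e 0]; exact (p 0).im_pos, rfl⟩)), e⟩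
    · have e : ∀ i, ((p i).re - b / c) ^ 2 + (p i).im ^ 2 = 2 / c * (p i).im := by
        intro i
        have := hN'' i
        field_simp
        linear_combination c * this - h0
      have hk : 0 < 2 / c := by
        have h1 := (p 0).im_pos
        have h2 : 0 < 2 / c * (p 0).im := by rw [← e 0]; positivity
        exact pos_of_mul_pos_left h2 h1.le
      exact ⟨_, Or.inr (Or.inl (Or.inr ⟨b / c, 2 / c, hk, rfl⟩)), e⟩
  · have hf : Fut N := fut_of_bil_pos (fut_vec (p 0)) h0 (by rw [bil_comm, hN' 0]; exact one_pos)
    have hs : 0 < √(bil N N) := Real.sqrt_pos.2 h0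
    have hs1 : √(bil N N) < 1 := (Real.sqrt_lt' one_pos).2 (by linarith)
    have e : ∀ i, Real.cosh (dist (p i) (pt N)) = 1 / √(bil N N) := fun i => by
      rw [cosh_dist_eq, bil_comm, vec_pt hf, bil_smul_left, hN' i, mul_one]
    refine ⟨Metric.sphere (pt N) (dist (p 0) (pt N)), Or.inl ⟨_, _, ?_, rfl⟩, fun i => ?_⟩
    · refine dist_pos.2 fun hcon => ?_
      have := e 0
      rw [hcon, dist_self, Real.cosh_zero, eq_div_iff hs.ne'] at this
      linarith
    · rw [Metric.mem_sphere]
      have := (e i).trans (e 0).symm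
      have h1 := Real.cosh_le_cosh.1 this.le
      have h2 := Real.cosh_le_cosh.1 this.ge
      rw [abs_of_nonneg dist_nonneg, abs_of_nonneg dist_nonneg] at h1 h2
      exact le_antisymm h1 h2

end HypPlane

namespace HypPlane
open Filter Topology MeasureTheory

/-! ### Existence of polygons of maximal area -/

lemma bil_reflect (N : ℝ × ℝ × ℝ) (z : ℍ) :
    bil (N.1, -N.2.1, N.2.2) (vec (reflect z)) = bil N (vec z) := by
  rw [bil_vec_eq, bil_vec_eq, reflect_re, reflect_im]
  simp

lemma Coplanar.reflect {v : ℕ → ℍ} (h : Coplanar v) : Coplanar (reflect ∘ v) := by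
  obtain ⟨N, hN⟩ := h
  exact ⟨_, fun i => (bil_reflect N _).trans (hN i)⟩

section Moduli
variable {n : ℕ} [NeZero n] {l : Fin n → ℝ}

lemma ext_restrict {w : ℕ → ℍ} (hw : ∀ k, w (k + n) = w k) : ext (fun i : Fin n => w i) = w := by
  funext k
  have hm := per_mul hw (k / n) (k % n)
  rw [Nat.mod_add_div'] at hm
  simp [ext, Fin.ofNat, hm]

lemma dist_ext (p : ConvexPolygon l) (k : ℕ) :
    dist (ext p.1 k) (ext p.1 (k + 1)) = l (Fin.ofNat n k) := by
  rw [ext_eq_succ, ← p.2.2]; rfl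

/-- A polygon with the given edge lengths, from its periodic sequence of vertices. -/
lemma mem_convexPolygon {p : Fin n → ℍ} (h : CPoly n (ext p))
    (hd : ∀ k, dist (ext p k) (ext p (k + 1)) = l (Fin.ofNat n k)) :
    IsConvexPolygon p ∧ ∀ i, dist (p i) (p (finRotate n i)) = l i := by
  refine ⟨h.isConvexPolygon, fun i => ?_⟩
  have := hd i
  rw [ext_val, ext_succ] at this
  rw [this]
  congr 1
  simp [Fin.ofNat, Nat.mod_eq_of_lt i.2]

lemma area_eq_of_congr {p q : Fin n → ℍ} (hp : CPoly n (ext p)) (hq : CPoly n (ext q)) (g : ℍ ≃ᵢ ℍ)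
    (hg : ∀ i, g (p i) = q i) : area n (ext q) = area n (ext p) := by
  have hb : ∀ j k, bil (vec (ext q j)) (vec (ext q k)) = bil (vec (ext p j)) (vec (ext p k)) := by
    intro j k
    rw [← dist_eq_dist_iff]
    simp only [ext, ← hg]
    exact g.dist_eq _ _
  rw [hp.area_eq, hq.area_eq]
  simp only [hb]

/-- Every convex polygon is congruent to a positively oriented one, which has the same area. -/
lemma exists_positive (hn : 3 ≤ n) (p : ConvexPolygon l) {D : Set ℍ}
    (hD : IsConvexInterior p.1 D) : ∃ q : ConvexPolygon l, (congruence l).r p q ∧ CPoly n (ext q.1) ∧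
      (Coplanar (ext p.1) → Coplanar (ext q.1)) ∧
      volume D = ENNReal.ofReal (area n (ext q.1)) := by
  rcases IsConvexPolygon.cpoly_or hn p.2.1.1 hD with ⟨h, rfl⟩ | ⟨h, e⟩
  · exact ⟨p, (congruence l).iseqv.refl p, h, id, h.volume_inner⟩
  · refine ⟨⟨reflect ∘ p.1, mem_convexPolygon h fun k => ?_⟩, ⟨reflect, fun i => rfl⟩, h,
      fun hc => hc.reflect, ?_⟩
    · rw [ext_comp, Function.comp_apply, Function.comp_apply, reflect.dist_eq, dist_ext]
    · rw [← volume_reflect, e, h.volume_inner]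

/-- A positively oriented polygon can be moved so that its first vertex is `I`. -/
lemma exists_normalized (p : ConvexPolygon l) (hp : CPoly n (ext p.1)) :
    ∃ q : ConvexPolygon l, (congruence l).r p q ∧ CPoly n (ext q.1) ∧
      ext q.1 0 = UpperHalfPlane.I ∧ area n (ext q.1) = area n (ext p.1) := by
  set a := ext p.1 0
  set b := ext p.1 1
  have hab : a ≠ b := by have := hp.edge 0; rwa [zero_add] at this
  obtain ⟨b', hb'⟩ : ∃ b' : ℍ, bil (vec UpperHalfPlane.I) (vec b') = bil (vec a) (vec b) := by
    -- The imaginary axis is a geodesic through `I`, parametrized by arc length through the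
    -- exponential.
    refine ⟨⟨⟨0, Real.exp (dist a b)⟩, Real.exp_pos _⟩, ?_⟩
    have h1 := Real.exp_pos (dist a b)
    rw [← cosh_dist_eq a b, Real.cosh_eq, Real.exp_neg, bil_vec]
    change 1 + ((0 - 0) ^ 2 + (1 - Real.exp (dist a b)) ^ 2) / (2 * 1 * Real.exp (dist a b)) = _
    field_simp
    ring
  have hc : CPoly n (ext (moveEquiv hab hb' ∘ p.1)) := by
    rw [ext_comp]
    refine ⟨hp.three_le, fun k => ?_, fun i j k h1 h2 h3 => ?_, fun i => ?_, ?_⟩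
    · simp only [Function.comp_apply, ext_per]
    · change 0 ≤ ori (move _ _ _ _ _) (move _ _ _ _ _) (move _ _ _ _ _)
      rw [ori_move hab hb']
      exact hp.nonneg i j k h1 h2 h3
    · exact fun h => hp.edge i ((moveEquiv hab hb').injective h)
    · obtain ⟨i, j, k, h⟩ := hp.noncol
      refine ⟨i, j, k, ?_⟩
      change ori (move _ _ _ _ _) (move _ _ _ _ _) (move _ _ _ _ _) ≠ 0
      rwa [ori_move hab hb']
  refine ⟨⟨moveEquiv hab hb' ∘ p.1, mem_convexPolygon hc fun k => ?_⟩,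
    ⟨moveEquiv hab hb', fun i => rfl⟩, hc, move_left hab hb',
    area_eq_of_congr hp hc (moveEquiv hab hb') fun i => rfl⟩
  rw [ext_comp, Function.comp_apply, Function.comp_apply, (moveEquiv hab hb').dist_eq, dist_ext]

lemma continuous_area : Continuous fun p : Fin n → ℍ => area n (ext p) := by
  unfold area
  exact continuous_finsetSum _ fun k _ => continuous_omega (continuous_apply _) (continuous_apply _)

/-- The normalized polygons of area at least `A`. -/
def normalized (l : Fin n → ℝ) (A : ℝ) : Set (Fin n → ℍ) :=
  {p | ext p 0 = UpperHalfPlane.I} ∩ ({p | A ≤ area n (ext p)} ∩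
    (⋂ k, {p | dist (ext p k) (ext p (k + 1)) = l (Fin.ofNat n k)} ∩
    ⋂ i, ⋂ j, ⋂ m, {p | i ≤ j → j ≤ m → m ≤ i + n → 0 ≤ ori (ext p i) (ext p j) (ext p m)}))

/-- All the conditions are closed, and every vertex is within the perimeter of the first one; closed
balls are compact. -/
lemma isCompact_normalized (l : Fin n → ℝ) (A : ℝ) : IsCompact (normalized l A) := by
  have hcl : IsClosed (normalized l A) := by
    have hc : ∀ k, Continuous fun p : Fin n → ℍ => ext p k := fun k => continuous_apply _
    refine (isClosed_eq (hc 0) continuous_const).inter ((isClosed_le continuous_const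
      continuous_area).inter (isClosed_iInter fun k => (isClosed_eq ((hc k).dist (hc (k + 1)))
      continuous_const).inter (isClosed_iInter fun i => isClosed_iInter fun j =>
      isClosed_iInter fun m => ?_)))
    by_cases h : i ≤ j ∧ j ≤ m ∧ m ≤ i + n
    · simp only [h, forall_true_left]
      exact isClosed_le continuous_const (continuous_ori (hc i) (hc j) (hc m))
    · convert isClosed_univ
      rw [Set.eq_univ_iff_forall]
      exact fun p h1 h2 h3 => absurd ⟨h1, h2, h3⟩ h
  refine (isCompact_univ_pi fun _ : Fin n => isCompact_closedBall UpperHalfPlane.I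
    (∑ k ∈ Finset.range n, |l (Fin.ofNat n k)|)).of_isClosed_subset hcl ?_
  rintro p ⟨h0, -, h⟩ i -
  have hd : ∀ k, dist (ext p k) (ext p (k + 1)) = l (Fin.ofNat n k) := fun k =>
    (Set.mem_iInter.1 h k).1
  have h0 : ext p 0 = UpperHalfPlane.I := h0
  rw [Metric.mem_closedBall, dist_comm, ← h0, ← ext_val p i]
  refine (dist_le_range_sum_dist (ext p) i).trans ?_
  refine (Finset.sum_le_sum fun k _ => (hd k).le.trans (le_abs_self _)).trans ?_
  exact Finset.sum_le_sum_of_subset_of_nonneg (Finset.range_mono i.2.le) fun _ _ _ => abs_nonneg _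

/-- The limit cannot degenerate: consecutive vertices stay distinct because `p₀` shows the lengths
positive, and collinear vertices would have area 0. -/
lemma cpoly_of_mem_normalized (hn : 3 ≤ n) {A : ℝ} (hA : 0 < A) {p₀ : ConvexPolygon l}
    (hp₀ : CPoly n (ext p₀.1)) {p : Fin n → ℍ} (hp : p ∈ normalized l A) : CPoly n (ext p) ∧
      ∀ k, dist (ext p k) (ext p (k + 1)) = l (Fin.ofNat n k) := by
  obtain ⟨-, hpA, h⟩ := hp
  have hd : ∀ k, dist (ext p k) (ext p (k + 1)) = l (Fin.ofNat n k) := fun k =>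
    (Set.mem_iInter.1 h k).1
  have hper : ext p n = ext p 0 := by have := ext_per p 0; rwa [zero_add] at this
  refine ⟨⟨hn, ext_per p, fun i j k h1 h2 h3 => ?_, fun i hi => ?_, ?_⟩, hd⟩
  · have := (Set.mem_iInter.1 h 0).2
    exact Set.mem_iInter.1 (Set.mem_iInter.1 (Set.mem_iInter.1 this i) j) k h1 h2 h3
  · have h1 := hd i
    rw [hi, dist_self, ← dist_ext p₀] at h1
    exact (dist_pos.2 (hp₀.edge i)).ne h1
  · by_contra hc
    push Not at hc
    have h0 : area n (ext p) = 0 := by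
      rw [area_eq_sum (ext p 0) hper]
      exact Finset.sum_eq_zero fun k _ => by rw [sarea_eq, hc]; simp
    have : A ≤ area n (ext p) := hpA
    linarith

/-- In a saturated open and closed set of polygons, some inscribed polygon has maximal area. -/
theorem exists_max (hn : 3 ≤ n) {V : Set (ConvexPolygon l)} (hV : IsClopen V)
    (hsat : ∀ p q, (congruence l).r p q → p ∈ V → q ∈ V) (hne : V.Nonempty) :
    ∃ p ∈ V, CPoly n (ext p.1) ∧ Coplanar (ext p.1) ∧
      ∀ q ∈ V, CPoly n (ext q.1) → area n (ext q.1) ≤ area n (ext p.1) := by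
  obtain ⟨p₁, hp₁⟩ := hne
  obtain ⟨D, hD⟩ := p₁.2.1.2
  obtain ⟨p₀, hr, hc₀, -, -⟩ := exists_positive hn p₁ hD
  have hp₀ := hsat _ _ hr hp₁
  -- Only polygons of area at least `A` can compete for the maximum, and these form a compact set
  -- after normalization.
  have hA := hc₀.area_pos
  set A := area n (ext p₀.1)
  let f : normalized l A → ConvexPolygon l := fun p => ⟨p.1,
    mem_convexPolygon (cpoly_of_mem_normalized hn hA hc₀ p.2).1
      (cpoly_of_mem_normalized hn hA hc₀ p.2).2⟩
  have hf : Continuous f := continuous_subtype_val.subtype_mk _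
  have : CompactSpace (normalized l A) := isCompact_iff_compactSpace.1 (isCompact_normalized l A)
  have hK : IsCompact (f ⁻¹' V) := (hV.1.preimage hf).isCompact
  have hmem : ∀ q ∈ V, CPoly n (ext q.1) → A ≤ area n (ext q.1) → ∃ r ∈ f ⁻¹' V,
      area n (ext r.1) = area n (ext q.1) := by
    intro q hq hqc hqA
    obtain ⟨r, hr, hrc, hr0, hra⟩ := exists_normalized q hqc
    have hrn : r.1 ∈ normalized l A := ⟨hr0, hqA.trans hra.ge, Set.mem_iInter.2 fun k =>
      ⟨dist_ext r k, Set.mem_iInter.2 fun i => Set.mem_iInter.2 fun j => Set.mem_iInter.2 fun m =>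
        hrc.nonneg i j m⟩⟩
    exact ⟨⟨r.1, hrn⟩, hsat _ _ hr hq, hra⟩
  obtain ⟨r₀, hr₀, -⟩ := hmem p₀ hp₀ hc₀ le_rfl
  obtain ⟨m, hm, hmax⟩ := hK.exists_isMaxOn ⟨r₀, hr₀⟩
    (continuous_area.comp continuous_subtype_val).continuousOn
  have hmc := (cpoly_of_mem_normalized hn hA hc₀ m.2).1
  have hall : ∀ q ∈ V, CPoly n (ext q.1) → area n (ext q.1) ≤ area n (ext m.1) := by
    intro q hq hqc
    rcases le_total A (area n (ext q.1)) with h | h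
    · obtain ⟨r, hr, e⟩ := hmem q hq hqc h
      rw [← e]; exact hmax hr
    · exact h.trans m.2.2.1
  refine ⟨f m, hm, hmc, ?_, hall⟩
  by_contra hcop
  have hi := hmc.improvable hcop
  -- `V` is open, so polygons close enough to `m` remain in `V`; one of larger area contradicts
  -- maximality.
  obtain ⟨O, hO, rfl⟩ := isOpen_induced_iff.1 hV.2
  have hR : Continuous fun (w : ℕ → ℍ) (i : Fin n) => w i :=
    continuous_pi fun i => continuous_apply _
  have hev : ∀ᶠ w in 𝓝 (ext m.1), (fun i : Fin n => w i) ∈ O := by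
    refine hR.continuousAt.eventually (hO.mem_nhds ?_)
    have : (fun i : Fin n => ext m.1 i) = m.1 := by funext i; exact ext_val _ i
    change (fun i : Fin n => ext m.1 i) ∈ O
    rw [this]; exact hm
  obtain ⟨w, ⟨hw, hwb, hwa⟩, hwO⟩ := (hi.and_eventually hev).exists
  have hext := ext_restrict hw.per
  have hq : IsConvexPolygon (fun i : Fin n => w i) ∧
      ∀ i, dist ((fun i : Fin n => w i) i) ((fun i : Fin n => w i) (finRotate n i)) = l i := by
    refine mem_convexPolygon (by rwa [hext]) fun k => ?_
    rw [hext, ← (cpoly_of_mem_normalized hn hA hc₀ m.2).2 k, dist_eq_dist_iff]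
    exact hwb k
  have := hall ⟨_, hq⟩ hwO (by rwa [hext])
  rw [hext] at this
  exact absurd hwa (not_lt.2 this)

/-- Two inscribed polygons with the same edge lengths are congruent. -/
theorem congruent_of_inscribed (hn : 3 ≤ n) {p q : ConvexPolygon l} (hp : IsInscribed p.1)
    (hq : IsInscribed q.1) : (congruence l).r p q := by
  obtain ⟨D, hD⟩ := p.2.1.2
  obtain ⟨E, hE⟩ := q.2.1.2
  obtain ⟨p', hpp, hpc, hpl, -⟩ := exists_positive hn p hD
  obtain ⟨q', hqq, hqc, hql, -⟩ := exists_positive hn q hE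
  obtain ⟨g, hg⟩ := hpc.congruent_of_coplanar hqc (hpl hp.coplanar) (hql hq.coplanar) fun k => by
    rw [← dist_eq_dist_iff, dist_ext, dist_ext]
  refine (congruence l).iseqv.trans hpp ((congruence l).iseqv.trans ?_
    ((congruence l).iseqv.symm hqq))
  exact ⟨g, fun i => by have := hg i; rwa [ext_val, ext_val] at this⟩

end Moduli

end HypPlane

/-! ### The main theorem. -/

theorem mainTheorem3 (n : ℕ) (hn : 3 ≤ n) (l : Fin n → ℝ)
    (hne : Nonempty (HypPlane.ModuliSpace l)) :
    (∃! P : HypPlane.ModuliSpace l, ∃ p : HypPlane.ConvexPolygon l,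
      Quotient.mk (HypPlane.congruence l) p = P ∧ HypPlane.IsInscribed p.1) ∧
    (∀ p q : HypPlane.ConvexPolygon l, HypPlane.IsInscribed p.1 →
      ∀ D E : Set HypPlane, HypPlane.IsConvexInterior p.1 D → HypPlane.IsConvexInterior q.1 E →
        MeasureTheory.volume E ≤ MeasureTheory.volume D) ∧
    ConnectedSpace (HypPlane.ModuliSpace l) := by
  have : NeZero n := ⟨by omega⟩
  obtain ⟨P₀⟩ := hne
  obtain ⟨p₀, -⟩ := Quotient.exists_rep P₀
  obtain ⟨m, -, hmc, hml, hmax⟩ := HypPlane.exists_max hn (isClopen_univ (X := HypPlane.ConvexPolygon l))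
    (fun _ _ _ _ => Set.mem_univ _) ⟨p₀, Set.mem_univ _⟩
  refine ⟨⟨Quotient.mk _ m, ⟨m, rfl, hmc.isInscribed hml⟩, ?_⟩, ?_, ?_⟩
  · rintro P ⟨p, rfl, hp⟩
    exact Quotient.sound (HypPlane.congruent_of_inscribed hn hp (hmc.isInscribed hml))
  · intro p q hp D E hD hE
    obtain ⟨p', -, hpc, hpl, hpv⟩ := HypPlane.exists_positive hn p hD
    obtain ⟨q', -, hqc, -, hqv⟩ := HypPlane.exists_positive hn q hE
    obtain ⟨g, hg⟩ := HypPlane.congruent_of_inscribed hn (hmc.isInscribed hml)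
      (hpc.isInscribed (hpl hp.coplanar))
    rw [hpv, hqv, HypPlane.area_eq_of_congr hmc hpc g hg]
    exact ENNReal.ofReal_le_ofReal (hmax q' (Set.mem_univ _) hqc)
  · have hpre : PreconnectedSpace (HypPlane.ModuliSpace l) := by
      rw [preconnectedSpace_iff_clopen]
      intro U hU
      by_contra hcon
      push Not at hcon
      obtain ⟨⟨P, hP⟩, hUne⟩ := hcon
      obtain ⟨Q, hQ⟩ := (Set.ne_univ_iff_exists_notMem U).1 hUne
      obtain ⟨p, rfl⟩ := Quotient.exists_rep P
      obtain ⟨q, rfl⟩ := Quotient.exists_rep Q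
      -- Every nonempty clopen set of classes contains an inscribed one, which rigidity identifies
      -- with the class of `m`. A clopen set and its complement cannot both be nonempty.
      have key : ∀ W : Set (HypPlane.ModuliSpace l), IsClopen W → W.Nonempty →
          Quotient.mk _ m ∈ W := by
        rintro W hW ⟨R, hR⟩
        obtain ⟨r, rfl⟩ := Quotient.exists_rep R
        obtain ⟨s, hs, hsc, hsl, -⟩ := HypPlane.exists_max hn
          (V := Quotient.mk (HypPlane.congruence l) ⁻¹' W)
          (hW.preimage continuous_quotient_mk') (fun a b hab ha => by
            have : Quotient.mk (HypPlane.congruence l) a = Quotient.mk _ b := Quotient.sound hab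
            change Quotient.mk _ b ∈ W
            rw [← this]; exact ha) ⟨r, hR⟩
        have : Quotient.mk (HypPlane.congruence l) s = Quotient.mk _ m := Quotient.sound
          (HypPlane.congruent_of_inscribed hn (hsc.isInscribed hsl) (hmc.isInscribed hml))
        rw [← this]; exact hs
      exact key Uᶜ hU.compl ⟨_, hQ⟩ (key U hU ⟨_, hP⟩)
    exact { hpre with toNonempty := ⟨P₀⟩ }
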